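/- Let $\Bbbk$ be $\mathbb R$ or $\mathbb C$, and let $V$ be a $\mathbb Z$-graded vector space over $\Bbbk$, finite-dimensional in each degree, with an odd symplectic form $\omega$ of degree $-1$ (a nondegenerate graded-antisymmetric bilinear form with $\omega(v,w)=0$ for homogeneous $v,w$ unless $|v|+|w|=1$). Let $(e_i)$ be a homogeneous basis of $V$, $(\phi^i)$ the dual basis, $|\phi^i|=-|e_i|$, and $(\omega^{ij})$ the inverse of the matrix $\omega_{ij}=\omega(e_i,e_j)$. *Functions.* A monomial $\hbar^g\phi^{i_1}\cdots\phi^{i_n}$ with $g\in\mathbb Z$, $n\ge 0$ has genus $g$, polynomial degree $n$, weight $2g+n$, and degree $\sum_k|\phi^{i_k}|$. Let $\mathcal F$ be the graded commutative algebra of series of monomials in the graded commuting variables $\phi^i$ whose weights are bounded below and which have only finitely many terms in each weight; it contains $\mathcal F(V)=\prod_{g,n\ge 0}(V^*)^{\odot n}\hbar^g$ and the space $\mathcal F_+(V)$ of those series all of whose terms have weight at least $1$. On $\mathcal F$ put $$\Delta F=\tfrac12\sum_{i,j}(-1)^{|\phi^i|}\omega^{ij}\frac{\partial_L^2F}{\partial\phi^i\partial\phi^j},\qquad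 \{F,G\}=\sum_{i,j}\frac{\partial_RF}{\partial\phi^i}\,\omega^{ij}\,\frac{\partial_LG}{\partial\phi^j},\qquad T_S(F)=\hbar\Delta F+\{S,F\}.$$ The quantum master equation for $S$ is $\hbar\Delta S+\frac12\{S,S\}=0$. *Homotopies.* Let $S_{\mathrm{free}}$ be homogeneous of genus $0$, polynomial degree $2$ and degree $0$, with $\{S_{\mathrm{free}},S_{\mathrm{free}}\}=0$. Let $A(t)$, $B(t)$, $t\in[0,1]$, be such that $A(t)/\hbar$ and $B(t)/\hbar$ lie in $\mathcal F_+(V)\otimes C^\infty([0,1])$ (that is, in each weight $w\ge 1$ they are finite sums of monomials with coefficients smooth on $[0,1]$), $A(t)$ has degree $0$, $B(t)$ has degree $-1$, and $e^{(A(t)+B(t)\,dt)/\hbar}$ is a homotopy between $A(0)$ and $A(1)$: $$\big(\{S_{\mathrm{free}},-\}+\hbar\Delta+d_{\mathrm{dR}}\big)\,e^{(A(t)+B(t)\,dt)/\hbar}=0 .$$ *Formal maps and morphisms.* A formal map $\Phi:U\to V$ between odd symplectic vector spaces is given by its pullback $\Phi^*$, an $\hbar$-linear homomorphism from the algebra $\mathcal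 F$ of $V$ to that of $U$ which preserves the degree and does not lower the weight. For solutions $S_U,S_V$ of the quantum master equation, of degree $0$ and each the sum of a quadratic term of genus $0$ and of terms of weight at least $3$, a quantum $L_\infty$-morphism $(U,\omega_U,S_U)\to(V,\omega_V,S_V)$ is a formal map $\Phi$ with $\Phi^*\{F,G\}_V=\{\Phi^*F,\Phi^*G\}_U$ and $\Phi^*\circ T_{S_V}=T_{S_U}\circ\Phi^*$. **Statement.** The time-dependent vector field $X(t)=\{-B(t),-\}$ has a flow on $[0,1]$: a family of formal maps $\Phi_t:V\to V$ with $\Phi_0=\mathrm{id}$ and $\frac{d}{dt}\Phi_t^*=\Phi_t^*\circ X(t)$. For every such flow: 1. $\Phi_t^*\circ T_{S_{\mathrm{free}}+A(t)}=T_{S_{\mathrm{free}}+A(0)}\circ\Phi_t^*$ on $\mathcal F$ for all $t\in[0,1]$. 2. $S_{\mathrm{free}}+A(0)$ and $S_{\mathrm{free}}+A(1)$ solve the quantum master equation, and $\Phi_1$ is a quantum $L_\infty$-morphism $(V,\omega,S_{\mathrm{free}}+A(0))\to(V,\omega,S_{\mathrm{free}}+A(1))$. 3. If $B(t)\in\mathcal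 F(V)$ for all $t\in[0,1]$, then $\Phi_t^*$ maps $\mathcal F(V)$ to $\mathcal F(V)$ for all $t\in[0,1]$. -/

import Mathlib

open scoped ContDiff

noncomputable section

namespace BV

/-! ### Odd symplectic vector spaces -/

/-- A degree-wise finite-dimensional `ℤ`-graded vector space `V` with an odd symplectic form of
degree `-1`: a nondegenerate graded-antisymmetric bilinear form which vanishes on homogeneous
vectors `v, w` unless `|v| + |w| = 1`. -/
structure OddSymplecticSpace (𝕜 V : Type*) [RCLike 𝕜] [AddCommGroup V] [Module 𝕜 V] where
  grading : ℤ → Submodule 𝕜 V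
  isInternal : DirectSum.IsInternal grading
  finite : ∀ a, FiniteDimensional 𝕜 (grading a)
  form : V →ₗ[𝕜] V →ₗ[𝕜] 𝕜
  form_degree : ∀ a b : ℤ, a + b ≠ 1 → ∀ v ∈ grading a, ∀ w ∈ grading b, form v w = 0
  form_antisymm : ∀ a b : ℤ, ∀ v ∈ grading a, ∀ w ∈ grading b,
    form v w = -(((a * b).negOnePow : ℤ) : 𝕜) * form w v
  form_nondegenerate : ∀ v, (∀ w, form v w = 0) → v = 0

/-- A basis `(e_i)` of homogeneous vectors. -/
structure HomogeneousBasis {𝕜 V : Type*} [RCLike 𝕜] [AddCommGroup V] [Module 𝕜 V]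
    (X : OddSymplecticSpace 𝕜 V) (ι : Type*) where
  basis : Module.Basis ι 𝕜 V
  deg : ι → ℤ
  mem : ∀ i, basis i ∈ X.grading (deg i)

namespace OddSymplecticSpace

variable {𝕜 V ι : Type*} [RCLike 𝕜] [AddCommGroup V] [Module 𝕜 V]

theorem form_swap (X : OddSymplecticSpace 𝕜 V) {a b : ℤ} {v w : V} (hv : v ∈ X.grading a)
    (hw : w ∈ X.grading b) : X.form v w = - X.form w v := by
  by_cases h : a + b = 1
  · have he : Even (a * b) := by
      obtain rfl : b = 1 - a := by omega
      rcases Int.even_or_odd a with ha | ha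
      · exact ha.mul_right _
      · exact (Odd.sub_odd odd_one ha).mul_left _
    rw [X.form_antisymm a b v hv w hw, Int.negOnePow_even _ he]
    simp
  · rw [X.form_degree a b h v hv w hw, X.form_degree b a (by omega) w hw v hv, neg_zero]

theorem eq_zero_of_pairing (X : OddSymplecticSpace 𝕜 V) {a : ℤ} {v : V}
    (hv : v ∈ X.grading a) (h : ∀ w ∈ X.grading (1 - a), X.form w v = 0) : v = 0 := by
  apply X.form_nondegenerate
  intro w
  have hw : w ∈ ⨆ b, X.grading b := by
    rw [X.isInternal.submodule_iSup_eq_top]; trivial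
  induction hw using Submodule.iSup_induction' with
  | mem b x hx =>
    by_cases hb : b = 1 - a
    · subst hb
      rw [X.form_swap hv hx, h x hx, neg_zero]
    · exact X.form_degree a b (by omega) v hv x hx
  | zero => simp
  | add x y _ _ hx hy => simp [hx, hy]

theorem exists_dual (X : OddSymplecticSpace 𝕜 V) (b : HomogeneousBasis X ι) (j : ι) :
    ∃ u : V, ∀ i, X.form (b.basis i) u = b.basis.coord j (b.basis i) := by
  have key : ∀ a : ℤ, ∃ f : X.grading (1 - a) →ₗ[𝕜] Module.Dual 𝕜 (X.grading a),
      Function.Injective f ∧ ∀ u v, f u v = X.form v u := by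
    intro a
    refine ⟨((X.form.domRestrict₁₂ (X.grading a) (X.grading (1 - a)))).flip, ?_, fun u v => rfl⟩
    rw [← LinearMap.ker_eq_bot, LinearMap.ker_eq_bot']
    intro u hu
    apply Subtype.ext
    refine X.eq_zero_of_pairing u.2 fun w hw => ?_
    have hw' : w ∈ X.grading a := by
      have h1 : 1 - (1 - a) = a := by ring
      rwa [h1] at hw
    exact LinearMap.congr_fun hu ⟨w, hw'⟩
  have := X.finite
  have hle : ∀ a : ℤ, Module.finrank 𝕜 (X.grading (1 - a)) ≤ Module.finrank 𝕜 (X.grading a) := by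
    intro a
    obtain ⟨f, hf, -⟩ := key a
    calc _ ≤ Module.finrank 𝕜 (Module.Dual 𝕜 (X.grading a)) :=
          LinearMap.finrank_le_finrank_of_injective hf
      _ = _ := Subspace.dual_finrank_eq
  obtain ⟨f, hf, hfu⟩ := key (b.deg j)
  have hdim : Module.finrank 𝕜 (X.grading (1 - b.deg j)) =
      Module.finrank 𝕜 (Module.Dual 𝕜 (X.grading (b.deg j))) := by
    rw [Subspace.dual_finrank_eq]
    refine le_antisymm (hle _) ?_
    have h2 := hle (1 - b.deg j)
    have h1 : 1 - (1 - b.deg j) = b.deg j := by ring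
    rwa [h1] at h2
  have hsurj : Function.Surjective f :=
    (LinearMap.injective_iff_surjective_of_finrank_eq_finrank hdim).1 hf
  obtain ⟨u, hu⟩ := hsurj ((b.basis.coord j).domRestrict (X.grading (b.deg j)))
  refine ⟨u, fun i => ?_⟩
  by_cases h : b.deg i = b.deg j
  · have hm : b.basis i ∈ X.grading (b.deg j) := h ▸ b.mem i
    have := LinearMap.congr_fun hu ⟨b.basis i, hm⟩
    rw [hfu] at this
    exact this
  · rw [X.form_degree _ _ (by omega) _ (b.mem i) _ u.2]
    have : i ≠ j := fun hij => h (by rw [hij])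
    simp [Module.Basis.coord_apply, this]

/-- The vector `e^j` with `ω(e_i, e^j) = δ_i^j`. -/
def dualVector (X : OddSymplecticSpace 𝕜 V) (b : HomogeneousBasis X ι) (j : ι) : V :=
  (X.exists_dual b j).choose

/-- The inverse matrix `ω^{ij}` of `ω_{ij} = ω(e_i, e_j)`, read off from
`e^j = ∑ i, ω^{ij} e_i`, i.e. `∑ i, ω_{ki} ω^{ij} = ω(e_k, e^j) = δ_k^j`. -/
def invForm (X : OddSymplecticSpace 𝕜 V) (b : HomogeneousBasis X ι) (i j : ι) : 𝕜 :=
  b.basis.coord i (X.dualVector b j)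

theorem sum_form_mul_invForm [DecidableEq ι] (X : OddSymplecticSpace 𝕜 V)
    (b : HomogeneousBasis X ι) (k j : ι) :
    ((b.basis.repr (X.dualVector b j)).sum fun i _ =>
      X.form (b.basis k) (b.basis i) * X.invForm b i j) = if k = j then 1 else 0 := by
  have h := (X.exists_dual b j).choose_spec k
  change X.form (b.basis k) (X.dualVector b j) = _ at h
  rw [Module.Basis.coord_apply, Module.Basis.repr_self, Finsupp.single_apply] at h
  rw [← h]
  conv_rhs => rw [← b.basis.linearCombination_repr (X.dualVector b j),
    Finsupp.linearCombination_apply, Finsupp.sum, map_sum]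
  simp only [Finsupp.sum, map_smul, smul_eq_mul, invForm, Module.Basis.coord_apply]
  exact Finset.sum_congr rfl fun i _ => mul_comm _ _

end OddSymplecticSpace

/-! ### The graded symmetric algebra over `𝕜[ħ, ħ⁻¹]` -/

section Polynomials

variable (𝕜 : Type*) [RCLike 𝕜] {ι : Type*} (d : ι → ℤ)

/-- The sign `(-1)^n`, as a scalar of `𝕜[ħ, ħ⁻¹]`; the variable `T 1` is `ħ`. -/
def sgn (n : ℤ) : LaurentPolynomial 𝕜 := ((n.negOnePow : ℤ) : LaurentPolynomial 𝕜)

/-- Graded commutativity `φ^i φ^j = (-1)^{|φ^i||φ^j|} φ^j φ^i` of generators of degrees `d`. -/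
inductive GradedComm :
    FreeAlgebra (LaurentPolynomial 𝕜) ι → FreeAlgebra (LaurentPolynomial 𝕜) ι → Prop
  | swap (i j : ι) : GradedComm
      (FreeAlgebra.ι (LaurentPolynomial 𝕜) i * FreeAlgebra.ι (LaurentPolynomial 𝕜) j)
      (sgn 𝕜 (d i * d j) •
        (FreeAlgebra.ι (LaurentPolynomial 𝕜) j * FreeAlgebra.ι (LaurentPolynomial 𝕜) i))

/-- The graded symmetric algebra on generators `φ^i` of degrees `d i`, with coefficients in
`𝕜[ħ, ħ⁻¹]`: if `φ` is the dual basis of `V`, this is `⨁_{g ∈ ℤ, n ≥ 0} (V^*)^{⊙ n} ħ^g`. -/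
def GradedSym : Type _ := RingQuot (GradedComm 𝕜 d)

instance : Semiring (GradedSym 𝕜 d) :=
  inferInstanceAs (Semiring (RingQuot (GradedComm 𝕜 d)))

instance : Algebra (LaurentPolynomial 𝕜) (GradedSym 𝕜 d) :=
  inferInstanceAs (Algebra (LaurentPolynomial 𝕜) (RingQuot (GradedComm 𝕜 d)))

instance : Ring (GradedSym 𝕜 d) := Algebra.semiringToRing (LaurentPolynomial 𝕜)

instance : Algebra 𝕜 (GradedSym 𝕜 d) :=
  inferInstanceAs (Algebra 𝕜 (RingQuot (GradedComm 𝕜 d)))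

instance : IsScalarTower 𝕜 (LaurentPolynomial 𝕜) (GradedSym 𝕜 d) :=
  inferInstanceAs (IsScalarTower 𝕜 (LaurentPolynomial 𝕜) (RingQuot (GradedComm 𝕜 d)))

/-- The quotient map from the free algebra. -/
def mkGr : FreeAlgebra (LaurentPolynomial 𝕜) ι →ₐ[LaurentPolynomial 𝕜] GradedSym 𝕜 d :=
  RingQuot.mkAlgHom (LaurentPolynomial 𝕜) (GradedComm 𝕜 d)

variable {𝕜} {d}

theorem sgn_mul_self (n : ℤ) : sgn 𝕜 n * sgn 𝕜 n = 1 := by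
  rw [sgn, ← Int.cast_mul, ← Units.val_mul, Int.units_mul_self]; simp

theorem sgn_add (m n : ℤ) : sgn 𝕜 (m + n) = sgn 𝕜 m * sgn 𝕜 n := by
  simp [sgn, Int.negOnePow_add]

variable (𝕜 d) in
/-- The generator `φ^i`. -/
def gen (i : ι) : GradedSym 𝕜 d :=
  mkGr 𝕜 d (FreeAlgebra.ι (LaurentPolynomial 𝕜) i)

theorem gen_mul_gen (i j : ι) :
    gen 𝕜 d i * gen 𝕜 d j = sgn 𝕜 (d i * d j) • (gen 𝕜 d j * gen 𝕜 d i) := by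
  simp only [gen, ← map_mul, ← map_smul]
  exact RingQuot.mkAlgHom_rel _ (GradedComm.swap i j)

/-- The algebra homomorphism with prescribed, graded commuting, values on the generators. -/
def liftGen {M : Type*} [Semiring M] [Algebra (LaurentPolynomial 𝕜) M] (f : ι → M)
    (hf : ∀ i j, f i * f j = sgn 𝕜 (d i * d j) • (f j * f i)) :
    GradedSym 𝕜 d →ₐ[LaurentPolynomial 𝕜] M :=
  RingQuot.liftAlgHom (LaurentPolynomial 𝕜) ⟨FreeAlgebra.lift (LaurentPolynomial 𝕜) f, by
    rintro _ _ ⟨i, j⟩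
    simpa using hf i j⟩

@[simp] theorem liftGen_gen {M : Type*} [Semiring M] [Algebra (LaurentPolynomial 𝕜) M] (f : ι → M)
    (hf : ∀ i j, f i * f j = sgn 𝕜 (d i * d j) • (f j * f i)) (i : ι) :
    liftGen f hf (gen 𝕜 d i) = f i :=
  (RingQuot.liftAlgHom_mkAlgHom_apply _ _ _ _).trans (by simp)

/-- The parity automorphism `F ↦ (-1)^{|F|} F`. -/
def parity : GradedSym 𝕜 d →ₐ[LaurentPolynomial 𝕜] GradedSym 𝕜 d :=
  liftGen (fun i => sgn 𝕜 (d i) • gen 𝕜 d i) (fun i j => by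
    rw [smul_mul_smul_comm, smul_mul_smul_comm, gen_mul_gen, smul_comm, mul_comm (sgn 𝕜 (d i))])

open Classical in
/-- The matrix form `F ↦ (F', ∂_L F/∂φ^i; 0, F)`, `F' = (-1)^{|φ^i||F|} F`, of the left
derivative: multiplicativity is `∂_L(FG) = (∂_L F) G + (-1)^{|φ^i||F|} F ∂_L G`. -/
def leftHom (i : ι) : GradedSym 𝕜 d →ₐ[LaurentPolynomial 𝕜]
    Matrix (Fin 2) (Fin 2) (GradedSym 𝕜 d) :=
  liftGen (fun j => !![sgn 𝕜 (d i * d j) • gen 𝕜 d j, if j = i then 1 else 0; 0, gen 𝕜 d j])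
    (fun j k => by
      have h := gen_mul_gen (𝕜 := 𝕜) (d := d) j k
      ext a b
      fin_cases a <;> fin_cases b
      · simp only [Fin.zero_eta, Matrix.smul_apply, Matrix.mul_apply, Fin.sum_univ_two]
        simp [smul_smul, h, mul_comm, mul_left_comm]
      · simp only [Fin.zero_eta, Fin.mk_one, Matrix.smul_apply, Matrix.mul_apply,
          Fin.sum_univ_two]
        by_cases hj : j = i <;> by_cases hk : k = i <;>
          simp [hj, hk, smul_add, smul_smul, sgn_mul_self, mul_comm, add_comm]
      · simp [Matrix.mul_apply, Fin.sum_univ_two]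
      · simp [Matrix.mul_apply, Fin.sum_univ_two, h])

open Classical in
/-- The matrix form `F ↦ (F, ∂_R F/∂φ^i; 0, F')`, `F' = (-1)^{|φ^i||F|} F`, of the right
derivative: multiplicativity is `∂_R(FG) = F ∂_R G + (-1)^{|φ^i||G|} (∂_R F) G`. -/
def rightHom (i : ι) : GradedSym 𝕜 d →ₐ[LaurentPolynomial 𝕜]
    Matrix (Fin 2) (Fin 2) (GradedSym 𝕜 d) :=
  liftGen (fun j => !![gen 𝕜 d j, if j = i then 1 else 0; 0, sgn 𝕜 (d i * d j) • gen 𝕜 d j])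
    (fun j k => by
      have h := gen_mul_gen (𝕜 := 𝕜) (d := d) j k
      ext a b
      fin_cases a <;> fin_cases b
      · simp only [Fin.zero_eta, Matrix.smul_apply, Matrix.mul_apply, Fin.sum_univ_two]
        simp [h]
      · simp only [Fin.zero_eta, Fin.mk_one, Matrix.smul_apply, Matrix.mul_apply,
          Fin.sum_univ_two]
        by_cases hj : j = i <;> by_cases hk : k = i <;>
          simp [hj, hk, smul_add, smul_smul, sgn_mul_self, mul_comm, add_comm]
      · simp [Matrix.mul_apply, Fin.sum_univ_two]
      · simp only [Fin.mk_one, Matrix.smul_apply, Matrix.mul_apply, Fin.sum_univ_two]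
        simp [smul_smul, h, mul_comm, mul_left_comm])

/-- The left partial derivative `∂_L/∂φ^i`. -/
def leftD (i : ι) : GradedSym 𝕜 d →ₗ[LaurentPolynomial 𝕜] GradedSym 𝕜 d :=
  Matrix.entryLinearMap (LaurentPolynomial 𝕜) (GradedSym 𝕜 d) 0 1 ∘ₗ (leftHom i).toLinearMap

/-- The right partial derivative `∂_R/∂φ^i`. -/
def rightD (i : ι) : GradedSym 𝕜 d →ₗ[LaurentPolynomial 𝕜] GradedSym 𝕜 d :=
  Matrix.entryLinearMap (LaurentPolynomial 𝕜) (GradedSym 𝕜 d) 0 1 ∘ₗ (rightHom i).toLinearMap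

end Polynomials

/-! ### Genus, polynomial degree, weight -/

section Weights

variable {𝕜 : Type*} [RCLike 𝕜] {ι : Type*} {d : ι → ℤ}

variable (𝕜 d) in
/-- The monomial `ħ^g φ^{i_1} ⋯ φ^{i_n}`, where `l = [i_1, …, i_n]`. -/
def mono (g : ℤ) (l : List ι) : GradedSym 𝕜 d :=
  (LaurentPolynomial.T g : LaurentPolynomial 𝕜) • (l.map (gen 𝕜 d)).prod

variable (𝕜 d) in
/-- The span of the monomials of genus `g` and with variables `l` such that `Q g l`. -/
def monoSpan (Q : ℤ → List ι → Prop) : Submodule 𝕜 (GradedSym 𝕜 d) :=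
  Submodule.span 𝕜 {x | ∃ g l, Q g l ∧ x = mono 𝕜 d g l}

variable (𝕜 d) in
/-- The elements of weight `w`: sums of monomials of genus `g` and polynomial degree `n`
with `2 g + n = w`. -/
def weightPart (w : ℤ) : Submodule 𝕜 (GradedSym 𝕜 d) :=
  monoSpan 𝕜 d fun g l => 2 * g + l.length = w

theorem mono_mul_mono (g h : ℤ) (l m : List ι) :
    mono 𝕜 d g l * mono 𝕜 d h m = mono 𝕜 d (g + h) (l ++ m) := by
  simp only [mono, smul_mul_smul_comm, ← LaurentPolynomial.T_add, List.map_append,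
    List.prod_append]

theorem mono_mem {Q : ℤ → List ι → Prop} {g : ℤ} {l : List ι} (h : Q g l) :
    mono 𝕜 d g l ∈ monoSpan 𝕜 d Q :=
  Submodule.subset_span ⟨g, l, h, rfl⟩

theorem mul_mem_weightPart {v w : ℤ} {x y : GradedSym 𝕜 d} (hx : x ∈ weightPart 𝕜 d v)
    (hy : y ∈ weightPart 𝕜 d w) : x * y ∈ weightPart 𝕜 d (v + w) := by
  induction hx, hy using Submodule.span_induction₂ with
  | mem_mem x y hx hy =>
    obtain ⟨g, l, hl, rfl⟩ := hx
    obtain ⟨h, m, hm, rfl⟩ := hy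
    rw [mono_mul_mono]
    exact mono_mem (by simp only [List.length_append]; push_cast; omega)
  | zero_left y _ => simp
  | zero_right x _ => simp
  | add_left x y z _ _ _ h1 h2 => rw [add_mul]; exact add_mem h1 h2
  | add_right x y z _ _ _ h1 h2 => rw [mul_add]; exact add_mem h1 h2
  | smul_left r x y _ _ h => rw [smul_mul_assoc]; exact Submodule.smul_mem _ _ h
  | smul_right r x y _ _ h => rw [mul_smul_comm]; exact Submodule.smul_mem _ _ h

theorem T_smul_mem_weightPart {w : ℤ} (g : ℤ) {x : GradedSym 𝕜 d} (hx : x ∈ weightPart 𝕜 d w) :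
    (LaurentPolynomial.T g : LaurentPolynomial 𝕜) • x ∈ weightPart 𝕜 d (2 * g + w) := by
  have h : mono 𝕜 d g [] ∈ weightPart 𝕜 d (2 * g) := mono_mem (by simp)
  have := mul_mem_weightPart h hx
  simpa [mono] using this

theorem sgn_smul_mem (S : Submodule 𝕜 (GradedSym 𝕜 d)) (n : ℤ) {x : GradedSym 𝕜 d} (hx : x ∈ S) :
    sgn 𝕜 n • x ∈ S := by
  rcases Int.even_or_odd n with h | h
  · simpa [sgn, Int.negOnePow_even _ h] using hx
  · simpa [sgn, Int.negOnePow_odd _ h, neg_smul] using neg_mem hx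

theorem parity_mem {w : ℤ} {x : GradedSym 𝕜 d} (hx : x ∈ weightPart 𝕜 d w) :
    parity x ∈ weightPart 𝕜 d w := by
  have key : ∀ l : List ι, ∃ n, parity (l.map (gen 𝕜 d)).prod = sgn 𝕜 n • (l.map (gen 𝕜 d)).prod := by
    intro l
    induction l with
    | nil => exact ⟨0, by simp [sgn]⟩
    | cons i l ih =>
      obtain ⟨n, hn⟩ := ih
      refine ⟨d i + n, ?_⟩
      rw [List.map_cons, List.prod_cons, map_mul, hn, sgn_add, ← smul_mul_smul_comm]
      simp [parity]
  induction hx using Submodule.span_induction with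
  | mem x hx =>
    obtain ⟨g, l, hl, rfl⟩ := hx
    obtain ⟨n, hn⟩ := key l
    rw [mono, map_smul, hn, smul_comm]
    exact sgn_smul_mem _ _ (mono_mem hl)
  | zero => simp
  | add x y _ _ h1 h2 => rw [map_add]; exact add_mem h1 h2
  | smul r x _ h =>
    rw [algebra_compatible_smul (LaurentPolynomial 𝕜) r x, map_smul, ← algebra_compatible_smul]
    exact Submodule.smul_mem _ _ h

theorem mem_of_monomials {D : GradedSym 𝕜 d →ₗ[LaurentPolynomial 𝕜] GradedSym 𝕜 d}
    (hD : ∀ l : List ι, D (l.map (gen 𝕜 d)).prod ∈ weightPart 𝕜 d (l.length - 1))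
    {w : ℤ} {x : GradedSym 𝕜 d} (hx : x ∈ weightPart 𝕜 d w) : D x ∈ weightPart 𝕜 d (w - 1) := by
  induction hx using Submodule.span_induction with
  | mem x hx =>
    obtain ⟨g, l, hl, rfl⟩ := hx
    rw [mono, map_smul]
    have := T_smul_mem_weightPart g (hD l)
    rwa [show 2 * g + ((l.length : ℤ) - 1) = w - 1 by omega] at this
  | zero => simp
  | add x y _ _ h1 h2 => rw [map_add]; exact add_mem h1 h2
  | smul r x _ h =>
    rw [algebra_compatible_smul (LaurentPolynomial 𝕜) r x, map_smul, ← algebra_compatible_smul]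
    exact Submodule.smul_mem _ _ h

theorem prod_mem (l : List ι) : (l.map (gen 𝕜 d)).prod ∈ weightPart 𝕜 d l.length := by
  have : mono 𝕜 d 0 l ∈ weightPart 𝕜 d l.length := mono_mem (by simp)
  simpa [mono] using this

theorem gen_mem (i : ι) : gen 𝕜 d i ∈ weightPart 𝕜 d 1 := by simpa using prod_mem (𝕜 := 𝕜) (d := d) [i]

theorem leftHom_one_one (i : ι) (l : List ι) :
    leftHom i (l.map (gen 𝕜 d)).prod 1 1 = (l.map (gen 𝕜 d)).prod := by
  induction l with
  | nil => simp
  | cons j l ih =>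
    rw [List.map_cons, List.prod_cons, map_mul, Matrix.mul_apply, Fin.sum_univ_two, ih]
    simp [leftHom]

theorem leftD_mem (i : ι) {w : ℤ} {x : GradedSym 𝕜 d} (hx : x ∈ weightPart 𝕜 d w) :
    leftD i x ∈ weightPart 𝕜 d (w - 1) := by
  classical
  refine mem_of_monomials (fun l => ?_) hx
  change leftHom i _ 0 1 ∈ _
  induction l with
  | nil => simp
  | cons j l ih =>
    rw [List.map_cons, List.prod_cons, map_mul, Matrix.mul_apply, Fin.sum_univ_two,
      leftHom_one_one]
    have h1 := mul_mem_weightPart (gen_mem (𝕜 := 𝕜) (d := d) j) ih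
    rw [show (1 : ℤ) + (l.length - 1) = ((j :: l).length : ℤ) - 1 by simp] at h1
    have h2 : (l.map (gen 𝕜 d)).prod ∈ weightPart 𝕜 d (((j :: l).length : ℤ) - 1) := by
      simpa using prod_mem (𝕜 := 𝕜) (d := d) l
    refine add_mem ?_ ?_
    · simpa [leftHom] using sgn_smul_mem _ _ h1
    · by_cases h : j = i <;> simp [leftHom, h] at h2 ⊢
      exact h2

theorem rightHom_one_one (i : ι) (l : List ι) :
    ∃ n, rightHom i (l.map (gen 𝕜 d)).prod 1 1 = sgn 𝕜 n • (l.map (gen 𝕜 d)).prod := by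
  induction l with
  | nil => exact ⟨0, by simp [sgn]⟩
  | cons j l ih =>
    obtain ⟨n, hn⟩ := ih
    refine ⟨d i * d j + n, ?_⟩
    rw [List.map_cons, List.prod_cons, map_mul, Matrix.mul_apply, Fin.sum_univ_two, hn, sgn_add,
      ← smul_mul_smul_comm]
    simp [rightHom]

theorem rightD_mem (i : ι) {w : ℤ} {x : GradedSym 𝕜 d} (hx : x ∈ weightPart 𝕜 d w) :
    rightD i x ∈ weightPart 𝕜 d (w - 1) := by
  classical
  refine mem_of_monomials (fun l => ?_) hx
  change rightHom i _ 0 1 ∈ _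
  induction l with
  | nil => simp
  | cons j l ih =>
    obtain ⟨n, hn⟩ := rightHom_one_one (𝕜 := 𝕜) (d := d) i l
    rw [List.map_cons, List.prod_cons, map_mul, Matrix.mul_apply, Fin.sum_univ_two, hn]
    have h1 := mul_mem_weightPart (gen_mem (𝕜 := 𝕜) (d := d) j) ih
    rw [show (1 : ℤ) + (l.length - 1) = ((j :: l).length : ℤ) - 1 by simp] at h1
    have h2 : (l.map (gen 𝕜 d)).prod ∈ weightPart 𝕜 d (((j :: l).length : ℤ) - 1) := by
      simpa using prod_mem (𝕜 := 𝕜) (d := d) l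
    refine add_mem ?_ ?_
    · simpa [rightHom] using h1
    · by_cases h : j = i <;> simp [rightHom, h] at h2 ⊢
      exact sgn_smul_mem _ _ h2

end Weights
/-! ### Formal functions -/

section Functions

variable (𝕜 : Type*) [RCLike 𝕜] {ι : Type*} (d : ι → ℤ)

/-- The algebra of formal functions: series `F = ∑_w F_w`, where `F_w` has weight `w` and is a
finite sum of monomials `ħ^g φ^{i_1} ⋯ φ^{i_n}` (with `g ∈ ℤ`, `2 g + n = w`), and where the
weight is bounded below. It contains `∏_{g, n ≥ 0} (V^*)^{⊙ n} ħ^g` (see `IsRegular`) and the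
series of positive weight (see `WeightGE`). -/
def funAlg : Subalgebra 𝕜 (HahnSeries ℤ (GradedSym 𝕜 d)) where
  carrier := {F | ∀ w, F.coeff w ∈ weightPart 𝕜 d w}
  mul_mem' := by
    intro F G hF hG w
    rw [HahnSeries.coeff_mul]
    refine Submodule.sum_mem _ fun p hp => ?_
    rw [← (Finset.mem_antidiagonal.1 hp).2.2]
    exact mul_mem_weightPart (hF _) (hG _)
  add_mem' := by
    intro F G hF hG w
    rw [HahnSeries.coeff_add]
    exact add_mem (hF w) (hG w)
  algebraMap_mem' := by
    intro r w
    rw [HahnSeries.algebraMap_apply, HahnSeries.C_apply]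
    by_cases h : w = 0
    · subst h
      rw [HahnSeries.coeff_single_same, Algebra.algebraMap_eq_smul_one]
      refine Submodule.smul_mem _ _ ?_
      simpa using prod_mem (𝕜 := 𝕜) (d := d) []
    · rw [HahnSeries.coeff_single_of_ne h]
      exact zero_mem _

/-- The type of formal functions. -/
def FormalFun : Type _ := funAlg 𝕜 d

instance : Ring (FormalFun 𝕜 d) := inferInstanceAs (Ring (funAlg 𝕜 d))

instance : Algebra 𝕜 (FormalFun 𝕜 d) := inferInstanceAs (Algebra 𝕜 (funAlg 𝕜 d))

variable {𝕜 d}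

/-- The component of weight `w`. -/
def comp (F : FormalFun 𝕜 d) (w : ℤ) : GradedSym 𝕜 d :=
  ((funAlg 𝕜 d).val F).coeff w

theorem comp_mem (F : FormalFun 𝕜 d) (w : ℤ) : comp F w ∈ weightPart 𝕜 d w := F.2 w

theorem exists_comp_eq_zero (F : FormalFun 𝕜 d) : ∃ N, ∀ w < N, comp F w = 0 :=
  ⟨_, fun _ hw => HahnSeries.coeff_eq_zero_of_lt_order hw⟩

/-- The formal function with given components. -/
def ofComp (f : ℤ → GradedSym 𝕜 d) (hb : ∃ N, ∀ w < N, f w = 0)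
    (hf : ∀ w, f w ∈ weightPart 𝕜 d w) : FormalFun 𝕜 d :=
  ⟨HahnSeries.ofSuppBddBelow f (by
    obtain ⟨N, hN⟩ := hb
    exact ⟨N, fun w hw => not_lt.1 fun h => hw (hN w h)⟩), hf⟩

@[simp] theorem comp_ofComp (f : ℤ → GradedSym 𝕜 d) (hb) (hf) (w : ℤ) :
    comp (ofComp f hb hf) w = f w := rfl

variable (𝕜 d) in
/-- The function `ħ^g`, for `g ∈ ℤ`. -/
def hbar (g : ℤ) : FormalFun 𝕜 d :=
  ⟨HahnSeries.single (2 * g) (mono 𝕜 d g []), by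
    intro w
    by_cases h : w = 2 * g
    · subst h
      rw [HahnSeries.coeff_single_same]
      exact mono_mem (by simp)
    · rw [HahnSeries.coeff_single_of_ne h]
      exact zero_mem _⟩

/-- `F` has only components of weight at least `k`. -/
def WeightGE (F : FormalFun 𝕜 d) (k : ℤ) : Prop := ∀ w < k, comp F w = 0

/-- `F` is homogeneous of degree `n`, where `|φ^i| = d i` and `|ħ| = 0`. -/
def HasDegree (F : FormalFun 𝕜 d) (n : ℤ) : Prop :=
  ∀ w, comp F w ∈ monoSpan 𝕜 d fun _ l => (l.map d).sum = n

/-- `F` has no negative powers of `ħ`, i.e. `F ∈ ∏_{g, n ≥ 0} (V^*)^{⊙ n} ħ^g`. -/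
def IsRegular (F : FormalFun 𝕜 d) : Prop :=
  ∀ w, comp F w ∈ monoSpan 𝕜 d fun g l => 0 ≤ g ∧ 2 * g + l.length = w

/-- The sum `∑_k y_k` of functions `y_k` of weight at least `k`. -/
def weightSum (y : ℕ → FormalFun 𝕜 d) : FormalFun 𝕜 d :=
  ofComp (fun w => if 0 ≤ w then ∑ k ∈ Finset.range (w.toNat + 1), comp (y k) w else 0)
    ⟨0, fun w hw => if_neg (not_le.2 hw)⟩
    (fun w => by
      split_ifs
      · exact Submodule.sum_mem _ fun k _ => comp_mem _ _
      · exact zero_mem _)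

/-- The parity automorphism `F ↦ (-1)^{|F|} F`. -/
def parityFun (F : FormalFun 𝕜 d) : FormalFun 𝕜 d :=
  ofComp (fun w => parity (comp F w))
    (by
      obtain ⟨N, hN⟩ := exists_comp_eq_zero F
      exact ⟨N, fun w hw => by rw [hN w hw, map_zero]⟩)
    (fun w => parity_mem (comp_mem F w))

/-! The Batalin-Vilkovisky operations, for a matrix `ω^{ij}`, first on polynomials. -/

/-- `½ ∑_{i,j} (-1)^{|φ^i|} ω^{ij} ∂²_L x / ∂φ^i ∂φ^j`. -/
def polyLaplacian (Ω : ι → ι → 𝕜) (x : GradedSym 𝕜 d) : GradedSym 𝕜 d :=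
  (2⁻¹ : 𝕜) • ∑ᶠ p : ι × ι, sgn 𝕜 (d p.1) • Ω p.1 p.2 • leftD p.1 (leftD p.2 x)

/-- `∑_{i,j} (∂_R x / ∂φ^i) ω^{ij} (∂_L y / ∂φ^j)`. -/
def polyBracket (Ω : ι → ι → 𝕜) (x y : GradedSym 𝕜 d) : GradedSym 𝕜 d :=
  ∑ᶠ p : ι × ι, Ω p.1 p.2 • (rightD p.1 x * leftD p.2 y)

theorem finsum_mem_submodule {α : Type*} (S : Submodule 𝕜 (GradedSym 𝕜 d))
    (f : α → GradedSym 𝕜 d) (hf : ∀ a, f a ∈ S) : ∑ᶠ a, f a ∈ S :=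
  finsum_induction (· ∈ S) S.zero_mem (fun _ _ => S.add_mem) hf

theorem polyLaplacian_mem (Ω : ι → ι → 𝕜) {w : ℤ} {x : GradedSym 𝕜 d}
    (hx : x ∈ weightPart 𝕜 d (w + 2)) : polyLaplacian Ω x ∈ weightPart 𝕜 d w := by
  refine Submodule.smul_mem _ _ (finsum_mem_submodule _ _ fun p => sgn_smul_mem _ _ ?_)
  refine Submodule.smul_mem _ _ ?_
  have := leftD_mem p.1 (leftD_mem p.2 hx)
  rwa [show w + 2 - 1 - 1 = w by ring] at this

theorem polyBracket_mem (Ω : ι → ι → 𝕜) {v w : ℤ} {x y : GradedSym 𝕜 d}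
    (hx : x ∈ weightPart 𝕜 d v) (hy : y ∈ weightPart 𝕜 d (w + 2 - v)) :
    polyBracket Ω x y ∈ weightPart 𝕜 d w := by
  refine finsum_mem_submodule _ _ fun p => Submodule.smul_mem _ _ ?_
  have := mul_mem_weightPart (rightD_mem p.1 hx) (leftD_mem p.2 hy)
  rwa [show v - 1 + (w + 2 - v - 1) = w by ring] at this

/-- The operator `Δ`; it lowers the weight by `2`. -/
def laplacianOf (Ω : ι → ι → 𝕜) (F : FormalFun 𝕜 d) : FormalFun 𝕜 d :=
  ofComp (fun w => polyLaplacian Ω (comp F (w + 2)))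
    (by
      obtain ⟨N, hN⟩ := exists_comp_eq_zero F
      exact ⟨N - 2, fun w hw => by simp [hN (w + 2) (by omega), polyLaplacian]⟩)
    (fun w => polyLaplacian_mem Ω (comp_mem F _))

/-- The bracket `{F, G}`; it lowers the weight by `2`. -/
def bracketOf (Ω : ι → ι → 𝕜) (F G : FormalFun 𝕜 d) : FormalFun 𝕜 d :=
  ofComp (fun w => ∑ᶠ v : ℤ, polyBracket Ω (comp F v) (comp G (w + 2 - v)))
    (by
      obtain ⟨M, hM⟩ := exists_comp_eq_zero F
      obtain ⟨N, hN⟩ := exists_comp_eq_zero G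
      refine ⟨M + N - 2, fun w hw => ?_⟩
      rw [← finsum_zero (α := ℤ)]
      refine finsum_congr fun v => ?_
      rcases lt_or_ge v M with hv | hv
      · simp [hM v hv, polyBracket]
      · simp [hN (w + 2 - v) (by omega), polyBracket])
    (fun w => finsum_mem_submodule _ _ fun v => polyBracket_mem Ω (comp_mem F _) (comp_mem G _))

end Functions
/-! ### The Batalin-Vilkovisky algebra of an odd symplectic vector space -/

section BVAlgebra

variable {𝕜 V ι : Type*} [RCLike 𝕜] [AddCommGroup V] [Module 𝕜 V] {X : OddSymplecticSpace 𝕜 V}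

/-- The degrees of the dual basis `φ^i`. -/
def HomogeneousBasis.dualDeg (b : HomogeneousBasis X ι) (i : ι) : ℤ := -b.deg i

/-- The formal functions on `V`, in the coordinates `φ^i` dual to a homogeneous basis of `V`. -/
abbrev Functions (b : HomogeneousBasis X ι) : Type _ := FormalFun 𝕜 b.dualDeg

variable {b : HomogeneousBasis X ι}

/-- The Batalin-Vilkovisky Laplacian `Δ`. -/
def laplacian (F : Functions b) : Functions b := laplacianOf (X.invForm b) F

/-- The bracket `{F, G}`. -/
def bracket (F G : Functions b) : Functions b := bracketOf (X.invForm b) F G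

/-- The twisted Laplacian `T_S(F) = ħ Δ F + {S, F}`. -/
def twisted (S F : Functions b) : Functions b := hbar 𝕜 _ 1 * laplacian F + bracket S F

/-- The quantum master equation `ħ Δ S + ½ {S, S} = 0`. -/
def QuantumMasterEquation (S : Functions b) : Prop :=
  hbar 𝕜 _ 1 * laplacian S + (2⁻¹ : 𝕜) • bracket S S = 0

/-- `F` is homogeneous of genus `0` and polynomial degree `2`. -/
def IsQuadratic (x : GradedSym 𝕜 b.dualDeg) : Prop :=
  x ∈ monoSpan 𝕜 b.dualDeg fun g l => g = 0 ∧ l.length = 2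

/-- A free action: quadratic, of genus `0` and of degree `0`, with `{S, S} = 0`. -/
structure IsFreeAction (S : Functions b) : Prop where
  comp_eq_zero : ∀ w, w ≠ 2 → comp S w = 0
  quadratic : IsQuadratic (comp S 2)
  degree : HasDegree S 0
  bracket_self : bracket S S = 0

/-- A quantum `L_∞` structure: a solution `S` of degree `0` of the quantum master equation which
is the sum of a quadratic part of genus `0` and of terms of weight at least `3`. -/
structure IsQuantumLInfty (S : Functions b) : Prop where
  weight : WeightGE S 2
  quadratic : IsQuadratic (comp S 2)
  degree : HasDegree S 0
  master : QuantumMasterEquation S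

end BVAlgebra

/-! ### Paths, differential forms on `[0, 1]`, homotopies -/

section Homotopies

variable {𝕜 : Type*} [RCLike 𝕜] {ι : Type*} {d : ι → ℤ}

/-- `f`, restricted to `[0, 1]`, is an element of `C^∞([0, 1]) ⊗ E`. -/
def SmoothPath {E : Type*} [AddCommGroup E] [Module 𝕜 E] (f : ℝ → E) : Prop :=
  ∃ (n : ℕ) (c : Fin n → ℝ → 𝕜) (x : Fin n → E),
    (∀ k, ContDiffOn ℝ ∞ (c k) (Set.Icc 0 1)) ∧ ∀ t ∈ Set.Icc (0 : ℝ) 1, f t = ∑ k, c k t • x k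

/-- The path `F` of formal functions has the derivative `F'` at `t ∈ [0, 1]`: in every weight,
every linear functional of `F` has the corresponding derivative. -/
def HasPathDeriv (F : ℝ → FormalFun 𝕜 d) (F' : FormalFun 𝕜 d) (t : ℝ) : Prop :=
  ∀ (w : ℤ) (L : GradedSym 𝕜 d →ₗ[𝕜] 𝕜),
    HasDerivWithinAt (fun s => L (comp (F s) w)) (L (comp F' w)) (Set.Icc 0 1) t

/-- The product `(A + B dt)(A' + B' dt) = A A' + (A B' + B (-1)^{|A'|} A') dt`, where
`(A, B)` stands for `A + B dt`. -/
def formMul (x y : FormalFun 𝕜 d × FormalFun 𝕜 d) : FormalFun 𝕜 d × FormalFun 𝕜 d :=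
  (x.1 * y.1, x.1 * y.2 + x.2 * parityFun y.1)

/-- The powers of `A + B dt`. -/
def formPow (x : FormalFun 𝕜 d × FormalFun 𝕜 d) : ℕ → FormalFun 𝕜 d × FormalFun 𝕜 d
  | 0 => (1, 0)
  | k + 1 => formMul (formPow x k) x

/-- The exponential `∑_k (A + B dt)^k / k!`, for `A` and `B` of weight at least `1`. -/
def formExp (x : FormalFun 𝕜 d × FormalFun 𝕜 d) : FormalFun 𝕜 d × FormalFun 𝕜 d :=
  (weightSum fun k => ((k.factorial : 𝕜)⁻¹) • (formPow x k).1,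
    weightSum fun k => ((k.factorial : 𝕜)⁻¹) • (formPow x k).2)

variable {V : Type*} [AddCommGroup V] [Module 𝕜 V] {X : OddSymplecticSpace 𝕜 V}
  {b : HomogeneousBasis X ι}

/-- `e^{(A(t) + B(t) dt)/ħ}`. -/
def homotopyExp (A B : ℝ → Functions b) (t : ℝ) : Functions b × Functions b :=
  formExp (hbar 𝕜 _ (-1) * A t, hbar 𝕜 _ (-1) * B t)

/-- `e^{(A(t) + B(t) dt)/ħ}` is a homotopy between `A(0)` and `A(1)`: `A(t)/ħ` and `B(t)/ħ` have
positive weight and depend smoothly on `t ∈ [0, 1]`, `A(t)` has degree `0`, `B(t)` has degree `-1`,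
and `({S_free, -} + ħ Δ + d_dR) e^{(A(t) + B(t) dt)/ħ} = 0`. The last equation is stated
for the components without and with `dt`; `d_dR f = (∂f/∂t) dt` without sign, as the component
without `dt` has degree `0`. -/
structure IsHomotopy (Sfree : Functions b) (A B : ℝ → Functions b) : Prop where
  smooth_A : ∀ w, SmoothPath (𝕜 := 𝕜) fun t => comp (A t) w
  smooth_B : ∀ w, SmoothPath (𝕜 := 𝕜) fun t => comp (B t) w
  weight_A : ∀ t ∈ Set.Icc (0 : ℝ) 1, WeightGE (A t) 3
  weight_B : ∀ t ∈ Set.Icc (0 : ℝ) 1, WeightGE (B t) 3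
  degree_A : ∀ t ∈ Set.Icc (0 : ℝ) 1, HasDegree (A t) 0
  degree_B : ∀ t ∈ Set.Icc (0 : ℝ) 1, HasDegree (B t) (-1)
  closed : ∀ t ∈ Set.Icc (0 : ℝ) 1, twisted Sfree (homotopyExp A B t).1 = 0
  closed_dt : ∀ t ∈ Set.Icc (0 : ℝ) 1, ∃ E' : Functions b,
    HasPathDeriv (fun s => (homotopyExp A B s).1) E' t ∧
      twisted Sfree (homotopyExp A B t).2 + E' = 0

end Homotopies

/-! ### Formal maps, flows, morphisms -/

section Morphisms

variable {𝕜 U V ι κ : Type*} [RCLike 𝕜] [AddCommGroup U] [Module 𝕜 U] [AddCommGroup V]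
  [Module 𝕜 V] {X : OddSymplecticSpace 𝕜 U} {Y : OddSymplecticSpace 𝕜 V}

/-- A formal, possibly non-linear, map `Φ : U → V` of graded vector spaces, given by the pullback
`Φ^*` of functions: a homomorphism of algebras which is `ħ`-linear, preserves the degree and
does not lower the weight. Such a `Φ^*` is the substitution `φ^i ↦ Φ^*(φ^i)` of the coordinates
of `V` by formal functions on `U` of degree `|φ^i|` and positive weight. -/
structure FormalMap (b : HomogeneousBasis X ι) (c : HomogeneousBasis Y κ) where
  pullback : Functions c →ₐ[𝕜] Functions b
  map_hbar : pullback (hbar 𝕜 _ 1) = hbar 𝕜 _ 1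
  map_degree : ∀ F n, HasDegree F n → HasDegree (pullback F) n
  map_weight : ∀ F k, WeightGE F k → WeightGE (pullback F) k

/-- `Φ` is a quantum `L_∞`-morphism from `(U, S_U)` to `(V, S_V)`: a Poisson map with
`Φ^* ∘ T_{S_V} = T_{S_U} ∘ Φ^*`. -/
structure IsQuantumLInftyMorphism {b : HomogeneousBasis X ι} {c : HomogeneousBasis Y κ}
    (SU : Functions b) (SV : Functions c) (Φ : FormalMap b c) : Prop where
  source : IsQuantumLInfty SU
  target : IsQuantumLInfty SV
  poisson : ∀ F G, Φ.pullback (bracket F G) = bracket (Φ.pullback F) (Φ.pullback G)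
  intertwines : ∀ F, Φ.pullback (twisted SV F) = twisted SU (Φ.pullback F)

/-- `Φ_t` is the flow on `[0, 1]` of the time-dependent vector field `X(t) = {-B(t), -}`:
`Φ_0 = id` and `(d/dt) Φ_t^* = Φ_t^* ∘ X(t)`. -/
structure IsFlow {b : HomogeneousBasis X ι} (B : ℝ → Functions b) (Φ : ℝ → FormalMap b b) :
    Prop where
  zero : ∀ F, (Φ 0).pullback F = F
  deriv : ∀ F, ∀ t ∈ Set.Icc (0 : ℝ) 1,
    HasPathDeriv (fun s => (Φ s).pullback F) ((Φ t).pullback (bracket (-B t) F)) t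

end Morphisms

end BV

end

/-! Write `T_t` for the twisted Laplacian of `S_free + A(t)` and `X_t = {-B(t), -}`. The operator
`Δ` is of second order with the bracket as its defect, so `Δ e^a = e^a (Δa + ½{a,a})` for even `a`
of positive weight (`laplacianOf_expFun`). Moreover `e^a` is `1` plus terms of positive weight and
can be cancelled (`eq_zero_of_expFun_mul`). Hence the homotopy equation loses its exponentials. Its
part without `dt` becomes the quantum master equation for `S_free + A(t)`
(`IsHomotopy.isQuantumLInfty`); here `Δ S_free = 0` because `S_free` is quadratic and even. Its `dt`
part becomes `A' = -T_t B` (`IsHomotopy.deriv_eq`).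

Applying `Δ² = 0` to products shows that `Δ` is compatible with `{B, -}` for odd `B`, and that `{B,
-}` satisfies the Jacobi identity. Together these give `T_t X_t - X_t T_t = {T_t(-B), -} = {A', -}`
(`twisted_bracket`). Therefore the defect `D_t(F) = Φ_t^* T_t F - T_0 Φ_t^* F` satisfies `D_0 = 0`
and `(d/dt) D_t(F) = D_t(X_t F)`.

Such an equation forces `D = 0` with no estimates. As `B` has weight at least `3` and the bracket
lowers the weight by `2`, `X_t` raises the weight by at least `1`. In a fixed weight, finitely many
applications of `X_t` reach functions whose defect vanishes there, and integrating back removes the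
defect of `F` (`mem_of_hasPathDeriv`). The same principle yields uniqueness of the flow, its
compatibility with products and brackets, and preservation of degree and of regularity. Existence is
Picard iteration, which becomes stationary in each weight (`exists_isFlowFamily`).

No topology on functions is needed. In each weight a smooth path is a finite sum of vectors with
smooth scalar coefficients, and derivatives are tested on all linear functionals. An operator that
shifts weights by a bounded amount (`IsFiltered`) computes each output component from finitely many
input components. This reduces identities to polynomials and justifies differentiating term by term.
-/

noncomputable section

namespace BV

/-! ### Derivatives and signs in the graded symmetric algebra -/

section GradedSymCalculus

variable {𝕜 : Type*} [RCLike 𝕜] {ι : Type*} {d : ι → ℤ}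

@[simp] theorem sgn_zero : sgn 𝕜 0 = 1 := by simp [sgn]

theorem sgn_even {n : ℤ} (h : Even n) : sgn 𝕜 n = 1 := by simp [sgn, Int.negOnePow_even _ h]

theorem sgn_odd {n : ℤ} (h : Odd n) : sgn 𝕜 n = -1 := by simp [sgn, Int.negOnePow_odd _ h]

/-- Induction on elements of the graded symmetric algebra, one generator at a time. -/
theorem gradedSym_induction {P : GradedSym 𝕜 d → Prop} (one : P 1)
    (gen_mul : ∀ i x, P x → P (gen 𝕜 d i * x)) (add : ∀ x y, P x → P y → P (x + y))
    (smul : ∀ (r : LaurentPolynomial 𝕜) x, P x → P (r • x)) (x : GradedSym 𝕜 d) : P x := by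
  have key : ∀ z : FreeAlgebra (LaurentPolynomial 𝕜) ι, ∀ y, P y → P (mkGr 𝕜 d z * y) := by
    intro z
    induction z using FreeAlgebra.induction with
    | grade0 r =>
      intro y hy
      rw [AlgHom.commutes, ← Algebra.smul_def]
      exact smul r y hy
    | grade1 i => exact fun y hy => gen_mul i y hy
    | mul a b ha hb => intro y hy; rw [map_mul, mul_assoc]; exact ha _ (hb _ hy)
    | add a b ha hb => intro y hy; rw [map_add, add_mul]; exact add _ _ (ha _ hy) (hb _ hy)
  obtain ⟨z, rfl⟩ := RingQuot.mkAlgHom_surjective (LaurentPolynomial 𝕜) (GradedComm 𝕜 d) x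
  have := key z 1 one
  rwa [mul_one] at this

/-- The automorphism `F ↦ (-1)^{n |F|} F`. -/
def tw (n : ℤ) : GradedSym 𝕜 d →ₐ[LaurentPolynomial 𝕜] GradedSym 𝕜 d :=
  liftGen (fun i => sgn 𝕜 (n * d i) • gen 𝕜 d i) (fun i j => by
    rw [smul_mul_smul_comm, smul_mul_smul_comm, gen_mul_gen, smul_comm, mul_comm (sgn 𝕜 (n * d i))])

@[simp] theorem tw_gen (n : ℤ) (i : ι) : tw n (gen 𝕜 d i) = sgn 𝕜 (n * d i) • gen 𝕜 d i := by
  simp [tw]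

theorem tw_one_eq_parity (x : GradedSym 𝕜 d) : tw 1 x = parity x := by
  simp [tw, parity]

theorem tw_tw (m n : ℤ) (x : GradedSym 𝕜 d) : tw m (tw n x) = tw (m + n) x := by
  induction x using gradedSym_induction with
  | one => simp
  | gen_mul i x h =>
    simp only [map_mul, h, tw_gen, map_smul, smul_smul, add_mul, sgn_add]
    rw [mul_comm]
  | add x y hx hy => simp [hx, hy]
  | smul r x h => simp [h]

theorem tw_even {n : ℤ} (hn : Even n) (x : GradedSym 𝕜 d) : tw n x = x := by
  induction x using gradedSym_induction with
  | one => simp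
  | gen_mul i x h => simp [h, sgn_even (hn.mul_right (d i))]
  | add x y hx hy => simp [hx, hy]
  | smul r x h => simp [h]

theorem tw_odd {n : ℤ} (hn : Odd n) (x : GradedSym 𝕜 d) : tw n x = parity x := by
  obtain ⟨k, rfl⟩ := hn
  rw [← tw_tw, tw_even (even_two_mul k), tw_one_eq_parity]

/-- The matrices are upper triangular with the twist and the identity on the diagonal, so
multiplicativity of the upper right entry is the graded Leibniz rule of `leftD_mul`. -/
theorem leftHom_zero_zero (i : ι) (x : GradedSym 𝕜 d) :
    leftHom i x 1 0 = 0 ∧ leftHom i x 1 1 = x ∧ leftHom i x 0 0 = tw (d i) x := by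
  induction x using gradedSym_induction with
  | one => simp
  | gen_mul j x h =>
    obtain ⟨h1, h2, h3⟩ := h
    simp only [map_mul, Matrix.mul_apply, Fin.sum_univ_two, h1, h2, h3]
    simp [leftHom]
  | add x y hx hy => simp [hx, hy]
  | smul r x h => simp [h]

theorem rightHom_one_zero (i : ι) (x : GradedSym 𝕜 d) :
    rightHom i x 1 0 = 0 ∧ rightHom i x 0 0 = x ∧ rightHom i x 1 1 = tw (d i) x := by
  induction x using gradedSym_induction with
  | one => simp
  | gen_mul j x h =>
    obtain ⟨h1, h2, h3⟩ := h
    simp only [map_mul, Matrix.mul_apply, Fin.sum_univ_two, h1, h2, h3]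
    simp [rightHom]
  | add x y hx hy => simp [hx, hy]
  | smul r x h => simp [h]

theorem leftD_mul (i : ι) (x y : GradedSym 𝕜 d) :
    leftD i (x * y) = leftD i x * y + tw (d i) x * leftD i y := by
  change leftHom i (x * y) 0 1 = leftHom i x 0 1 * y + tw (d i) x * leftHom i y 0 1
  rw [map_mul, Matrix.mul_apply, Fin.sum_univ_two, (leftHom_zero_zero i x).2.2,
    (leftHom_zero_zero i y).2.1, add_comm]

theorem rightD_mul (i : ι) (x y : GradedSym 𝕜 d) :
    rightD i (x * y) = x * rightD i y + rightD i x * tw (d i) y := by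
  change rightHom i (x * y) 0 1 = x * rightHom i y 0 1 + rightHom i x 0 1 * tw (d i) y
  rw [map_mul, Matrix.mul_apply, Fin.sum_univ_two, (rightHom_one_zero i x).2.1,
    (rightHom_one_zero i y).2.2]

@[simp] theorem leftD_one (i : ι) : leftD i (1 : GradedSym 𝕜 d) = 0 := by
  change leftHom i 1 0 1 = 0
  simp

@[simp] theorem rightD_one (i : ι) : rightD i (1 : GradedSym 𝕜 d) = 0 := by
  change rightHom i 1 0 1 = 0
  simp

open Classical in
theorem leftD_gen (i j : ι) : leftD i (gen 𝕜 d j) = if j = i then 1 else 0 := by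
  change leftHom i (gen 𝕜 d j) 0 1 = _
  simp [leftHom]

open Classical in
theorem rightD_gen (i j : ι) : rightD i (gen 𝕜 d j) = if j = i then 1 else 0 := by
  change rightHom i (gen 𝕜 d j) 0 1 = _
  simp [rightHom]

theorem leftD_tw (i : ι) (n : ℤ) (x : GradedSym 𝕜 d) :
    leftD i (tw n x) = sgn 𝕜 (n * d i) • tw n (leftD i x) := by
  classical
  induction x using gradedSym_induction with
  | one => simp
  | gen_mul j x h =>
    simp only [map_mul, leftD_mul, tw_gen, map_smul, map_add, smul_add, leftD_gen, h,
      smul_mul_assoc, mul_smul_comm]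
    by_cases hj : j = i
    · subst hj
      simp only [if_true, one_mul, map_one, smul_smul]
      congr 2; ring
    · simp only [if_neg hj, zero_mul, map_zero, smul_zero, zero_add, smul_smul]
      congr 1; ring
  | add x y hx hy => simp [hx, hy]
  | smul r x h => simp [h, smul_comm r]

theorem tw_leftD (i : ι) (n : ℤ) (x : GradedSym 𝕜 d) :
    tw n (leftD i x) = sgn 𝕜 (n * d i) • leftD i (tw n x) := by
  rw [leftD_tw, smul_smul, sgn_mul_self, one_smul]

/-- Moving the removed generator from the right end to the left costs only a sign, so all later sign
computations can be done with left derivatives. -/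
theorem rightD_eq (i : ι) (x : GradedSym 𝕜 d) :
    rightD i x = sgn 𝕜 (d i) • leftD i (tw (d i) x) := by
  classical
  induction x using gradedSym_induction with
  | one => simp
  | gen_mul j x h =>
    simp only [map_mul, rightD_mul, leftD_mul, tw_gen, map_smul, smul_add, leftD_gen, rightD_gen, h,
      smul_mul_assoc, mul_smul_comm, smul_smul]
    by_cases hj : j = i
    · subst hj
      have h1 : sgn 𝕜 (d j) * sgn 𝕜 (d j * d j) = 1 := by
        rw [← sgn_add]
        refine sgn_even ?_
        have := Int.even_mul_succ_self (d j)
        rwa [mul_add, mul_one, add_comm] at this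
      have h2 : sgn 𝕜 (d j) * (sgn 𝕜 (d j * d j) * sgn 𝕜 (d j * d j)) = sgn 𝕜 (d j) := by
        rw [sgn_mul_self, mul_one]
      simp [h1, h2, add_comm]
    · simp [hj, sgn_mul_self]
  | add x y hx hy => simp [hx, hy]
  | smul r x h => simp [h, smul_comm r]

theorem leftD_comm (i j : ι) (x : GradedSym 𝕜 d) :
    leftD i (leftD j x) = sgn 𝕜 (d i * d j) • leftD j (leftD i x) := by
  classical
  induction x using gradedSym_induction with
  | one => simp
  | gen_mul k x h =>
    have e1 := leftD_gen (𝕜 := 𝕜) (d := d) i k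
    have e2 := leftD_gen (𝕜 := 𝕜) (d := d) j k
    simp only [leftD_mul, map_add, e1, e2, tw_gen, map_smul, smul_mul_assoc, smul_add]
    by_cases hi : k = i <;> by_cases hj : k = j
    · subst hi; subst hj
      -- When both derivatives hit the new generator, the two sides differ by `D` against `sgn (d k
      -- * d k) • D`. The induction hypothesis identifies these, but it is of the form `D = sgn _ •
      -- D` and has to be applied to one occurrence only.
      generalize hD : leftD k (leftD k x) = D at *
      nth_rewrite 1 [h]
      simp only [if_true, one_mul, map_one, smul_smul, sgn_mul_self, leftD_one, zero_add, zero_mul,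
        smul_zero, mul_smul_comm]
      simp only [one_smul]
      abel
    · subst hi
      simp [hj, smul_smul, h, mul_comm (d j)]
    · subst hj
      simp [hi, smul_smul, h, ← mul_assoc, sgn_mul_self]
    · simp only [hi, hj, if_false, map_zero, zero_mul, smul_zero, zero_add, smul_smul, h,
        mul_smul_comm]
      congr 1
      ring
  | add x y hx hy => simp [hx, hy]
  | smul r x h => simp [h, smul_comm r]

/-- The sign for moving `x` past a generator depends only on the parity of `x`; move `x` past the
generators of `y` one at a time. -/
theorem mul_comm_of_parity {n : ℤ} {x : GradedSym 𝕜 d} (hx : parity x = sgn 𝕜 n • x)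
    (y : GradedSym 𝕜 d) : x * y = tw n y * x := by
  induction y using gradedSym_induction with
  | one => simp
  | gen_mul i y h =>
    have h1 : ∀ z : GradedSym 𝕜 d, z * gen 𝕜 d i = gen 𝕜 d i * tw (d i) z := by
      intro z
      induction z using gradedSym_induction with
      | one => simp
      | gen_mul j z hz =>
        rw [mul_assoc, hz, ← mul_assoc, gen_mul_gen, map_mul, tw_gen, smul_mul_assoc,
          smul_mul_assoc, mul_smul_comm, mul_assoc, mul_comm (d j)]
      | add x y hx hy => simp [add_mul, mul_add, hx, hy]
      | smul r x h => simp [h]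
    have h2 : tw (d i) x = sgn 𝕜 (n * d i) • x := by
      rcases Int.even_or_odd (d i) with hd | hd
      · rw [tw_even hd, sgn_even (hd.mul_left n), one_smul]
      · rw [tw_odd hd, hx]
        rcases Int.even_or_odd n with hn | hn
        · rw [sgn_even hn, sgn_even (hn.mul_right _)]
        · rw [sgn_odd hn, sgn_odd (hn.mul hd)]
    rw [← mul_assoc, h1, h2, map_mul, tw_gen, mul_smul_comm, smul_mul_assoc, mul_assoc, h,
      smul_mul_assoc, smul_mul_assoc, mul_assoc]
  | add x y hx hy => simp [add_mul, mul_add, hx, hy]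
  | smul r x h => simp [h]

/-- The index set `ι` may be infinite. Since a polynomial involves finitely many variables, the sums
over `ι × ι` in the Laplacian and the bracket become finite sums over a common `s`. -/
theorem exists_leftD_eq_zero (x : GradedSym 𝕜 d) : ∃ s : Finset ι, ∀ i ∉ s, leftD i x = 0 := by
  classical
  induction x using gradedSym_induction with
  | one => exact ⟨∅, by simp⟩
  | gen_mul j x h =>
    obtain ⟨s, hs⟩ := h
    refine ⟨insert j s, fun i hi => ?_⟩
    simp only [Finset.mem_insert, not_or] at hi
    rw [leftD_mul, leftD_gen, if_neg (Ne.symm hi.1), hs i hi.2]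
    simp
  | add x y hx hy =>
    obtain ⟨s, hs⟩ := hx
    obtain ⟨t, ht⟩ := hy
    refine ⟨s ∪ t, fun i hi => ?_⟩
    simp only [Finset.mem_union, not_or] at hi
    rw [map_add, hs i hi.1, ht i hi.2, add_zero]
  | smul r x h =>
    obtain ⟨s, hs⟩ := h
    exact ⟨s, fun i hi => by rw [map_smul, hs i hi, smul_zero]⟩

/-- The elements `x` that involve only the variables in `s`. -/
def Involves (s : Finset ι) (x : GradedSym 𝕜 d) : Prop := ∀ i ∉ s, leftD i x = 0

theorem exists_involves₃ (x y z : GradedSym 𝕜 d) :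
    ∃ s : Finset ι, Involves s x ∧ Involves s y ∧ Involves s z := by
  classical
  obtain ⟨s, hs⟩ := exists_leftD_eq_zero x
  obtain ⟨t, ht⟩ := exists_leftD_eq_zero y
  obtain ⟨u, hu⟩ := exists_leftD_eq_zero z
  exact ⟨s ∪ (t ∪ u), fun i hi => hs i (by simp_all), fun i hi => ht i (by simp_all),
    fun i hi => hu i (by simp_all)⟩

theorem Involves.tw {s : Finset ι} {x : GradedSym 𝕜 d} (hx : Involves s x) (n : ℤ) :
    Involves s (tw n x) := fun i hi => by rw [leftD_tw, hx i hi]; simp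

theorem Involves.parity {s : Finset ι} {x : GradedSym 𝕜 d} (hx : Involves s x) :
    Involves s (parity x) := by rw [← tw_one_eq_parity]; exact hx.tw 1

theorem Involves.mul {s : Finset ι} {x y : GradedSym 𝕜 d} (hx : Involves s x)
    (hy : Involves s y) : Involves s (x * y) :=
  fun i hi => by rw [leftD_mul, hx i hi, hy i hi]; simp

theorem Involves.leftD {s : Finset ι} {x : GradedSym 𝕜 d} (hx : Involves s x) (j : ι) :
    Involves s (leftD j x) := fun i hi => by rw [leftD_comm, hx i hi]; simp

theorem Involves.add {s : Finset ι} {x y : GradedSym 𝕜 d} (hx : Involves s x)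
    (hy : Involves s y) : Involves s (x + y) :=
  fun i hi => by rw [map_add, hx i hi, hy i hi, add_zero]

theorem Involves.rightD_eq_zero {s : Finset ι} {x : GradedSym 𝕜 d} (hx : Involves s x) {i : ι}
    (hi : i ∉ s) : rightD i x = 0 := by rw [rightD_eq, hx.tw _ i hi, smul_zero]

theorem polyLaplacian_eq_sum (Ω : ι → ι → 𝕜) {s : Finset ι} {x : GradedSym 𝕜 d}
    (hx : Involves s x) : polyLaplacian Ω x =
      algebraMap 𝕜 (LaurentPolynomial 𝕜) 2⁻¹ • ∑ i ∈ s, ∑ j ∈ s,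
        (sgn 𝕜 (d i) * algebraMap 𝕜 (LaurentPolynomial 𝕜) (Ω i j)) • leftD i (leftD j x) := by
  rw [polyLaplacian, finsum_eq_sum_of_support_subset (s := s ×ˢ s), Finset.sum_product]
  · simp only [mul_smul, algebraMap_smul]
  intro p hp
  by_contra h
  apply hp
  rw [Finset.mem_coe, Finset.mem_product, not_and_or] at h
  rcases h with h | h
  · simp [(hx.leftD p.2) _ h]
  · simp [hx _ h]

theorem polyBracket_eq_sum (Ω : ι → ι → 𝕜) {s : Finset ι} {x y : GradedSym 𝕜 d}
    (hx : Involves s x) (hy : Involves s y) : polyBracket Ω x y =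
      ∑ i ∈ s, ∑ j ∈ s,
        algebraMap 𝕜 (LaurentPolynomial 𝕜) (Ω i j) • (rightD i x * leftD j y) := by
  rw [polyBracket, finsum_eq_sum_of_support_subset (s := s ×ˢ s), Finset.sum_product]
  · simp only [algebraMap_smul]
  intro p hp
  by_contra h
  apply hp
  rw [Finset.mem_coe, Finset.mem_product, not_and_or] at h
  rcases h with h | h
  · simp [hx.rightD_eq_zero h]
  · simp [hy _ h]

end GradedSymCalculus

/-! ### Batalin-Vilkovisky identities for polynomials -/

section PolynomialIdentities

variable {𝕜 : Type*} [RCLike 𝕜] {ι : Type*} {d : ι → ℤ}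

/-- The properties of the inverse matrix of an odd symplectic form of degree `-1`. -/
structure IsOddForm (d : ι → ℤ) (Ω : ι → ι → 𝕜) : Prop where
  degree : ∀ i j, Ω i j ≠ 0 → d i + d j = -1
  antisymm : ∀ i j, Ω j i = -Ω i j

theorem parity_leftD (i : ι) (x : GradedSym 𝕜 d) :
    parity (leftD i x) = sgn 𝕜 (d i) • leftD i (parity x) := by
  rw [← tw_one_eq_parity, ← tw_one_eq_parity, tw_leftD, one_mul]

theorem parity_parity (x : GradedSym 𝕜 d) : parity (parity x) = x := by
  rw [← tw_one_eq_parity, ← tw_one_eq_parity, tw_tw, tw_even (by decide)]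

/-- Paired variables have degrees summing to `-1`, hence opposite parities. Every sign in the
identities below comes from this. -/
theorem IsOddForm.sgn_mul_sgn {Ω : ι → ι → 𝕜} (hΩ : IsOddForm d Ω) {i j : ι} (h : Ω i j ≠ 0) :
    sgn 𝕜 (d i * d j) = 1 ∧ sgn 𝕜 (d j) = - sgn 𝕜 (d i) ∧ Odd (d i + d j) := by
  have h := hΩ.degree i j h
  obtain h' : d j = -1 - d i := by omega
  rw [h']
  rcases Int.even_or_odd (d i) with hi | hi
  · refine ⟨sgn_even (hi.mul_right _), ?_, ?_⟩
    · rw [sgn_even hi, sgn_odd ((by decide : Odd (-1 : ℤ)).sub_even hi)]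
    · rw [add_sub_cancel]; decide
  · refine ⟨sgn_even (((by decide : Odd (-1 : ℤ)).sub_odd hi).mul_left _), ?_, ?_⟩
    · rw [sgn_odd hi, sgn_even ((by decide : Odd (-1 : ℤ)).sub_odd hi), neg_neg]
    · rw [add_sub_cancel]; decide

/-- Two derivatives of a product either fall on the same factor, giving the first two terms, or are
split between the factors, giving the bracket. -/
theorem polyLaplacian_mul {Ω : ι → ι → 𝕜} (hΩ : IsOddForm d Ω) (x y : GradedSym 𝕜 d) :
    polyLaplacian Ω (x * y) =
      polyLaplacian Ω x * y + parity x * polyLaplacian Ω y + polyBracket Ω (parity x) y := by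
  obtain ⟨s, hx, hy, -⟩ := exists_involves₃ x y y
  rw [polyLaplacian_eq_sum Ω (hx.mul hy), polyLaplacian_eq_sum Ω hx, polyLaplacian_eq_sum Ω hy,
    polyBracket_eq_sum Ω hx.parity hy]
  set half := algebraMap 𝕜 (LaurentPolynomial 𝕜) 2⁻¹ with half_def
  set κ : ι → ι → LaurentPolynomial 𝕜 := fun i j => algebraMap 𝕜 (LaurentPolynomial 𝕜) (Ω i j)
    with κ_def
  have hhalf : half + half = 1 := by
    rw [half_def, ← map_add, ← map_one (algebraMap 𝕜 (LaurentPolynomial 𝕜))]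
    congr 1; norm_num
  let T : ι → ι → GradedSym 𝕜 d := fun i j => κ i j • (rightD i (parity x) * leftD j y)
  -- The two mixed terms are `T i j` and, by antisymmetry of `Ω` together with the opposite parities
  -- of `i` and `j`, `T j i`. Summed over `i, j` they count the bracket twice, which the factor `½`
  -- in `Δ` compensates.
  have key : ∀ i j, (sgn 𝕜 (d i) * κ i j) • leftD i (leftD j (x * y)) =
      ((sgn 𝕜 (d i) * κ i j) • leftD i (leftD j x)) * y +
      parity x * ((sgn 𝕜 (d i) * κ i j) • leftD i (leftD j y)) + (T i j + T j i) := by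
    intro i j
    by_cases h : Ω i j = 0
    · simp [T, κ_def, h, hΩ.antisymm i j]
    obtain ⟨h1, h2, h3⟩ := hΩ.sgn_mul_sgn h
    have e1 : tw (d i) (parity x) = tw (d j) x := by
      rw [← tw_odd h3, tw_tw, ← add_assoc, ← two_mul, ← tw_tw, tw_even (even_two_mul _)]
    have e2 : tw (d j) (parity x) = tw (d i) x := by
      rw [← tw_odd h3, tw_tw, add_comm (d i), ← add_assoc, ← two_mul, ← tw_tw,
        tw_even (even_two_mul _)]
    have e3 : κ j i = - κ i j := by rw [κ_def]; simp [hΩ.antisymm i j]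
    simp only [T, leftD_mul, map_add, rightD_eq, e1, e2, e3, h2, tw_leftD, tw_tw, tw_odd h3,
      mul_comm (d i) (d j)]
    rw [mul_comm (d i) (d j)] at h1
    simp only [h1, one_smul, smul_mul_assoc, mul_smul_comm, smul_add, smul_smul, neg_mul_neg,
      mul_comm (κ i j)]
    abel
  simp only [show ∀ i j, algebraMap 𝕜 (LaurentPolynomial 𝕜) (Ω i j) = κ i j from fun _ _ => rfl,
    key, Finset.sum_add_distrib]
  rw [Finset.sum_comm (f := fun i j => T j i)]
  simp only [Finset.sum_mul, Finset.mul_sum, smul_add, smul_mul_assoc, mul_smul_comm]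
  rw [← add_smul, hhalf, one_smul]

theorem two_smul_eq_zero {x : GradedSym 𝕜 d} (h : x = -x) : x = 0 := by
  have h2 : (2 : 𝕜) • x = 0 := by rw [two_smul]; nth_rewrite 2 [h]; exact add_neg_cancel x
  have := congrArg ((2⁻¹ : 𝕜) • ·) h2
  simpa [smul_smul] using this

/-- For paired indices `∂_i ∂_j` is an odd operator, so two such operators anticommute. The double
sum is antisymmetric under exchanging the two pairs and equals its own negative. -/
theorem polyLaplacian_polyLaplacian {Ω : ι → ι → 𝕜} (hΩ : IsOddForm d Ω) (x : GradedSym 𝕜 d) :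
    polyLaplacian Ω (polyLaplacian Ω x) = 0 := by
  obtain ⟨s, hx, hy, -⟩ := exists_involves₃ x (polyLaplacian Ω x) x
  rw [polyLaplacian_eq_sum Ω hy, polyLaplacian_eq_sum Ω hx]
  set κ : ι → ι → LaurentPolynomial 𝕜 := fun i j => algebraMap 𝕜 (LaurentPolynomial 𝕜) (Ω i j)
    with κ_def
  let T : ι × ι → ι × ι → GradedSym 𝕜 d := fun p q =>
    ((sgn 𝕜 (d p.1) * κ p.1 p.2) * (sgn 𝕜 (d q.1) * κ q.1 q.2)) •
      leftD p.1 (leftD p.2 (leftD q.1 (leftD q.2 x)))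
  have key : ∀ p q, T p q = - T q p := by
    rintro ⟨i, j⟩ ⟨k, l⟩
    by_cases h : Ω i j = 0
    · simp [T, κ_def, h]
    by_cases h' : Ω k l = 0
    · simp [T, κ_def, h']
    obtain ⟨-, h2, h3⟩ := hΩ.sgn_mul_sgn h
    obtain ⟨-, h2', h3'⟩ := hΩ.sgn_mul_sgn h'
    have e : leftD i (leftD j (leftD k (leftD l x))) =
        - leftD k (leftD l (leftD i (leftD j x))) := by
      have c1 : leftD j (leftD k (leftD l x)) =
          sgn 𝕜 (d j * (d k + d l)) • leftD k (leftD l (leftD j x)) := by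
        rw [leftD_comm j k, leftD_comm j l, map_smul, smul_smul, mul_add, sgn_add]
      have c2 : leftD i (leftD k (leftD l (leftD j x))) =
          sgn 𝕜 (d i * (d k + d l)) • leftD k (leftD l (leftD i (leftD j x))) := by
        rw [leftD_comm i k, leftD_comm i l, map_smul, smul_smul, mul_add, sgn_add]
      rw [c1, map_smul, c2, smul_smul, ← sgn_add, ← add_mul, add_comm (d j),
        sgn_odd (h3.mul h3'), neg_one_smul]
    simp only [T]
    rw [e, smul_neg, mul_comm]
  simp only [map_smul, map_sum, Finset.smul_sum]
  have h0 : ∑ p ∈ s ×ˢ s, ∑ q ∈ s ×ˢ s, T p q = 0 := by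
    apply two_smul_eq_zero
    rw [← Finset.sum_neg_distrib]
    conv_lhs => rw [Finset.sum_comm]
    refine Finset.sum_congr rfl fun p _ => ?_
    rw [← Finset.sum_neg_distrib]
    exact Finset.sum_congr rfl fun q _ => key _ _
  set half := algebraMap 𝕜 (LaurentPolynomial 𝕜) 2⁻¹
  have h1 := congrArg ((half * half) • ·) h0
  simp only [smul_zero, Finset.smul_sum, Finset.sum_product, T] at h1
  rw [← h1]
  refine Finset.sum_congr rfl fun i _ => Finset.sum_congr rfl fun j _ => Finset.sum_congr rfl
    fun k _ => Finset.sum_congr rfl fun l _ => ?_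
  simp only [smul_smul]
  congr 1
  ring

theorem parity_of_tw {n : ℤ} {x : GradedSym 𝕜 d} (hx : parity x = sgn 𝕜 n • x) (m : ℤ) :
    tw m x = sgn 𝕜 (m * n) • x := by
  rcases Int.even_or_odd m with hd | hd
  · rw [tw_even hd, sgn_even (hd.mul_right n), one_smul]
  · rw [tw_odd hd, hx]
    rcases Int.even_or_odd n with hn | hn
    · rw [sgn_even hn, sgn_even (hn.mul_left _)]
    · rw [sgn_odd hn, sgn_odd (hd.mul hn)]

/-- The right derivative of `x` by `φ^i` has parity `n + d i`. Moving it past `y`, already twisted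
by `d j`, gives the total twist `n + d i + d j`, which has the parity of `n + 1` whatever the pair.
-/
theorem polyBracket_mul {Ω : ι → ι → 𝕜} (hΩ : IsOddForm d Ω) {n : ℤ} {x : GradedSym 𝕜 d}
    (hx : parity x = sgn 𝕜 n • x) (y z : GradedSym 𝕜 d) :
    polyBracket Ω x (y * z) = polyBracket Ω x y * z + tw (n + 1) y * polyBracket Ω x z := by
  obtain ⟨s, hxs, hy, hz⟩ := exists_involves₃ x y z
  rw [polyBracket_eq_sum Ω hxs (hy.mul hz), polyBracket_eq_sum Ω hxs hy,
    polyBracket_eq_sum Ω hxs hz]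
  simp only [Finset.mul_sum, Finset.sum_mul, ← Finset.sum_add_distrib]
  refine Finset.sum_congr rfl fun i _ => Finset.sum_congr rfl fun j _ => ?_
  by_cases h : Ω i j = 0
  · simp [h]
  obtain ⟨-, -, h3⟩ := hΩ.sgn_mul_sgn h
  have hr : parity (rightD i x) = sgn 𝕜 (n + d i) • rightD i x := by
    rw [rightD_eq, map_smul, parity_leftD, parity_of_tw hx, map_smul, hx, sgn_add]
    simp only [map_smul, smul_smul]
    congr 1; ring
  have e : tw (n + d i) (tw (d j) y) = tw (n + 1) y := by
    rw [tw_tw, add_assoc, ← tw_tw, ← tw_tw n 1, tw_odd h3, tw_one_eq_parity]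
  rw [leftD_mul, mul_add, ← mul_assoc, ← mul_assoc,
    mul_comm_of_parity hr (tw (d j) y), e, smul_add,
    smul_mul_assoc, mul_smul_comm, mul_assoc _ (rightD i x)]

theorem parity_polyLaplacian {Ω : ι → ι → 𝕜} (hΩ : IsOddForm d Ω) (x : GradedSym 𝕜 d) :
    parity (polyLaplacian Ω x) = - polyLaplacian Ω (parity x) := by
  obtain ⟨s, hx, -, -⟩ := exists_involves₃ x x x
  rw [polyLaplacian_eq_sum Ω hx, polyLaplacian_eq_sum Ω hx.parity]
  simp only [map_smul, map_sum, parity_leftD, ← smul_neg, ← Finset.sum_neg_distrib]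
  congr 1
  refine Finset.sum_congr rfl fun i _ => Finset.sum_congr rfl fun j _ => ?_
  by_cases h : Ω i j = 0
  · simp [h]
  obtain ⟨-, h2, -⟩ := hΩ.sgn_mul_sgn h
  rw [h2, smul_smul (sgn 𝕜 (d i)), mul_neg, sgn_mul_self, neg_one_smul]

theorem parity_polyBracket {Ω : ι → ι → 𝕜} (hΩ : IsOddForm d Ω) (x y : GradedSym 𝕜 d) :
    parity (polyBracket Ω x y) = - polyBracket Ω (parity x) (parity y) := by
  obtain ⟨s, hx, hy, -⟩ := exists_involves₃ x y x
  rw [polyBracket_eq_sum Ω hx hy, polyBracket_eq_sum Ω hx.parity hy.parity]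
  simp only [map_smul, map_sum, map_mul, parity_leftD, ← Finset.sum_neg_distrib]
  refine Finset.sum_congr rfl fun i _ => Finset.sum_congr rfl fun j _ => ?_
  by_cases h : Ω i j = 0
  · simp [h]
  obtain ⟨-, h2, -⟩ := hΩ.sgn_mul_sgn h
  have e : parity (tw (d i) x) = tw (d i) (parity x) := by
    rw [← tw_one_eq_parity, ← tw_one_eq_parity, tw_tw, tw_tw, add_comm]
  rw [rightD_eq, rightD_eq, map_smul, parity_leftD, e, h2]
  simp only [smul_mul_assoc, mul_smul_comm, smul_smul, ← neg_smul]
  congr 1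
  have := sgn_mul_self (𝕜 := 𝕜) (d i)
  linear_combination (-(algebraMap 𝕜 (LaurentPolynomial 𝕜) (Ω i j)) * sgn 𝕜 (d i)) * this

end PolynomialIdentities

/-! ### Linearity of the operations over Laurent polynomials in `ħ` -/

section PolynomialLinearity

variable {𝕜 : Type*} [RCLike 𝕜] {ι : Type*} {d : ι → ℤ}

theorem polyLaplacian_add (Ω : ι → ι → 𝕜) (x y : GradedSym 𝕜 d) :
    polyLaplacian Ω (x + y) = polyLaplacian Ω x + polyLaplacian Ω y := by
  obtain ⟨s, hx, hy, -⟩ := exists_involves₃ x y x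
  rw [polyLaplacian_eq_sum Ω (hx.add hy), polyLaplacian_eq_sum Ω hx, polyLaplacian_eq_sum Ω hy]
  simp only [map_add, smul_add, Finset.sum_add_distrib]

theorem Involves.smul {s : Finset ι} {x : GradedSym 𝕜 d} (hx : Involves s x)
    (r : LaurentPolynomial 𝕜) : Involves s (r • x) :=
  fun i hi => by rw [map_smul, hx i hi, smul_zero]

theorem polyLaplacian_smul (Ω : ι → ι → 𝕜) (r : LaurentPolynomial 𝕜) (x : GradedSym 𝕜 d) :
    polyLaplacian Ω (r • x) = r • polyLaplacian Ω x := by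
  obtain ⟨s, hx, -, -⟩ := exists_involves₃ x x x
  rw [polyLaplacian_eq_sum Ω (hx.smul r), polyLaplacian_eq_sum Ω hx]
  simp only [map_smul, smul_comm r, Finset.smul_sum]

theorem polyBracket_add_left (Ω : ι → ι → 𝕜) (x y z : GradedSym 𝕜 d) :
    polyBracket Ω (x + y) z = polyBracket Ω x z + polyBracket Ω y z := by
  obtain ⟨s, hx, hy, hz⟩ := exists_involves₃ x y z
  rw [polyBracket_eq_sum Ω (hx.add hy) hz, polyBracket_eq_sum Ω hx hz, polyBracket_eq_sum Ω hy hz]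
  simp only [map_add, add_mul, smul_add, Finset.sum_add_distrib]

theorem polyBracket_add_right (Ω : ι → ι → 𝕜) (x y z : GradedSym 𝕜 d) :
    polyBracket Ω x (y + z) = polyBracket Ω x y + polyBracket Ω x z := by
  obtain ⟨s, hx, hy, hz⟩ := exists_involves₃ x y z
  rw [polyBracket_eq_sum Ω hx (hy.add hz), polyBracket_eq_sum Ω hx hy, polyBracket_eq_sum Ω hx hz]
  simp only [map_add, mul_add, smul_add, Finset.sum_add_distrib]

theorem polyBracket_smul_left (Ω : ι → ι → 𝕜) (r : LaurentPolynomial 𝕜) (x y : GradedSym 𝕜 d) :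
    polyBracket Ω (r • x) y = r • polyBracket Ω x y := by
  obtain ⟨s, hx, hy, -⟩ := exists_involves₃ x y x
  rw [polyBracket_eq_sum Ω (hx.smul r) hy, polyBracket_eq_sum Ω hx hy]
  simp only [map_smul, smul_mul_assoc, smul_comm r, Finset.smul_sum]

theorem polyBracket_smul_right (Ω : ι → ι → 𝕜) (r : LaurentPolynomial 𝕜) (x y : GradedSym 𝕜 d) :
    polyBracket Ω x (r • y) = r • polyBracket Ω x y := by
  obtain ⟨s, hx, hy, -⟩ := exists_involves₃ x y x
  rw [polyBracket_eq_sum Ω hx (hy.smul r), polyBracket_eq_sum Ω hx hy]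
  simp only [map_smul, mul_smul_comm, smul_comm r, Finset.smul_sum]

@[simp] theorem polyBracket_zero_left (Ω : ι → ι → 𝕜) (y : GradedSym 𝕜 d) :
    polyBracket Ω 0 y = 0 := by simp [polyBracket]

@[simp] theorem polyBracket_zero_right (Ω : ι → ι → 𝕜) (y : GradedSym 𝕜 d) :
    polyBracket Ω y 0 = 0 := by simp [polyBracket]

@[simp] theorem polyLaplacian_zero (Ω : ι → ι → 𝕜) :
    polyLaplacian Ω (0 : GradedSym 𝕜 d) = 0 := by simp [polyLaplacian]

theorem T_smul_eq (g : ℤ) (x : GradedSym 𝕜 d) :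
    mono 𝕜 d g [] * x = (LaurentPolynomial.T g : LaurentPolynomial 𝕜) • x := by
  simp [mono]

end PolynomialLinearity

/-! ### Weight components of formal functions -/

section Components

variable {𝕜 : Type*} [RCLike 𝕜] {ι : Type*} {d : ι → ℤ}

@[ext] theorem FormalFun.ext {F G : FormalFun 𝕜 d} (h : ∀ w, comp F w = comp G w) : F = G :=
  Subtype.ext (HahnSeries.ext (funext h))

variable (𝕜 d) in
/-- The component of weight `w`, as a linear map. -/
def compL (w : ℤ) : FormalFun 𝕜 d →ₗ[𝕜] GradedSym 𝕜 d where
  toFun F := comp F w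
  map_add' _ _ := rfl
  map_smul' _ _ := rfl

@[simp] theorem comp_add (F G : FormalFun 𝕜 d) (w : ℤ) : comp (F + G) w = comp F w + comp G w := rfl
@[simp] theorem comp_smul (r : 𝕜) (F : FormalFun 𝕜 d) (w : ℤ) :
    comp (r • F) w = r • comp F w := rfl
@[simp] theorem comp_zero (w : ℤ) : comp (0 : FormalFun 𝕜 d) w = 0 := rfl
@[simp] theorem comp_neg (F : FormalFun 𝕜 d) (w : ℤ) : comp (-F) w = -comp F w :=
  map_neg (compL 𝕜 d w) F
@[simp] theorem comp_sub (F G : FormalFun 𝕜 d) (w : ℤ) : comp (F - G) w = comp F w - comp G w :=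
  map_sub (compL 𝕜 d w) F G
theorem comp_sum {α : Type*} (s : Finset α) (F : α → FormalFun 𝕜 d) (w : ℤ) :
    comp (∑ a ∈ s, F a) w = ∑ a ∈ s, comp (F a) w :=
  map_sum (compL 𝕜 d w) F s

theorem comp_mul (F G : FormalFun 𝕜 d) (w : ℤ) : ∃ s : Finset (ℤ × ℤ),
    (∀ p ∈ s, p.1 + p.2 = w) ∧ comp (F * G) w = ∑ p ∈ s, comp F p.1 * comp G p.2 :=
  ⟨_, fun _ hp => (Finset.mem_antidiagonal.1 hp).2.2, HahnSeries.coeff_mul ..⟩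

theorem WeightGE.mono {F : FormalFun 𝕜 d} {m n : ℤ} (h : WeightGE F n) (hmn : m ≤ n) :
    WeightGE F m := fun w hw => h w (by omega)

theorem weightGE_zero (m : ℤ) : WeightGE (0 : FormalFun 𝕜 d) m := fun _ _ => rfl

theorem WeightGE.add {F G : FormalFun 𝕜 d} {m : ℤ} (hF : WeightGE F m) (hG : WeightGE G m) :
    WeightGE (F + G) m := fun w hw => by rw [comp_add, hF w hw, hG w hw, add_zero]

theorem WeightGE.neg {F : FormalFun 𝕜 d} {m : ℤ} (hF : WeightGE F m) :
    WeightGE (-F) m := fun w hw => by rw [comp_neg, hF w hw, neg_zero]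

theorem WeightGE.sub {F G : FormalFun 𝕜 d} {m : ℤ} (hF : WeightGE F m) (hG : WeightGE G m) :
    WeightGE (F - G) m := fun w hw => by rw [comp_sub, hF w hw, hG w hw, sub_zero]

theorem WeightGE.smul {F : FormalFun 𝕜 d} {m : ℤ} (hF : WeightGE F m) (r : 𝕜) :
    WeightGE (r • F) m := fun w hw => by rw [comp_smul, hF w hw, smul_zero]

theorem WeightGE.mul {F G : FormalFun 𝕜 d} {m n : ℤ} (hF : WeightGE F m) (hG : WeightGE G n) :
    WeightGE (F * G) (m + n) := by
  intro w hw
  obtain ⟨s, hs, h⟩ := comp_mul F G w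
  rw [h]
  refine Finset.sum_eq_zero fun p hp => ?_
  have := hs p hp
  rcases lt_or_ge p.1 m with h | h
  · rw [hF _ h, zero_mul]
  · rw [hG p.2 (by omega), mul_zero]

theorem exists_weightGE (F : FormalFun 𝕜 d) : ∃ m, WeightGE F m := exists_comp_eq_zero F

theorem eq_of_forall_weightGE {F G : FormalFun 𝕜 d} (h : ∀ N : ℕ, WeightGE (F - G) N) : F = G := by
  ext w
  have := h (w + 1).toNat w (by omega)
  rwa [comp_sub, sub_eq_zero] at this

/-- Any linear complement of the subspace will do. Only the values of `p` on elements of weight `v`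
matter, so independence of the different weights need not be established. -/
theorem exists_projection (v : ℤ) : ∃ p : GradedSym 𝕜 d →ₗ[𝕜] GradedSym 𝕜 d,
    (∀ x, p x ∈ weightPart 𝕜 d v) ∧ ∀ x ∈ weightPart 𝕜 d v, p x = x := by
  obtain ⟨g, hg⟩ := LinearMap.exists_leftInverse_of_injective (weightPart 𝕜 d v).subtype
    (Submodule.ker_subtype _)
  exact ⟨(weightPart 𝕜 d v).subtype ∘ₗ g, fun x => (g x).2, fun x hx =>
    congrArg Subtype.val (LinearMap.congr_fun hg ⟨x, hx⟩)⟩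

variable (𝕜 d) in
/-- A projection onto the elements of weight `v`. -/
def proj (v : ℤ) : GradedSym 𝕜 d →ₗ[𝕜] GradedSym 𝕜 d := (exists_projection v).choose

theorem proj_mem (v : ℤ) (x : GradedSym 𝕜 d) : proj 𝕜 d v x ∈ weightPart 𝕜 d v :=
  (exists_projection v).choose_spec.1 x

theorem proj_eq {v : ℤ} {x : GradedSym 𝕜 d} (hx : x ∈ weightPart 𝕜 d v) : proj 𝕜 d v x = x :=
  (exists_projection v).choose_spec.2 x hx

variable (𝕜 d) in
/-- The projection of `x` to weight `v`, as a formal function. -/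
def singleFun (v : ℤ) (x : GradedSym 𝕜 d) : FormalFun 𝕜 d :=
  ⟨HahnSeries.single v (proj 𝕜 d v x), by
    intro w
    by_cases h : w = v
    · subst h
      rw [HahnSeries.coeff_single_same]
      exact proj_mem _ _
    · rw [HahnSeries.coeff_single_of_ne h]
      exact zero_mem _⟩

theorem comp_singleFun (v w : ℤ) (x : GradedSym 𝕜 d) :
    comp (singleFun 𝕜 d v x) w = if w = v then proj 𝕜 d v x else 0 := by
  by_cases h : w = v
  · subst h
    rw [if_pos rfl]
    exact HahnSeries.coeff_single_same _ _
  · rw [if_neg h]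
    exact HahnSeries.coeff_single_of_ne h

variable (𝕜 d) in
/-- The formal function with the single component `x`, of weight `v`. -/
def inj (v : ℤ) : GradedSym 𝕜 d →ₗ[𝕜] FormalFun 𝕜 d where
  toFun x := singleFun 𝕜 d v x
  map_add' x y := by
    ext w
    rw [comp_add]
    simp only [comp_singleFun]
    split_ifs <;> simp
  map_smul' r x := by
    ext w
    rw [RingHom.id_apply, comp_smul]
    simp only [comp_singleFun]
    split_ifs <;> simp

theorem comp_inj (v w : ℤ) (x : GradedSym 𝕜 d) :
    comp (inj 𝕜 d v x) w = if w = v then proj 𝕜 d v x else 0 := comp_singleFun v w x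

theorem comp_inj_self {v : ℤ} {x : GradedSym 𝕜 d} (hx : x ∈ weightPart 𝕜 d v) :
    comp (inj 𝕜 d v x) v = x := by rw [comp_inj, if_pos rfl, proj_eq hx]

theorem comp_inj_of_ne {v w : ℤ} (h : w ≠ v) (x : GradedSym 𝕜 d) :
    comp (inj 𝕜 d v x) w = 0 := by rw [comp_inj, if_neg h]

theorem weightGE_inj (v : ℤ) (x : GradedSym 𝕜 d) : WeightGE (inj 𝕜 d v x) v :=
  fun _ hw => comp_inj_of_ne hw.ne x

theorem inj_mul_inj {u v w : ℤ} (h : u = v + w) {x y : GradedSym 𝕜 d} (hx : x ∈ weightPart 𝕜 d v)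
    (hy : y ∈ weightPart 𝕜 d w) : inj 𝕜 d v x * inj 𝕜 d w y = inj 𝕜 d u (x * y) := by
  subst h
  refine Subtype.ext ((HahnSeries.single_mul_single (a := v) (b := w)).trans ?_)
  change HahnSeries.single (v + w) (proj 𝕜 d v x * proj 𝕜 d w y) =
    HahnSeries.single (v + w) (proj 𝕜 d (v + w) (x * y))
  rw [proj_eq hx, proj_eq hy, proj_eq (mul_mem_weightPart hx hy)]

theorem hbar_eq_inj (g : ℤ) : hbar 𝕜 d g = inj 𝕜 d (2 * g) (mono 𝕜 d g []) := by
  have h : mono 𝕜 d g [] ∈ weightPart 𝕜 d (2 * g) := mono_mem (by simp)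
  ext w
  change (HahnSeries.single (2 * g) (mono 𝕜 d g [])).coeff w =
    (HahnSeries.single (2 * g) (proj 𝕜 d (2 * g) (mono 𝕜 d g []))).coeff w
  rw [proj_eq h]

end Components

/-! ### Operators that shift the weight by a bounded amount -/

section Filtered

variable {𝕜 : Type*} [RCLike 𝕜] {ι : Type*} {d : ι → ℤ}

/-- A linear operator which raises the weight by at least `k`. -/
structure IsFiltered (k : ℤ) (f : FormalFun 𝕜 d → FormalFun 𝕜 d) : Prop where
  map_add : ∀ F G, f (F + G) = f F + f G
  map_smul : ∀ (r : 𝕜) F, f (r • F) = r • f F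
  weight : ∀ m F, WeightGE F m → WeightGE (f F) (m + k)

namespace IsFiltered

variable {k l : ℤ} {f g : FormalFun 𝕜 d → FormalFun 𝕜 d}

/-- The underlying linear map. -/
def toLinearMap (hf : IsFiltered k f) : FormalFun 𝕜 d →ₗ[𝕜] FormalFun 𝕜 d where
  toFun := f
  map_add' := hf.map_add
  map_smul' := hf.map_smul

theorem map_zero (hf : IsFiltered k f) : f 0 = 0 := _root_.map_zero hf.toLinearMap

theorem map_neg (hf : IsFiltered k f) (F : FormalFun 𝕜 d) : f (-F) = -f F :=
  _root_.map_neg hf.toLinearMap F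

theorem map_sub (hf : IsFiltered k f) (F G : FormalFun 𝕜 d) : f (F - G) = f F - f G :=
  _root_.map_sub hf.toLinearMap F G

theorem map_sum (hf : IsFiltered k f) {α : Type*} (s : Finset α) (F : α → FormalFun 𝕜 d) :
    f (∑ a ∈ s, F a) = ∑ a ∈ s, f (F a) := _root_.map_sum hf.toLinearMap F s

theorem mono (hf : IsFiltered k f) (h : l ≤ k) : IsFiltered l f :=
  ⟨hf.map_add, hf.map_smul, fun m F hF => (hf.weight m F hF).mono (by omega)⟩

theorem id : IsFiltered 0 (fun F : FormalFun 𝕜 d => F) :=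
  ⟨fun _ _ => rfl, fun _ _ => rfl, fun m F hF => hF.mono (by omega)⟩

theorem zero (k : ℤ) : IsFiltered k (fun _ : FormalFun 𝕜 d => (0 : FormalFun 𝕜 d)) :=
  ⟨fun _ _ => by simp, fun _ _ => by simp, fun m F _ => weightGE_zero _⟩

theorem comp (hf : IsFiltered k f) (hg : IsFiltered l g) :
    IsFiltered (k + l) (fun F => f (g F)) :=
  ⟨fun F G => by rw [hg.map_add, hf.map_add], fun r F => by rw [hg.map_smul, hf.map_smul],
    fun m F hF => (hf.weight _ _ (hg.weight m F hF)).mono (by omega)⟩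

theorem add (hf : IsFiltered k f) (hg : IsFiltered l g) :
    IsFiltered (min k l) (fun F => f F + g F) :=
  ⟨fun F G => by rw [hg.map_add, hf.map_add]; abel,
    fun r F => by rw [hg.map_smul, hf.map_smul, smul_add],
    fun m F hF => ((hf.weight _ _ hF).mono (by omega)).add ((hg.weight m F hF).mono (by omega))⟩

theorem neg (hf : IsFiltered k f) : IsFiltered k (fun F => -f F) :=
  ⟨fun F G => by rw [hf.map_add]; abel,
    fun r F => by rw [hf.map_smul, smul_neg],
    fun m F hF => (hf.weight _ _ hF).neg⟩

theorem mul_left {G : FormalFun 𝕜 d} (hG : WeightGE G k) :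
    IsFiltered k (fun F => G * F) :=
  ⟨fun _ _ => mul_add _ _ _, fun _ _ => mul_smul_comm _ _ _,
    fun m F hF => (hG.mul hF).mono (by omega)⟩

theorem mul_right {G : FormalFun 𝕜 d} (hG : WeightGE G k) :
    IsFiltered k (fun F => F * G) :=
  ⟨fun _ _ => add_mul _ _ _, fun _ _ => smul_mul_assoc _ _ _,
    fun m F hF => (hF.mul hG).mono (by omega)⟩

/-- This is the substitute for continuity: components of weight below `N` vanish, and those of
weight above `w - k` are moved beyond weight `w`, so finitely many remain. -/
theorem comp_eq_sum (hf : IsFiltered k f) {F : FormalFun 𝕜 d} {N : ℤ} (hF : WeightGE F N) (w : ℤ) :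
    BV.comp (f F) w =
      ∑ v ∈ Finset.Ico N (w - k + 1), BV.comp (f (inj 𝕜 d v (BV.comp F v))) w := by
  have h : WeightGE (F - ∑ v ∈ Finset.Ico N (w - k + 1), inj 𝕜 d v (BV.comp F v)) (w - k + 1) := by
    intro u hu
    rw [comp_sub, comp_sum, sub_eq_zero]
    by_cases hN : u < N
    · rw [hF u hN, eq_comm]
      refine Finset.sum_eq_zero fun v hv => comp_inj_of_ne ?_ _
      rw [Finset.mem_Ico] at hv
      omega
    · rw [Finset.sum_eq_single u (fun v _ hv => comp_inj_of_ne hv.symm _)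
        (fun h => absurd (Finset.mem_Ico.2 ⟨not_lt.1 hN, hu⟩) h), comp_inj_self (comp_mem F u)]
  have h1 := hf.weight _ _ h w (by omega)
  rw [hf.map_sub, comp_sub, sub_eq_zero, hf.map_sum, comp_sum] at h1
  exact h1

theorem ext (hf : IsFiltered k f) (hg : IsFiltered l g) {F : FormalFun 𝕜 d}
    (h : ∀ v, f (inj 𝕜 d v (BV.comp F v)) = g (inj 𝕜 d v (BV.comp F v))) : f F = g F := by
  obtain ⟨N, hN⟩ := exists_weightGE F
  ext w
  rw [(hf.mono (min_le_left k l)).comp_eq_sum hN, (hg.mono (min_le_right k l)).comp_eq_sum hN]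
  exact Finset.sum_congr rfl fun v _ => by rw [h]

end IsFiltered

/-- The tool that transfers bilinear identities from polynomials to series. The shift `k` may depend
on the argument held fixed, as it must for products and brackets of functions of arbitrary lowest
weight. -/
theorem filtered_ext₂ {f g : FormalFun 𝕜 d → FormalFun 𝕜 d → FormalFun 𝕜 d}
    (hf₁ : ∀ G, ∃ k, IsFiltered k (fun F => f F G)) (hf₂ : ∀ F, ∃ k, IsFiltered k (f F))
    (hg₁ : ∀ G, ∃ k, IsFiltered k (fun F => g F G)) (hg₂ : ∀ F, ∃ k, IsFiltered k (g F))
    {F G : FormalFun 𝕜 d}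
    (h : ∀ v w, f (inj 𝕜 d v (comp F v)) (inj 𝕜 d w (comp G w)) =
      g (inj 𝕜 d v (comp F v)) (inj 𝕜 d w (comp G w))) : f F G = g F G := by
  obtain ⟨k, hk⟩ := hf₁ G
  obtain ⟨l, hl⟩ := hg₁ G
  refine hk.ext hl fun v => ?_
  obtain ⟨k, hk⟩ := hf₂ (inj 𝕜 d v (comp F v))
  obtain ⟨l, hl⟩ := hg₂ (inj 𝕜 d v (comp F v))
  exact hk.ext hl fun w => h v w

/-! ### The operators on formal functions -/

theorem comp_parityFun (F : FormalFun 𝕜 d) (w : ℤ) : comp (parityFun F) w = parity (comp F w) := rfl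

theorem comp_laplacianOf (Ω : ι → ι → 𝕜) (F : FormalFun 𝕜 d) (w : ℤ) :
    comp (laplacianOf Ω F) w = polyLaplacian Ω (comp F (w + 2)) := rfl

theorem comp_bracketOf (Ω : ι → ι → 𝕜) {F G : FormalFun 𝕜 d} {M N : ℤ} (hF : WeightGE F M)
    (hG : WeightGE G N) (w : ℤ) : comp (bracketOf Ω F G) w =
      ∑ v ∈ Finset.Ico M (w + 3 - N), polyBracket Ω (comp F v) (comp G (w + 2 - v)) := by
  refine finsum_eq_sum_of_support_subset _ fun v hv => ?_
  by_contra h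
  apply hv
  rw [Finset.mem_coe, Finset.mem_Ico, not_and_or] at h
  rcases h with h | h
  · simp [hF v (by omega)]
  · simp [hG (w + 2 - v) (by omega)]

theorem parityFun_filtered : IsFiltered 0 (parityFun (𝕜 := 𝕜) (d := d)) where
  map_add F G := by ext w; simp [comp_parityFun]
  map_smul r F := by
    ext w
    rw [comp_parityFun, comp_smul, comp_smul, algebra_compatible_smul (LaurentPolynomial 𝕜),
      map_smul, algebraMap_smul]
    rfl
  weight m F hF w hw := by rw [comp_parityFun, hF w (by omega), map_zero]

theorem laplacianOf_filtered (Ω : ι → ι → 𝕜) : IsFiltered (-2) (laplacianOf (d := d) Ω) where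
  map_add F G := by ext w; simp [comp_laplacianOf, polyLaplacian_add]
  map_smul r F := by
    ext w
    rw [comp_laplacianOf, comp_smul, comp_smul, algebra_compatible_smul (LaurentPolynomial 𝕜),
      polyLaplacian_smul, algebraMap_smul]
    rfl
  weight m F hF w hw := by rw [comp_laplacianOf, hF _ (by omega), polyLaplacian_zero]

theorem weightGE_bracketOf (Ω : ι → ι → 𝕜) {F G : FormalFun 𝕜 d} {M N : ℤ} (hF : WeightGE F M)
    (hG : WeightGE G N) : WeightGE (bracketOf Ω F G) (M + N - 2) := fun w hw => by
  rw [comp_bracketOf Ω hF hG, Finset.Ico_eq_empty (by omega), Finset.sum_empty]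

theorem bracketOf_filtered_left (Ω : ι → ι → 𝕜) {G : FormalFun 𝕜 d} {N : ℤ} (hG : WeightGE G N) :
    IsFiltered (N - 2) (fun F => bracketOf Ω F G) where
  map_add F F' := by
    obtain ⟨m, hm⟩ := exists_weightGE F
    obtain ⟨m', hm'⟩ := exists_weightGE F'
    have h := hm.mono (min_le_left m m')
    have h' := hm'.mono (min_le_right m m')
    ext w
    rw [comp_add, comp_bracketOf Ω (h.add h') hG, comp_bracketOf Ω h hG, comp_bracketOf Ω h' hG]
    simp only [comp_add, polyBracket_add_left, Finset.sum_add_distrib]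
  map_smul r F := by
    obtain ⟨m, hm⟩ := exists_weightGE F
    ext w
    rw [comp_smul, comp_bracketOf Ω (hm.smul r) hG, comp_bracketOf Ω hm hG, Finset.smul_sum]
    refine Finset.sum_congr rfl fun v _ => ?_
    rw [comp_smul, algebra_compatible_smul (LaurentPolynomial 𝕜), polyBracket_smul_left,
      algebraMap_smul]
  weight m F hF := (weightGE_bracketOf Ω hF hG).mono (by omega)

theorem bracketOf_filtered_right (Ω : ι → ι → 𝕜) {F : FormalFun 𝕜 d} {N : ℤ} (hF : WeightGE F N) :
    IsFiltered (N - 2) (bracketOf Ω F) where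
  map_add G G' := by
    obtain ⟨m, hm⟩ := exists_weightGE G
    obtain ⟨m', hm'⟩ := exists_weightGE G'
    have h := hm.mono (min_le_left m m')
    have h' := hm'.mono (min_le_right m m')
    ext w
    rw [comp_add, comp_bracketOf Ω hF (h.add h'), comp_bracketOf Ω hF h, comp_bracketOf Ω hF h']
    simp only [comp_add, polyBracket_add_right, Finset.sum_add_distrib]
  map_smul r G := by
    obtain ⟨m, hm⟩ := exists_weightGE G
    ext w
    rw [comp_smul, comp_bracketOf Ω hF (hm.smul r), comp_bracketOf Ω hF hm, Finset.smul_sum]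
    refine Finset.sum_congr rfl fun v _ => ?_
    rw [comp_smul, algebra_compatible_smul (LaurentPolynomial 𝕜), polyBracket_smul_right,
      algebraMap_smul]
  weight m G hG := (weightGE_bracketOf Ω hF hG).mono (by omega)

theorem parityFun_inj {v : ℤ} {x : GradedSym 𝕜 d} (hx : x ∈ weightPart 𝕜 d v) :
    parityFun (inj 𝕜 d v x) = inj 𝕜 d v (parity x) := by
  ext w
  rw [comp_parityFun]
  by_cases h : w = v
  · subst h
    rw [comp_inj_self hx, comp_inj_self (parity_mem hx)]
  · rw [comp_inj_of_ne h, comp_inj_of_ne h, map_zero]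

theorem laplacianOf_inj (Ω : ι → ι → 𝕜) {u v : ℤ} (h : v = u + 2) {x : GradedSym 𝕜 d}
    (hx : x ∈ weightPart 𝕜 d v) :
    laplacianOf Ω (inj 𝕜 d v x) = inj 𝕜 d u (polyLaplacian Ω x) := by
  subst h
  ext w
  rw [comp_laplacianOf]
  by_cases h : w = u
  · subst h
    rw [comp_inj_self hx, comp_inj_self (polyLaplacian_mem Ω hx)]
  · rw [comp_inj_of_ne (by omega), comp_inj_of_ne h, polyLaplacian_zero]

theorem bracketOf_inj (Ω : ι → ι → 𝕜) {t u v : ℤ} (h : v = t + 2 - u) {x y : GradedSym 𝕜 d}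
    (hx : x ∈ weightPart 𝕜 d u) (hy : y ∈ weightPart 𝕜 d v) :
    bracketOf Ω (inj 𝕜 d u x) (inj 𝕜 d v y) = inj 𝕜 d t (polyBracket Ω x y) := by
  subst h
  ext w
  change ∑ᶠ _, _ = _
  rw [finsum_eq_single _ u (fun v hv => by rw [comp_inj_of_ne hv, polyBracket_zero_left])]
  by_cases h : w = t
  · subst h
    rw [comp_inj_self hx, comp_inj_self hy, comp_inj_self (polyBracket_mem Ω hx hy)]
  · rw [comp_inj_of_ne h, comp_inj_of_ne (w := w + 2 - u) (by omega), polyBracket_zero_right]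

end Filtered

/-! ### Batalin-Vilkovisky identities for formal functions -/

section BVIdentities

variable {𝕜 : Type*} [RCLike 𝕜] {ι : Type*} {d : ι → ℤ} {Ω : ι → ι → 𝕜}

theorem exists_filtered_mul_left (G : FormalFun 𝕜 d) : ∃ k, IsFiltered k (fun F => G * F) :=
  (exists_weightGE G).imp fun _ h => .mul_left h

theorem exists_filtered_mul_right (G : FormalFun 𝕜 d) : ∃ k, IsFiltered k (fun F => F * G) :=
  (exists_weightGE G).imp fun _ h => .mul_right h

theorem exists_filtered_bracket_left (Ω : ι → ι → 𝕜) (G : FormalFun 𝕜 d) :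
    ∃ k, IsFiltered k (fun F => bracketOf Ω F G) :=
  (exists_weightGE G).elim fun _ h => ⟨_, bracketOf_filtered_left Ω h⟩

theorem exists_filtered_bracket_right (Ω : ι → ι → 𝕜) (G : FormalFun 𝕜 d) :
    ∃ k, IsFiltered k (bracketOf Ω G) :=
  (exists_weightGE G).elim fun _ h => ⟨_, bracketOf_filtered_right Ω h⟩

theorem exists_filtered_comp {f g : FormalFun 𝕜 d → FormalFun 𝕜 d} (hf : ∃ k, IsFiltered k f)
    (hg : ∃ k, IsFiltered k g) : ∃ k, IsFiltered k (fun F => f (g F)) := by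
  obtain ⟨k, hf⟩ := hf
  obtain ⟨l, hg⟩ := hg
  exact ⟨_, hf.comp hg⟩

theorem exists_filtered_add {f g : FormalFun 𝕜 d → FormalFun 𝕜 d} (hf : ∃ k, IsFiltered k f)
    (hg : ∃ k, IsFiltered k g) : ∃ k, IsFiltered k (fun F => f F + g F) := by
  obtain ⟨k, hf⟩ := hf
  obtain ⟨l, hg⟩ := hg
  exact ⟨_, hf.add hg⟩

theorem parityFun_mul (F G : FormalFun 𝕜 d) : parityFun (F * G) = parityFun F * parityFun G := by
  have hP : ∃ k, IsFiltered k (parityFun (𝕜 := 𝕜) (d := d)) := ⟨_, parityFun_filtered⟩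
  refine filtered_ext₂ (f := fun F G => parityFun (F * G))
    (g := fun F G => parityFun F * parityFun G)
    (fun G => exists_filtered_comp hP (exists_filtered_mul_right G))
    (fun F => exists_filtered_comp hP (exists_filtered_mul_left F))
    (fun G => exists_filtered_comp (exists_filtered_mul_right _) hP)
    (fun F => exists_filtered_comp (exists_filtered_mul_left _) hP) fun v w => ?_
  have hx := comp_mem F v
  have hy := comp_mem G w
  simp only [inj_mul_inj rfl hx hy, parityFun_inj (mul_mem_weightPart hx hy), parityFun_inj hx,
    parityFun_inj hy, inj_mul_inj rfl (parity_mem hx) (parity_mem hy), map_mul]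

theorem parityFun_parityFun (F : FormalFun 𝕜 d) : parityFun (parityFun F) = F := by
  ext w; rw [comp_parityFun, comp_parityFun, parity_parity]

theorem parityFun_laplacianOf (hΩ : IsOddForm d Ω) (F : FormalFun 𝕜 d) :
    parityFun (laplacianOf Ω F) = - laplacianOf Ω (parityFun F) := by
  ext w
  rw [comp_parityFun, comp_neg, comp_laplacianOf, comp_laplacianOf, comp_parityFun,
    parity_polyLaplacian hΩ]

theorem laplacianOf_laplacianOf (hΩ : IsOddForm d Ω) (F : FormalFun 𝕜 d) :
    laplacianOf Ω (laplacianOf Ω F) = 0 := by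
  ext w
  rw [comp_laplacianOf, comp_laplacianOf, polyLaplacian_polyLaplacian hΩ, comp_zero]

theorem weightGE_parityFun {F : FormalFun 𝕜 d} {N : ℤ} (h : WeightGE F N) :
    WeightGE (parityFun F) N := (parityFun_filtered.weight N F h).mono (by omega)

theorem parityFun_bracketOf (hΩ : IsOddForm d Ω) (F G : FormalFun 𝕜 d) :
    parityFun (bracketOf Ω F G) = - bracketOf Ω (parityFun F) (parityFun G) := by
  obtain ⟨M, hM⟩ := exists_weightGE F
  obtain ⟨N, hN⟩ := exists_weightGE G
  ext w
  rw [comp_parityFun, comp_neg, comp_bracketOf Ω hM hN,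
    comp_bracketOf Ω (weightGE_parityFun hM) (weightGE_parityFun hN), map_sum,
    ← Finset.sum_neg_distrib]
  exact Finset.sum_congr rfl fun v _ => by
    rw [comp_parityFun, comp_parityFun, parity_polyBracket hΩ]

theorem laplacianOf_mul (hΩ : IsOddForm d Ω) (F G : FormalFun 𝕜 d) :
    laplacianOf Ω (F * G) = laplacianOf Ω F * G + parityFun F * laplacianOf Ω G +
      bracketOf Ω (parityFun F) G := by
  have hP : ∃ k, IsFiltered k (parityFun (𝕜 := 𝕜) (d := d)) := ⟨_, parityFun_filtered⟩
  have hL : ∃ k, IsFiltered k (laplacianOf (d := d) Ω) := ⟨_, laplacianOf_filtered Ω⟩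
  refine filtered_ext₂ (f := fun F G => laplacianOf Ω (F * G))
    (g := fun F G => laplacianOf Ω F * G + parityFun F * laplacianOf Ω G +
      bracketOf Ω (parityFun F) G)
    (fun G => exists_filtered_comp hL (exists_filtered_mul_right G))
    (fun F => exists_filtered_comp hL (exists_filtered_mul_left F))
    (fun G => exists_filtered_add (exists_filtered_add
      (exists_filtered_comp (exists_filtered_mul_right _) hL)
      (exists_filtered_comp (exists_filtered_mul_right _) hP))
      (exists_filtered_comp (exists_filtered_bracket_left Ω G) hP))
    (fun F => exists_filtered_add (exists_filtered_add (exists_filtered_mul_left _)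
      (exists_filtered_comp (exists_filtered_mul_left _) hL))
      (exists_filtered_bracket_right Ω _)) fun v w => ?_
  have hx := comp_mem F v
  have hy := comp_mem G w
  have hx' : polyLaplacian Ω (comp F v) ∈ weightPart 𝕜 d (v - 2) :=
    polyLaplacian_mem Ω (by rwa [sub_add_cancel])
  have hy' : polyLaplacian Ω (comp G w) ∈ weightPart 𝕜 d (w - 2) :=
    polyLaplacian_mem Ω (by rwa [sub_add_cancel])
  simp only [inj_mul_inj rfl hx hy]
  rw [laplacianOf_inj Ω (u := v + w - 2) (by ring) (mul_mem_weightPart hx hy),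
    laplacianOf_inj Ω (u := v - 2) (by ring) hx, laplacianOf_inj Ω (u := w - 2) (by ring) hy,
    parityFun_inj hx, inj_mul_inj (u := v + w - 2) (by ring) hx' hy,
    inj_mul_inj (u := v + w - 2) (by ring) (parity_mem hx) hy',
    bracketOf_inj Ω (t := v + w - 2) (by ring) (parity_mem hx) hy, polyLaplacian_mul hΩ, map_add,
    map_add]

theorem mul_comm_of_even {A : FormalFun 𝕜 d} (hA : parityFun A = A) (F : FormalFun 𝕜 d) :
    A * F = F * A := by
  refine filtered_ext₂ (f := fun F G => F * G) (g := fun F G => G * F)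
    exists_filtered_mul_right exists_filtered_mul_left exists_filtered_mul_left
    exists_filtered_mul_right fun v w => ?_
  have h : parity (comp A v) = sgn 𝕜 0 • comp A v := by
    rw [← comp_parityFun, hA, sgn_zero, one_smul]
  rw [inj_mul_inj rfl (comp_mem A v) (comp_mem F w),
    inj_mul_inj (add_comm v w) (comp_mem F w) (comp_mem A v),
    mul_comm_of_parity h, tw_even (by decide)]

theorem mul_comm_of_odd {B : FormalFun 𝕜 d} (hB : parityFun B = -B) (F : FormalFun 𝕜 d) :
    B * F = parityFun F * B := by
  have hP : ∃ k, IsFiltered k (parityFun (𝕜 := 𝕜) (d := d)) := ⟨_, parityFun_filtered⟩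
  refine filtered_ext₂ (f := fun F G => F * G) (g := fun F G => parityFun G * F)
    exists_filtered_mul_right exists_filtered_mul_left
    (fun G => exists_filtered_mul_left _)
    (fun G => exists_filtered_comp (exists_filtered_mul_right _) hP) fun v w => ?_
  have h : parity (comp B v) = sgn 𝕜 1 • comp B v := by
    rw [← comp_parityFun, hB, sgn_odd (by decide), neg_one_smul, comp_neg]
  rw [inj_mul_inj rfl (comp_mem B v) (comp_mem F w), parityFun_inj (comp_mem F w),
    inj_mul_inj (add_comm v w) (parity_mem (comp_mem F w)) (comp_mem B v),
    mul_comm_of_parity h, tw_one_eq_parity]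

/-- The operator `t` is the twist by `n + 1` lifted to series. Taking it to be the identity or
`parityFun` treats odd and even `B` with one argument. -/
theorem bracketOf_mul_aux (hΩ : IsOddForm d Ω) {n : ℤ} {B : FormalFun 𝕜 d}
    (hB : ∀ v, parity (comp B v) = sgn 𝕜 n • comp B v) {t : FormalFun 𝕜 d → FormalFun 𝕜 d}
    (ht : ∃ k, IsFiltered k t)
    (ht' : ∀ v, ∀ x ∈ weightPart 𝕜 d v, tw (n + 1) x ∈ weightPart 𝕜 d v ∧
      t (inj 𝕜 d v x) = inj 𝕜 d v (tw (n + 1) x)) (F G : FormalFun 𝕜 d) :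
    bracketOf Ω B (F * G) = bracketOf Ω B F * G + t F * bracketOf Ω B G := by
  have hF : ∀ v w x y, x ∈ weightPart 𝕜 d v → y ∈ weightPart 𝕜 d w →
      bracketOf Ω B (inj 𝕜 d v x * inj 𝕜 d w y) = bracketOf Ω B (inj 𝕜 d v x) * inj 𝕜 d w y +
        t (inj 𝕜 d v x) * bracketOf Ω B (inj 𝕜 d w y) := by
    intro v w x y hx hy
    obtain ⟨h1, h2⟩ := ht' v x hx
    obtain ⟨k, hk⟩ := exists_filtered_bracket_left Ω (inj 𝕜 d v x * inj 𝕜 d w y)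
    obtain ⟨l, hl⟩ := exists_filtered_add
      (exists_filtered_comp (exists_filtered_mul_right (inj 𝕜 d w y))
        (exists_filtered_bracket_left Ω (inj 𝕜 d v x)))
      (exists_filtered_comp (exists_filtered_mul_left (t (inj 𝕜 d v x)))
        (exists_filtered_bracket_left Ω (inj 𝕜 d w y)))
    -- The identity is linear in `B` as well, so `B` too may be replaced by its homogeneous
    -- components.
    refine hk.ext hl fun u => ?_
    have hu := comp_mem B u
    have m1 : polyBracket Ω (comp B u) x ∈ weightPart 𝕜 d (u + v - 2) :=
      polyBracket_mem Ω hu (by rwa [show u + v - 2 + 2 - u = v by ring])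
    have m2 : polyBracket Ω (comp B u) y ∈ weightPart 𝕜 d (u + w - 2) :=
      polyBracket_mem Ω hu (by rwa [show u + w - 2 + 2 - u = w by ring])
    rw [h2, inj_mul_inj rfl hx hy,
      bracketOf_inj Ω (t := u + v + w - 2) (by ring) hu (mul_mem_weightPart hx hy),
      bracketOf_inj Ω (t := u + v - 2) (by ring) hu hx,
      bracketOf_inj Ω (t := u + w - 2) (by ring) hu hy,
      inj_mul_inj (u := u + v + w - 2) (by ring) m1 hy,
      inj_mul_inj (u := u + v + w - 2) (by ring) h1 m2, polyBracket_mul hΩ (hB u), map_add]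
  exact filtered_ext₂ (f := fun F G => bracketOf Ω B (F * G))
    (g := fun F G => bracketOf Ω B F * G + t F * bracketOf Ω B G)
    (fun G => exists_filtered_comp (exists_filtered_bracket_right Ω B) (exists_filtered_mul_right G))
    (fun F => exists_filtered_comp (exists_filtered_bracket_right Ω B) (exists_filtered_mul_left F))
    (fun G => exists_filtered_add
      (exists_filtered_comp (exists_filtered_mul_right G) (exists_filtered_bracket_right Ω B))
      (exists_filtered_comp (exists_filtered_mul_right _) ht))
    (fun F => exists_filtered_add (exists_filtered_mul_left _)
      (exists_filtered_comp (exists_filtered_mul_left _) (exists_filtered_bracket_right Ω B)))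
    fun v w => hF v w _ _ (comp_mem F v) (comp_mem G w)

theorem bracketOf_mul_of_odd (hΩ : IsOddForm d Ω) {B : FormalFun 𝕜 d} (hB : parityFun B = -B)
    (F G : FormalFun 𝕜 d) :
    bracketOf Ω B (F * G) = bracketOf Ω B F * G + F * bracketOf Ω B G := by
  refine bracketOf_mul_aux hΩ (n := 1) (t := fun F => F) (fun v => ?_) ⟨_, .id⟩
    (fun v x hx => ?_) F G
  · rw [← comp_parityFun, hB, sgn_odd (by decide), neg_one_smul, comp_neg]
  · rw [tw_even (by decide)]
    exact ⟨hx, rfl⟩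

theorem bracketOf_mul_of_even (hΩ : IsOddForm d Ω) {S : FormalFun 𝕜 d} (hS : parityFun S = S)
    (F G : FormalFun 𝕜 d) :
    bracketOf Ω S (F * G) = bracketOf Ω S F * G + parityFun F * bracketOf Ω S G := by
  refine bracketOf_mul_aux hΩ (n := 0) (t := parityFun) (fun v => ?_) ⟨_, parityFun_filtered⟩
    (fun v x hx => ?_) F G
  · rw [← comp_parityFun, hS, sgn_zero, one_smul]
  · rw [tw_odd (by decide)]
    exact ⟨parity_mem hx, parityFun_inj hx⟩

theorem laplacianOf_add (Ω : ι → ι → 𝕜) (F G : FormalFun 𝕜 d) :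
    laplacianOf Ω (F + G) = laplacianOf Ω F + laplacianOf Ω G := (laplacianOf_filtered Ω).map_add F G

theorem laplacianOf_smul (Ω : ι → ι → 𝕜) (r : 𝕜) (F : FormalFun 𝕜 d) :
    laplacianOf Ω (r • F) = r • laplacianOf Ω F := (laplacianOf_filtered Ω).map_smul r F

theorem laplacianOf_neg (Ω : ι → ι → 𝕜) (F : FormalFun 𝕜 d) :
    laplacianOf Ω (-F) = -laplacianOf Ω F := (laplacianOf_filtered Ω).map_neg F

theorem bracketOf_add_left (Ω : ι → ι → 𝕜) (F F' G : FormalFun 𝕜 d) :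
    bracketOf Ω (F + F') G = bracketOf Ω F G + bracketOf Ω F' G :=
  (exists_filtered_bracket_left Ω G).elim fun _ h => h.map_add F F'

theorem bracketOf_add_right (Ω : ι → ι → 𝕜) (F G G' : FormalFun 𝕜 d) :
    bracketOf Ω F (G + G') = bracketOf Ω F G + bracketOf Ω F G' :=
  (exists_filtered_bracket_right Ω F).elim fun _ h => h.map_add G G'

theorem bracketOf_neg_left (Ω : ι → ι → 𝕜) (F G : FormalFun 𝕜 d) :
    bracketOf Ω (-F) G = -bracketOf Ω F G :=
  (exists_filtered_bracket_left Ω G).elim fun _ h => h.map_neg F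

/-- Apply `Δ` to the product formula for `Δ(B F)`: the left side vanishes since `Δ² = 0`, and
expanding the right side once more leaves exactly this relation. -/
theorem laplacianOf_bracketOf (hΩ : IsOddForm d Ω) {B : FormalFun 𝕜 d} (hB : parityFun B = -B)
    (F : FormalFun 𝕜 d) : laplacianOf Ω (bracketOf Ω B F) =
      bracketOf Ω (laplacianOf Ω B) F + bracketOf Ω B (laplacianOf Ω F) := by
  have hLB : parityFun (laplacianOf Ω B) = laplacianOf Ω B := by
    rw [parityFun_laplacianOf hΩ, hB, laplacianOf_neg, neg_neg]
  have h1 := laplacianOf_mul hΩ B F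
  rw [hB, bracketOf_neg_left] at h1
  have h2 := congrArg (laplacianOf Ω) h1
  rw [laplacianOf_laplacianOf hΩ, laplacianOf_add, laplacianOf_add, laplacianOf_neg, neg_mul,
    laplacianOf_neg, laplacianOf_mul hΩ, laplacianOf_mul hΩ, hLB, hB, bracketOf_neg_left,
    laplacianOf_laplacianOf hΩ, laplacianOf_laplacianOf hΩ, zero_mul, mul_zero] at h2
  rw [← sub_eq_zero, ← neg_eq_zero, h2]
  abel

/-- Apply `Δ` to the Leibniz rule for `{B, F G}`. After cancelling the terms known from
`laplacianOf_bracketOf`, what remains is the Jacobi identity with `F` replaced by its parity twist;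
since the twist is an involution, this covers every `F`. -/
theorem bracketOf_jacobi (hΩ : IsOddForm d Ω) {B : FormalFun 𝕜 d} (hB : parityFun B = -B)
    (F G : FormalFun 𝕜 d) : bracketOf Ω B (bracketOf Ω F G) =
      bracketOf Ω (bracketOf Ω B F) G + bracketOf Ω F (bracketOf Ω B G) := by
  have hLB : parityFun (laplacianOf Ω B) = laplacianOf Ω B := by
    rw [parityFun_laplacianOf hΩ, hB, laplacianOf_neg, neg_neg]
  have key : ∀ F, bracketOf Ω B (bracketOf Ω (parityFun F) G) =
      bracketOf Ω (bracketOf Ω B (parityFun F)) G +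
        bracketOf Ω (parityFun F) (bracketOf Ω B G) := by
    intro F
    have hPB : parityFun (bracketOf Ω B F) = bracketOf Ω B (parityFun F) := by
      rw [parityFun_bracketOf hΩ, hB, bracketOf_neg_left, neg_neg]
    have h1 := congrArg (laplacianOf Ω) (bracketOf_mul_of_odd hΩ hB F G)
    rw [laplacianOf_bracketOf hΩ hB, laplacianOf_add, bracketOf_mul_of_even hΩ hLB,
      laplacianOf_mul hΩ F G, bracketOf_add_right, bracketOf_add_right,
      bracketOf_mul_of_odd hΩ hB, bracketOf_mul_of_odd hΩ hB, laplacianOf_mul hΩ,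
      laplacianOf_mul hΩ, laplacianOf_bracketOf hΩ hB, laplacianOf_bracketOf hΩ hB, hPB,
      add_mul, mul_add, ← sub_eq_zero] at h1
    rw [← sub_eq_zero, ← h1]
    abel
  have := key (parityFun F)
  rwa [parityFun_parityFun] at this

/-- The bracket is the defect of `Δ` on products, so its symmetry is read off from `Δ(A S) = Δ(S
A)`. -/
theorem bracketOf_comm_of_even (hΩ : IsOddForm d Ω) {A S : FormalFun 𝕜 d} (hA : parityFun A = A)
    (hS : parityFun S = S) : bracketOf Ω A S = bracketOf Ω S A := by
  have h1 := laplacianOf_mul hΩ A S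
  rw [mul_comm_of_even hA S, laplacianOf_mul hΩ, hA, hS, mul_comm_of_even hS,
    ← mul_comm_of_even hA, add_comm (A * laplacianOf Ω S)] at h1
  exact (add_left_cancel h1).symm

theorem bracketOf_comm_of_odd (hΩ : IsOddForm d Ω) {B S : FormalFun 𝕜 d} (hB : parityFun B = -B)
    (hS : parityFun S = S) : bracketOf Ω B S = -bracketOf Ω S B := by
  have h1 := laplacianOf_mul hΩ S B
  have h2 := laplacianOf_mul hΩ B S
  have hLS : parityFun (laplacianOf Ω S) = -laplacianOf Ω S := by
    rw [parityFun_laplacianOf hΩ, hS]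
  rw [mul_comm_of_even hS B, h2, hB, hS, bracketOf_neg_left, mul_comm_of_even hS,
    mul_comm_of_odd hLS, hB, add_comm (-B * laplacianOf Ω S)] at h1
  rw [← neg_eq_iff_eq_neg]
  exact add_left_cancel h1

/-! ### Powers of `ħ` -/

theorem hbar_mul_hbar (g h : ℤ) : hbar 𝕜 d g * hbar 𝕜 d h = hbar 𝕜 d (g + h) := by
  rw [hbar_eq_inj, hbar_eq_inj, hbar_eq_inj, inj_mul_inj (u := 2 * (g + h)) (by ring)
    (mono_mem (by simp)) (mono_mem (by simp)), mono_mul_mono, List.append_nil]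

theorem hbar_zero : hbar 𝕜 d 0 = 1 := by
  ext w
  change (HahnSeries.single (2 * 0) (mono 𝕜 d 0 [])).coeff w =
    (1 : HahnSeries ℤ (GradedSym 𝕜 d)).coeff w
  simp [mono]

theorem parityFun_hbar (g : ℤ) : parityFun (hbar 𝕜 d g) = hbar 𝕜 d g := by
  rw [hbar_eq_inj, parityFun_inj (mono_mem (by simp))]
  simp [mono]

theorem hbar_mul_comm (g : ℤ) (F : FormalFun 𝕜 d) : hbar 𝕜 d g * F = F * hbar 𝕜 d g :=
  mul_comm_of_even (parityFun_hbar g) F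

theorem weightGE_hbar (g : ℤ) : WeightGE (hbar 𝕜 d g) (2 * g) := by
  rw [hbar_eq_inj]; exact weightGE_inj _ _

theorem hbar_mul_inj (g : ℤ) {u v : ℤ} (h : u = 2 * g + v) {x : GradedSym 𝕜 d}
    (hx : x ∈ weightPart 𝕜 d v) : hbar 𝕜 d g * inj 𝕜 d v x =
      inj 𝕜 d u ((LaurentPolynomial.T g : LaurentPolynomial 𝕜) • x) := by
  rw [hbar_eq_inj, inj_mul_inj h (mono_mem (by simp)) hx, T_smul_eq]

theorem comp_hbar_mul (g : ℤ) (F : FormalFun 𝕜 d) (w : ℤ) : comp (hbar 𝕜 d g * F) w =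
    (LaurentPolynomial.T g : LaurentPolynomial 𝕜) • comp F (w - 2 * g) := by
  obtain ⟨N, hN⟩ := exists_weightGE F
  have hx : ∀ v, (LaurentPolynomial.T g : LaurentPolynomial 𝕜) • comp F v ∈
      weightPart 𝕜 d (2 * g + v) := fun v => T_smul_mem_weightPart g (comp_mem F v)
  rw [((IsFiltered.mul_left (weightGE_hbar g)).comp_eq_sum hN)]
  simp only [hbar_mul_inj g rfl (comp_mem F _)]
  by_cases h : N ≤ w - 2 * g
  · rw [Finset.sum_eq_single (w - 2 * g) (fun v _ hv => comp_inj_of_ne (by omega) _)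
      (fun h' => absurd (Finset.mem_Ico.2 ⟨h, by omega⟩) h')]
    have := hx (w - 2 * g)
    rw [show 2 * g + (w - 2 * g) = w by ring] at this ⊢
    rw [comp_inj_self this]
  · rw [Finset.Ico_eq_empty (by omega), Finset.sum_empty, hN _ (by omega), smul_zero]

theorem laplacianOf_hbar_mul (Ω : ι → ι → 𝕜) (g : ℤ) (F : FormalFun 𝕜 d) :
    laplacianOf Ω (hbar 𝕜 d g * F) = hbar 𝕜 d g * laplacianOf Ω F := by
  ext w
  rw [comp_laplacianOf, comp_hbar_mul, comp_hbar_mul, comp_laplacianOf, polyLaplacian_smul]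
  congr 3
  ring

theorem bracketOf_hbar_mul_right (Ω : ι → ι → 𝕜) (g : ℤ) (F G : FormalFun 𝕜 d) :
    bracketOf Ω F (hbar 𝕜 d g * G) = hbar 𝕜 d g * bracketOf Ω F G := by
  refine filtered_ext₂ (f := fun F G => bracketOf Ω F (hbar 𝕜 d g * G))
    (g := fun F G => hbar 𝕜 d g * bracketOf Ω F G)
    (fun G => exists_filtered_bracket_left Ω _)
    (fun F => exists_filtered_comp (exists_filtered_bracket_right Ω F) (exists_filtered_mul_left _))
    (fun G => exists_filtered_comp (exists_filtered_mul_left _) (exists_filtered_bracket_left Ω G))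
    (fun F => exists_filtered_comp (exists_filtered_mul_left _) (exists_filtered_bracket_right Ω F))
    fun v w => ?_
  have hx := comp_mem F v
  have hy := comp_mem G w
  have h1 : polyBracket Ω (comp F v) (comp G w) ∈ weightPart 𝕜 d (v + w - 2) :=
    polyBracket_mem Ω hx (by rwa [show v + w - 2 + 2 - v = w by ring])
  rw [hbar_mul_inj g rfl hy, bracketOf_inj Ω (t := 2 * g + (v + w - 2)) (by ring) hx
    (T_smul_mem_weightPart g hy), bracketOf_inj Ω (t := v + w - 2) (by ring) hx hy,
    hbar_mul_inj g rfl h1, polyBracket_smul_right]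

theorem bracketOf_hbar_mul_left (Ω : ι → ι → 𝕜) (g : ℤ) (F G : FormalFun 𝕜 d) :
    bracketOf Ω (hbar 𝕜 d g * F) G = hbar 𝕜 d g * bracketOf Ω F G := by
  refine filtered_ext₂ (f := fun F G => bracketOf Ω (hbar 𝕜 d g * F) G)
    (g := fun F G => hbar 𝕜 d g * bracketOf Ω F G)
    (fun G => exists_filtered_comp (exists_filtered_bracket_left Ω G) (exists_filtered_mul_left _))
    (fun F => exists_filtered_bracket_right Ω _)
    (fun G => exists_filtered_comp (exists_filtered_mul_left _) (exists_filtered_bracket_left Ω G))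
    (fun F => exists_filtered_comp (exists_filtered_mul_left _) (exists_filtered_bracket_right Ω F))
    fun v w => ?_
  have hx := comp_mem F v
  have hy := comp_mem G w
  have h1 : polyBracket Ω (comp F v) (comp G w) ∈ weightPart 𝕜 d (v + w - 2) :=
    polyBracket_mem Ω hx (by rwa [show v + w - 2 + 2 - v = w by ring])
  rw [hbar_mul_inj g rfl hx, bracketOf_inj Ω (t := 2 * g + (v + w - 2)) (by ring)
    (T_smul_mem_weightPart g hx) hy, bracketOf_inj Ω (t := v + w - 2) (by ring) hx hy,
    hbar_mul_inj g rfl h1, polyBracket_smul_left]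

theorem bracketOf_one (Ω : ι → ι → 𝕜) (F : FormalFun 𝕜 d) : bracketOf Ω F 1 = 0 := by
  obtain ⟨k, hk⟩ := exists_filtered_bracket_left Ω (1 : FormalFun 𝕜 d)
  refine hk.ext (IsFiltered.zero 0) fun v => ?_
  have h1 : (1 : FormalFun 𝕜 d) = inj 𝕜 d 0 1 := by
    rw [← hbar_zero, hbar_eq_inj]
    simp [mono]
  have h2 : (1 : GradedSym 𝕜 d) ∈ weightPart 𝕜 d 0 := by
    simpa using prod_mem (𝕜 := 𝕜) (d := d) []
  rw [h1, bracketOf_inj Ω (t := v - 2) (by ring) (comp_mem F v) h2]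
  simp [polyBracket]

/-- Powers of `ħ` are central for the bracket; this makes the flow `ħ`-linear. -/
theorem bracketOf_hbar (Ω : ι → ι → 𝕜) (F : FormalFun 𝕜 d) (g : ℤ) :
    bracketOf Ω F (hbar 𝕜 d g) = 0 := by
  rw [← mul_one (hbar 𝕜 d g), bracketOf_hbar_mul_right, bracketOf_one, mul_zero]

end BVIdentities

/-! ### Genus, length and degree of monomials under the operations -/

section MonomialSpans

variable {𝕜 : Type*} [RCLike 𝕜] {ι : Type*} {d : ι → ℤ} {Ω : ι → ι → 𝕜}

theorem monoSpan_mono {Q R : ℤ → List ι → Prop} (h : ∀ g l, Q g l → R g l) :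
    monoSpan 𝕜 d Q ≤ monoSpan 𝕜 d R :=
  Submodule.span_mono fun _ ⟨g, l, hQ, hx⟩ => ⟨g, l, h g l hQ, hx⟩

theorem mul_mem_monoSpan {Q R S : ℤ → List ι → Prop}
    (h : ∀ g l k m, Q g l → R k m → S (g + k) (l ++ m)) {x y : GradedSym 𝕜 d}
    (hx : x ∈ monoSpan 𝕜 d Q) (hy : y ∈ monoSpan 𝕜 d R) : x * y ∈ monoSpan 𝕜 d S := by
  induction hx, hy using Submodule.span_induction₂ with
  | mem_mem x y hx hy =>
    obtain ⟨g, l, hl, rfl⟩ := hx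
    obtain ⟨k, m, hm, rfl⟩ := hy
    rw [mono_mul_mono]
    exact mono_mem (h _ _ _ _ hl hm)
  | zero_left y _ => simp
  | zero_right x _ => simp
  | add_left x y z _ _ _ h1 h2 => rw [add_mul]; exact add_mem h1 h2
  | add_right x y z _ _ _ h1 h2 => rw [mul_add]; exact add_mem h1 h2
  | smul_left r x y _ _ h => rw [smul_mul_assoc]; exact Submodule.smul_mem _ _ h
  | smul_right r x y _ _ h => rw [mul_smul_comm]; exact Submodule.smul_mem _ _ h

theorem map_mem_monoSpan {Q R : ℤ → List ι → Prop}
    (f : GradedSym 𝕜 d →ₗ[LaurentPolynomial 𝕜] GradedSym 𝕜 d)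
    (hf : ∀ g l, Q g l → f (mono 𝕜 d g l) ∈ monoSpan 𝕜 d R) {x : GradedSym 𝕜 d}
    (hx : x ∈ monoSpan 𝕜 d Q) : f x ∈ monoSpan 𝕜 d R := by
  induction hx using Submodule.span_induction with
  | mem x hx =>
    obtain ⟨g, l, hl, rfl⟩ := hx
    exact hf g l hl
  | zero => simp
  | add x y _ _ h1 h2 => rw [map_add]; exact add_mem h1 h2
  | smul r x _ h =>
    rw [algebra_compatible_smul (LaurentPolynomial 𝕜) r x, map_smul, ← algebra_compatible_smul]
    exact Submodule.smul_mem _ _ h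

theorem mono_cons (g : ℤ) (i : ι) (l : List ι) :
    mono 𝕜 d g (i :: l) = gen 𝕜 d i * mono 𝕜 d g l := by
  simp [mono]

theorem tw_mono (n g : ℤ) (l : List ι) :
    tw n (mono 𝕜 d g l) = sgn 𝕜 (n * (l.map d).sum) • mono 𝕜 d g l := by
  induction l with
  | nil => simp [mono]
  | cons i l ih =>
    rw [mono_cons, map_mul, ih, tw_gen, smul_mul_smul_comm, ← sgn_add, ← mul_add, List.map_cons,
      List.sum_cons]

theorem leftD_mono_mem (i : ι) (g : ℤ) (l : List ι) : leftD i (mono 𝕜 d g l) ∈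
    monoSpan 𝕜 d fun k m => k = g ∧ m.length + 1 = l.length ∧
      (m.map d).sum + d i = (l.map d).sum := by
  classical
  induction l with
  | nil =>
    have : leftD i (mono 𝕜 d g []) = 0 := by simp [mono]
    rw [this]
    exact zero_mem _
  | cons j l ih =>
    rw [mono_cons, leftD_mul, leftD_gen, tw_gen, smul_mul_assoc]
    refine add_mem ?_ (sgn_smul_mem _ _ ?_)
    · split_ifs with h
      · subst h
        rw [one_mul]
        exact mono_mem ⟨rfl, by simp, by simp [add_comm]⟩
      · rw [zero_mul]
        exact zero_mem _
    · have h : gen 𝕜 d j ∈ monoSpan 𝕜 d fun k m => k = 0 ∧ m = [j] := by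
        have := mono_mem (𝕜 := 𝕜) (d := d) (Q := fun k m => k = 0 ∧ m = [j]) ⟨rfl, rfl⟩
        simpa [mono] using this
      refine mul_mem_monoSpan ?_ h ih
      rintro k m k' m' ⟨rfl, rfl⟩ ⟨rfl, h1, h2⟩
      refine ⟨zero_add _, by simpa using h1, ?_⟩
      simp only [List.singleton_append, List.map_cons, List.sum_cons]
      omega

theorem leftD_mem_monoSpan (i : ι) {Q : ℤ → List ι → Prop} {x : GradedSym 𝕜 d}
    (hx : x ∈ monoSpan 𝕜 d Q) : leftD i x ∈ monoSpan 𝕜 d fun g m =>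
      ∃ l, Q g l ∧ m.length + 1 = l.length ∧ (m.map d).sum + d i = (l.map d).sum :=
  map_mem_monoSpan _ (fun g l h => monoSpan_mono (by
    rintro _ m ⟨rfl, h1, h2⟩
    exact ⟨l, h, h1, h2⟩) (leftD_mono_mem i g l)) hx

theorem rightD_mem_monoSpan (i : ι) {Q : ℤ → List ι → Prop} {x : GradedSym 𝕜 d}
    (hx : x ∈ monoSpan 𝕜 d Q) : rightD i x ∈ monoSpan 𝕜 d fun g m =>
      ∃ l, Q g l ∧ m.length + 1 = l.length ∧ (m.map d).sum + d i = (l.map d).sum := by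
  rw [rightD_eq]
  refine sgn_smul_mem _ _ (leftD_mem_monoSpan i ?_)
  refine map_mem_monoSpan (tw (d i)).toLinearMap (fun g l h => ?_) hx
  rw [AlgHom.toLinearMap_apply, tw_mono]
  exact sgn_smul_mem _ _ (mono_mem h)

/-- The bracket adds genera, removes one letter from each monomial, and raises the total degree by
`1`, because paired letters have degree sum `-1`. The general predicates let degree and regularity
share this count. -/
theorem polyBracket_mem_monoSpan (hΩ : IsOddForm d Ω) {Q R S : ℤ → List ι → Prop}
    (h : ∀ g l k m n, Q g l → R k m → n.length + 2 = l.length + m.length →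
      (n.map d).sum = (l.map d).sum + (m.map d).sum + 1 → S (g + k) n) {x y : GradedSym 𝕜 d}
    (hx : x ∈ monoSpan 𝕜 d Q) (hy : y ∈ monoSpan 𝕜 d R) :
    polyBracket Ω x y ∈ monoSpan 𝕜 d S := by
  refine finsum_mem_submodule _ _ fun p => ?_
  by_cases hp : Ω p.1 p.2 = 0
  · rw [hp, zero_smul]
    exact zero_mem _
  have hd := hΩ.degree _ _ hp
  refine Submodule.smul_mem _ _ (mul_mem_monoSpan ?_ (rightD_mem_monoSpan p.1 hx)
    (leftD_mem_monoSpan p.2 hy))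
  rintro g l k m ⟨l', hl, h1, h2⟩ ⟨m', hm, h3, h4⟩
  refine h _ _ _ _ _ hl hm ?_ ?_
  · rw [List.length_append]; omega
  · rw [List.map_append, List.sum_append]; omega

theorem HasDegree.bracketOf (hΩ : IsOddForm d Ω) {F G : FormalFun 𝕜 d} {m n : ℤ}
    (hF : HasDegree F m) (hG : HasDegree G n) : HasDegree (bracketOf Ω F G) (m + n + 1) := by
  intro w
  refine finsum_mem_submodule _ _ fun v => polyBracket_mem_monoSpan hΩ ?_ (hF _) (hG _)
  rintro g l k m n rfl rfl - h
  exact h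

theorem IsRegular.bracketOf (hΩ : IsOddForm d Ω) {F G : FormalFun 𝕜 d}
    (hF : IsRegular F) (hG : IsRegular G) : IsRegular (bracketOf Ω F G) := by
  intro w
  refine finsum_mem_submodule _ _ fun v => polyBracket_mem_monoSpan hΩ ?_ (hF _) (hG _)
  rintro g l k m n ⟨h1, h2⟩ ⟨h3, h4⟩ h5 -
  constructor <;> omega

theorem HasDegree.add {F G : FormalFun 𝕜 d} {n : ℤ} (hF : HasDegree F n) (hG : HasDegree G n) :
    HasDegree (F + G) n := fun w => add_mem (hF w) (hG w)

theorem HasDegree.neg {F : FormalFun 𝕜 d} {n : ℤ} (hF : HasDegree F n) :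
    HasDegree (-F) n := fun w => by rw [comp_neg]; exact neg_mem (hF w)

theorem IsRegular.neg {F : FormalFun 𝕜 d} (hF : IsRegular F) : IsRegular (-F) :=
  fun w => by rw [comp_neg]; exact neg_mem (hF w)

theorem HasDegree.parityFun_eq {F : FormalFun 𝕜 d} {n : ℤ} (hF : HasDegree F n) (w : ℤ) :
    comp (parityFun F) w = sgn 𝕜 n • comp F w := by
  rw [comp_parityFun, ← tw_one_eq_parity]
  have h := hF w
  generalize comp F w = x at h
  induction h using Submodule.span_induction with
  | mem x hx =>
    obtain ⟨g, l, rfl, rfl⟩ := hx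
    rw [tw_mono, one_mul]
  | zero => simp
  | add x y _ _ h1 h2 => rw [map_add, smul_add, h1, h2]
  | smul r x _ h =>
    rw [algebra_compatible_smul (LaurentPolynomial 𝕜) r x, map_smul, h, smul_comm]

theorem HasDegree.even {F : FormalFun 𝕜 d} (hF : HasDegree F 0) : parityFun F = F := by
  ext w; rw [hF.parityFun_eq, sgn_zero, one_smul]

theorem HasDegree.odd {F : FormalFun 𝕜 d} (hF : HasDegree F (-1)) : parityFun F = -F := by
  ext w; rw [hF.parityFun_eq, sgn_odd (by decide), neg_one_smul, comp_neg]

theorem polyLaplacian_gen (Ω : ι → ι → 𝕜) (i : ι) : polyLaplacian Ω (gen 𝕜 d i) = 0 := by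
  classical
  simp [polyLaplacian, leftD_gen, apply_ite]

/-- The bracket of two generators is a constant, and constants are even. -/
theorem parity_polyBracket_gen (Ω : ι → ι → 𝕜) (i j : ι) :
    parity (polyBracket Ω (gen 𝕜 d i) (gen 𝕜 d j)) = polyBracket Ω (gen 𝕜 d i) (gen 𝕜 d j) := by
  classical
  obtain ⟨s, hx, hy, -⟩ := exists_involves₃ (gen 𝕜 d i) (gen 𝕜 d j) 0
  rw [polyBracket_eq_sum Ω hx hy]
  simp only [map_sum, map_smul, map_mul, leftD_gen, rightD_gen, apply_ite parity, map_one, map_zero]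

/-- `Δ S` is an odd constant, and thus zero, for a quadratic function `S` of degree `0`. -/
theorem laplacianOf_quadratic (hΩ : IsOddForm d Ω) {S : FormalFun 𝕜 d}
    (h2 : ∀ w, w ≠ 2 → comp S w = 0)
    (hq : comp S 2 ∈ monoSpan 𝕜 d fun g l => g = 0 ∧ l.length = 2) (hS : parityFun S = S) :
    laplacianOf Ω S = 0 := by
  ext w
  rw [comp_laplacianOf, comp_zero]
  by_cases hw : w + 2 = 2
  · rw [hw]
    -- Since `Δ` is odd and `S` even, `-Δ x` is the parity twist of `Δ x`. It remains to see that `Δ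
    -- x` is invariant under this twist, which is checked on products of two generators.
    apply two_smul_eq_zero
    conv_rhs => rw [← hS, comp_parityFun, ← parity_polyLaplacian hΩ]
    clear hS
    generalize comp S 2 = x at hq
    induction hq using Submodule.span_induction with
    | mem x hx =>
      obtain ⟨g, l, ⟨rfl, hl⟩, rfl⟩ := hx
      obtain ⟨i, j, rfl⟩ := List.length_eq_two.1 hl
      have : mono 𝕜 d 0 [i, j] = gen 𝕜 d i * gen 𝕜 d j := by simp [mono]
      rw [this, polyLaplacian_mul hΩ, polyLaplacian_gen, polyLaplacian_gen, zero_mul, mul_zero,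
        ← tw_one_eq_parity (gen 𝕜 d i), tw_gen, polyBracket_smul_left, zero_add, zero_add, map_smul,
        parity_polyBracket_gen]
    | zero => simp
    | add x y _ _ h1 h2 => rw [polyLaplacian_add, map_add, ← h1, ← h2]
    | smul r x _ h =>
      rw [algebra_compatible_smul (LaurentPolynomial 𝕜) r x, polyLaplacian_smul, map_smul, ← h]
  · rw [h2 _ hw, polyLaplacian_zero]

end MonomialSpans

/-! ### The inverse matrix of the symplectic form -/

section InverseForm

variable {𝕜 V ι : Type*} [RCLike 𝕜] [AddCommGroup V] [Module 𝕜 V] (X : OddSymplecticSpace 𝕜 V)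
  (b : HomogeneousBasis X ι)

/-- The graded sign is invisible: where the form is nonzero the degrees sum to `1`, so their product
is even. Plain antisymmetry then extends linearly from a homogeneous basis to all vectors. -/
theorem form_antisymm {𝕜 V ι : Type*} [RCLike 𝕜] [AddCommGroup V] [Module 𝕜 V]
    (X : OddSymplecticSpace 𝕜 V) (b : HomogeneousBasis X ι) (v w : V) : X.form v w = -X.form w v := by
  have h : X.form = -X.form.flip := by
    refine b.basis.ext fun i => b.basis.ext fun j => ?_
    exact X.form_swap (b.mem i) (b.mem j)
  exact LinearMap.congr_fun (LinearMap.congr_fun h v) w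

theorem form_dualVector (i j : ι) :
    X.form (b.basis i) (X.dualVector b j) = b.basis.coord j (b.basis i) :=
  (X.exists_dual b j).choose_spec i

theorem form_dualVector_right (v : V) (j : ι) :
    X.form v (X.dualVector b j) = b.basis.coord j v := by
  have h : X.form.flip (X.dualVector b j) = b.basis.coord j :=
    b.basis.ext fun i => form_dualVector X b i j
  exact LinearMap.congr_fun h v

/-- Expressing the inverse matrix through the form itself makes its antisymmetry and its degree
condition consequences of those of the form. -/
theorem invForm_eq (i j : ι) : X.invForm b i j = X.form (X.dualVector b j) (X.dualVector b i) :=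
  (form_dualVector_right X b _ _).symm

/-- The dual vector is merely a chosen solution of its defining equations, so homogeneity comes from
uniqueness: by nondegeneracy it equals its component `u` of degree `1 - deg j`. -/
theorem dualVector_mem (j : ι) : X.dualVector b j ∈ X.grading (1 - b.deg j) := by
  classical
  let u : V := ((b.basis.repr (X.dualVector b j)).filter fun i => b.deg i = 1 - b.deg j).sum
    fun i c => c • b.basis i
  have hu : u ∈ X.grading (1 - b.deg j) := by
    refine Submodule.sum_mem _ fun i hi => Submodule.smul_mem _ _ ?_
    rw [Finsupp.support_filter, Finset.mem_filter] at hi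
    rw [← hi.2]
    exact b.mem i
  have hcoord : ∀ k, b.basis.coord k u =
      if b.deg k = 1 - b.deg j then b.basis.coord k (X.dualVector b j) else 0 := by
    intro k
    have : b.basis.repr u =
        (b.basis.repr (X.dualVector b j)).filter fun i => b.deg i = 1 - b.deg j := by
      change b.basis.repr (Finsupp.linearCombination 𝕜 b.basis _) = _
      rw [b.basis.repr_linearCombination]
    rw [Module.Basis.coord_apply, this, Finsupp.filter_apply]
    rfl
  suffices h : X.dualVector b j - u = 0 by
    rw [sub_eq_zero.1 h]
    exact hu
  apply X.form_nondegenerate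
  intro w
  rw [form_antisymm X b, neg_eq_zero]
  have h : X.form.flip (X.dualVector b j - u) = 0 := by
    refine b.basis.ext fun i => ?_
    rw [LinearMap.flip_apply, LinearMap.zero_apply]
    -- If `e_i` has the degree of `e_j`, it pairs only with degree `1 - deg j`, where the difference
    -- has no coordinates. Otherwise both pairings with `e_i` vanish separately.
    by_cases hi : b.deg i = b.deg j
    · have h1 : X.dualVector b j - u = ∑ k ∈ ((b.basis.repr (X.dualVector b j - u)).support),
          b.basis.coord k (X.dualVector b j - u) • b.basis k := by
        conv_lhs => rw [← b.basis.linearCombination_repr (X.dualVector b j - u)]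
        rfl
      rw [h1, map_sum]
      refine Finset.sum_eq_zero fun k _ => ?_
      rw [map_smul, map_sub, hcoord]
      split_ifs with hk
      · rw [sub_self, zero_smul]
      · rw [X.form_degree _ _ (by omega) _ (b.mem i) _ (b.mem k), smul_zero]
    · rw [map_sub, form_dualVector, X.form_degree _ _ (by omega) _ (b.mem i) _ hu,
        Module.Basis.coord_apply, Module.Basis.repr_self,
        Finsupp.single_eq_of_ne (fun h => hi (by rw [h])), sub_zero]
  exact LinearMap.congr_fun h w

theorem isOddForm_invForm : IsOddForm b.dualDeg (X.invForm b) where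
  degree i j h := by
    by_contra hd
    rw [invForm_eq] at h
    refine h (X.form_degree _ _ ?_ _ (dualVector_mem X b j) _ (dualVector_mem X b i))
    simp only [HomogeneousBasis.dualDeg] at hd
    omega
  antisymm i j := by rw [invForm_eq, invForm_eq, form_antisymm X b]

end InverseForm

/-! ### Smooth paths and weak derivatives in a vector space -/

section Paths

variable {𝕜 : Type*} [RCLike 𝕜] {E E' : Type*} [AddCommGroup E] [Module 𝕜 E] [AddCommGroup E']
  [Module 𝕜 E']

theorem SmoothPath.of_fintype {κ : Type*} [Fintype κ] {f : ℝ → E} (c : κ → ℝ → 𝕜) (x : κ → E)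
    (hc : ∀ k, ContDiffOn ℝ ∞ (c k) (Set.Icc 0 1))
    (hf : ∀ t ∈ Set.Icc (0 : ℝ) 1, f t = ∑ k, c k t • x k) : SmoothPath (𝕜 := 𝕜) f := by
  refine ⟨Fintype.card κ, fun k => c ((Fintype.equivFin κ).symm k),
    fun k => x ((Fintype.equivFin κ).symm k), fun k => hc _, fun t ht => ?_⟩
  rw [hf t ht]
  exact ((Fintype.equivFin κ).symm.sum_comp fun k => c k t • x k).symm

theorem SmoothPath.congr {f g : ℝ → E} (hf : SmoothPath (𝕜 := 𝕜) f)
    (h : ∀ t ∈ Set.Icc (0 : ℝ) 1, g t = f t) : SmoothPath (𝕜 := 𝕜) g := by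
  obtain ⟨n, c, x, hc, hx⟩ := hf
  exact ⟨n, c, x, hc, fun t ht => (h t ht).trans (hx t ht)⟩

theorem smoothPath_const (x : E) : SmoothPath (𝕜 := 𝕜) fun _ => x :=
  ⟨1, fun _ _ => 1, fun _ => x, fun _ => contDiffOn_const, fun t _ => by simp⟩

theorem SmoothPath.add {f g : ℝ → E} (hf : SmoothPath (𝕜 := 𝕜) f) (hg : SmoothPath (𝕜 := 𝕜) g) :
    SmoothPath (𝕜 := 𝕜) fun t => f t + g t := by
  obtain ⟨n, c, x, hc, hx⟩ := hf
  obtain ⟨m, c', x', hc', hx'⟩ := hg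
  refine .of_fintype (Sum.elim c c') (Sum.elim x x') (fun k => ?_) fun t ht => ?_
  · rcases k with k | k
    exacts [hc k, hc' k]
  · rw [hx t ht, hx' t ht, Fintype.sum_sum_type]
    rfl

theorem SmoothPath.sum {α : Type*} (s : Finset α) {f : α → ℝ → E}
    (hf : ∀ a ∈ s, SmoothPath (𝕜 := 𝕜) (f a)) : SmoothPath (𝕜 := 𝕜) fun t => ∑ a ∈ s, f a t := by
  classical
  induction s using Finset.induction_on with
  | empty => simpa using smoothPath_const (𝕜 := 𝕜) (0 : E)
  | insert a s ha ih =>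
    simp only [Finset.sum_insert ha]
    exact (hf a (Finset.mem_insert_self a s)).add
      (ih fun b hb => hf b (Finset.mem_insert_of_mem hb))

theorem SmoothPath.smul {c : ℝ → 𝕜} (hc : ContDiffOn ℝ ∞ c (Set.Icc 0 1)) {f : ℝ → E}
    (hf : SmoothPath (𝕜 := 𝕜) f) : SmoothPath (𝕜 := 𝕜) fun t => c t • f t := by
  obtain ⟨n, c', x, hc', hx⟩ := hf
  refine ⟨n, fun k t => c t * c' k t, x, fun k => hc.mul (hc' k), fun t ht => ?_⟩
  simp only [hx t ht, Finset.smul_sum, mul_smul]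

/-- The path `f` has the weak derivative `f'` at `t`, along `[0, 1]`. -/
def WeakDeriv (𝕜 : Type*) [RCLike 𝕜] {E : Type*} [AddCommGroup E] [Module 𝕜 E] (f : ℝ → E) (f' : E)
    (t : ℝ) : Prop :=
  ∀ L : E →ₗ[𝕜] 𝕜, HasDerivWithinAt (fun s => L (f s)) (L f') (Set.Icc 0 1) t

theorem uniqueDiff_unitInterval {t : ℝ} (ht : t ∈ Set.Icc (0 : ℝ) 1) :
    UniqueDiffWithinAt ℝ (Set.Icc (0 : ℝ) 1) t := uniqueDiffOn_Icc zero_lt_one t ht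

/-- With derivatives tested on all linear functionals, every subspace behaves as if closed: a vector
outside it is separated from it by a functional vanishing on it. -/
theorem WeakDeriv.mem {f : ℝ → E} {f' : E} {t : ℝ} (ht : t ∈ Set.Icc (0 : ℝ) 1)
    (h : WeakDeriv 𝕜 f f' t) (Q : Submodule 𝕜 E) (hf : ∀ s ∈ Set.Icc (0 : ℝ) 1, f s ∈ Q) :
    f' ∈ Q := by
  by_contra hx
  obtain ⟨L, hL, hQ⟩ := Submodule.exists_le_ker_of_notMem hx
  have h0 : HasDerivWithinAt (fun s => L (f s)) 0 (Set.Icc 0 1) t :=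
    (hasDerivWithinAt_const t _ (0 : 𝕜)).congr_of_mem (fun s hs => hQ (hf s hs)) ht
  exact hL ((uniqueDiff_unitInterval ht).eq_deriv _ (h L) h0)

theorem WeakDeriv.unique {f : ℝ → E} {f' f'' : E} {t : ℝ} (ht : t ∈ Set.Icc (0 : ℝ) 1)
    (h : WeakDeriv 𝕜 f f' t) (h' : WeakDeriv 𝕜 f f'' t) : f' = f'' := by
  by_contra hx
  have hx : f' - f'' ∉ (⊥ : Submodule 𝕜 E) := by rwa [Submodule.mem_bot, sub_eq_zero]
  obtain ⟨L, hL, -⟩ := Submodule.exists_le_ker_of_notMem hx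
  refine hL ?_
  rw [map_sub, (uniqueDiff_unitInterval ht).eq_deriv _ (h L) (h' L), sub_self]

/-- A functional vanishing on `Q` has derivative zero along the path and is therefore constantly
zero on it; separating `f t` from `Q` would contradict this. -/
theorem mem_of_weakDeriv {f f' : ℝ → E} (Q : Submodule 𝕜 E) (h0 : f 0 ∈ Q)
    (hf : ∀ t ∈ Set.Icc (0 : ℝ) 1, WeakDeriv 𝕜 f (f' t) t)
    (hf' : ∀ t ∈ Set.Icc (0 : ℝ) 1, f' t ∈ Q) {t : ℝ} (ht : t ∈ Set.Icc (0 : ℝ) 1) : f t ∈ Q := by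
  by_contra hx
  obtain ⟨L, hL, hQ⟩ := Submodule.exists_le_ker_of_notMem hx
  have hd : ∀ s ∈ Set.Icc (0 : ℝ) 1, HasDerivWithinAt (fun s => L (f s)) 0 (Set.Icc 0 1) s := by
    intro s hs
    have h1 : L (f' s) = 0 := hQ (hf' s hs)
    have := hf s hs L
    rwa [h1] at this
  have := constant_of_derivWithin_zero (fun s hs => (hd s hs).differentiableWithinAt)
    (fun s hs => (hd s (Set.Ico_subset_Icc_self hs)).derivWithin
      (uniqueDiff_unitInterval (Set.Ico_subset_Icc_self hs))) t ht
  exact hL (this.trans (hQ h0))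

theorem SmoothPath.weakDeriv {f : ℝ → E} {n : ℕ} {c : Fin n → ℝ → 𝕜} {x : Fin n → E}
    (hc : ∀ k, ContDiffOn ℝ ∞ (c k) (Set.Icc 0 1))
    (hx : ∀ t ∈ Set.Icc (0 : ℝ) 1, f t = ∑ k, c k t • x k) {t : ℝ} (ht : t ∈ Set.Icc (0 : ℝ) 1) :
    WeakDeriv 𝕜 f (∑ k, derivWithin (c k) (Set.Icc 0 1) t • x k) t := by
  intro L
  have h1 : ∀ s ∈ Set.Icc (0 : ℝ) 1, L (f s) = ∑ k, c k s * L (x k) := fun s hs => by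
    simp [hx s hs]
  have h2 : HasDerivWithinAt (fun s => ∑ k, c k s * L (x k))
      (∑ k, derivWithin (c k) (Set.Icc 0 1) t * L (x k)) (Set.Icc 0 1) t :=
    HasDerivWithinAt.fun_sum fun k _ =>
      (((hc k).differentiableOn (by simp) t ht).hasDerivWithinAt).mul_const _
  simp only [map_sum, map_smul, smul_eq_mul]
  exact h2.congr_of_mem h1 ht

theorem exists_antideriv {c : ℝ → 𝕜} (hc : ContDiffOn ℝ ∞ c (Set.Icc 0 1)) :
    ∃ C : ℝ → 𝕜, ContDiffOn ℝ ∞ C (Set.Icc 0 1) ∧ C 0 = 0 ∧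
      ∀ t ∈ Set.Icc (0 : ℝ) 1, HasDerivWithinAt C (c t) (Set.Icc 0 1) t := by
  -- Extending `c` by its end values makes it continuous on `ℝ`, so the two-sided fundamental
  -- theorem of calculus applies at the endpoints too.
  let c' : ℝ → 𝕜 := Set.IccExtend (zero_le_one (α := ℝ)) ((Set.Icc 0 1).domRestrict c)
  have hc' : Continuous c' := (hc.continuousOn.domRestrict).Icc_extend'
  have hcc : ∀ t ∈ Set.Icc (0 : ℝ) 1, c' t = c t := fun t ht => Set.IccExtend_of_mem _ _ ht
  have hd : ∀ t ∈ Set.Icc (0 : ℝ) 1,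
      HasDerivWithinAt (fun t => ∫ s in (0 : ℝ)..t, c' s) (c t) (Set.Icc 0 1) t := fun t ht => by
    rw [← hcc t ht]
    exact (intervalIntegral.integral_hasDerivAt_right (hc'.intervalIntegrable _ _)
      (hc'.stronglyMeasurableAtFilter _ _) hc'.continuousAt).hasDerivWithinAt
  refine ⟨fun t => ∫ s in (0 : ℝ)..t, c' s, ?_, by simp, hd⟩
  rw [contDiffOn_infty_iff_derivWithin (uniqueDiffOn_Icc zero_lt_one)]
  exact ⟨fun t ht => (hd t ht).differentiableWithinAt,
    hc.congr fun t ht => (hd t ht).derivWithin (uniqueDiff_unitInterval ht)⟩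

end Paths

/-! ### Calculus of paths of formal functions -/

section FunctionPaths

variable {𝕜 : Type*} [RCLike 𝕜] {ι : Type*} {d : ι → ℤ}

/-- A path of formal functions, smooth in each weight, of weight bounded below. -/
structure SmoothFun (G : ℝ → FormalFun 𝕜 d) : Prop where
  smooth : ∀ w, SmoothPath (𝕜 := 𝕜) fun t => comp (G t) w
  bounded : ∃ N, ∀ t ∈ Set.Icc (0 : ℝ) 1, WeightGE (G t) N

theorem smoothFun_const (F : FormalFun 𝕜 d) : SmoothFun fun _ => F :=
  ⟨fun _ => smoothPath_const _, (exists_weightGE F).imp fun _ h _ _ => h⟩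

theorem SmoothFun.add {F G : ℝ → FormalFun 𝕜 d} (hF : SmoothFun F) (hG : SmoothFun G) :
    SmoothFun fun t => F t + G t := by
  obtain ⟨M, hM⟩ := hF.bounded
  obtain ⟨N, hN⟩ := hG.bounded
  exact ⟨fun w => (hF.smooth w).add (hG.smooth w), min M N, fun t ht =>
    ((hM t ht).mono (min_le_left _ _)).add ((hN t ht).mono (min_le_right _ _))⟩

theorem hasPathDeriv_const (F : FormalFun 𝕜 d) (t : ℝ) : HasPathDeriv (fun _ => F) 0 t := by
  intro w L
  rw [comp_zero, map_zero]
  exact hasDerivWithinAt_const _ _ _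

theorem HasPathDeriv.add {F G : ℝ → FormalFun 𝕜 d} {F' G' : FormalFun 𝕜 d} {t : ℝ}
    (hF : HasPathDeriv F F' t) (hG : HasPathDeriv G G' t) :
    HasPathDeriv (fun s => F s + G s) (F' + G') t := by
  intro w L
  simp only [comp_add, map_add]
  exact (hF w L).fun_add (hG w L)

theorem HasPathDeriv.sub {F G : ℝ → FormalFun 𝕜 d} {F' G' : FormalFun 𝕜 d} {t : ℝ}
    (hF : HasPathDeriv F F' t) (hG : HasPathDeriv G G' t) :
    HasPathDeriv (fun s => F s - G s) (F' - G') t := by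
  intro w L
  simp only [comp_sub, map_sub]
  exact (hF w L).fun_sub (hG w L)

theorem HasPathDeriv.smul {F : ℝ → FormalFun 𝕜 d} {F' : FormalFun 𝕜 d} {t : ℝ}
    (hF : HasPathDeriv F F' t) (r : 𝕜) : HasPathDeriv (fun s => r • F s) (r • F') t := by
  intro w L
  simp only [comp_smul, map_smul, smul_eq_mul]
  exact (hF w L).const_mul r

theorem HasPathDeriv.unique {F : ℝ → FormalFun 𝕜 d} {F' F'' : FormalFun 𝕜 d} {t : ℝ}
    (ht : t ∈ Set.Icc (0 : ℝ) 1) (h : HasPathDeriv F F' t) (h' : HasPathDeriv F F'' t) :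
    F' = F'' := by
  ext w
  exact WeakDeriv.unique ht (h w) (h' w)

theorem HasPathDeriv.congr {F G : ℝ → FormalFun 𝕜 d} {F' : FormalFun 𝕜 d} {t : ℝ}
    (ht : t ∈ Set.Icc (0 : ℝ) 1) (h : HasPathDeriv F F' t)
    (hFG : ∀ s ∈ Set.Icc (0 : ℝ) 1, G s = F s) : HasPathDeriv G F' t :=
  fun w L => (h w L).congr_of_mem (fun s hs => by rw [hFG s hs]) ht

theorem HasPathDeriv.weightGE {F : ℝ → FormalFun 𝕜 d} {F' : FormalFun 𝕜 d} {t : ℝ} {N : ℤ}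
    (ht : t ∈ Set.Icc (0 : ℝ) 1) (h : HasPathDeriv F F' t)
    (hF : ∀ s ∈ Set.Icc (0 : ℝ) 1, WeightGE (F s) N) : WeightGE F' N := by
  intro w hw
  rw [← Submodule.mem_bot 𝕜]
  exact WeakDeriv.mem ht (h w) ⊥ fun s hs => (Submodule.mem_bot 𝕜).2 (hF s hs w hw)

theorem SmoothFun.exists_deriv {F : ℝ → FormalFun 𝕜 d} (hF : SmoothFun F) {t : ℝ}
    (ht : t ∈ Set.Icc (0 : ℝ) 1) : ∃ F', HasPathDeriv F F' t := by
  obtain ⟨N, hN⟩ := hF.bounded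
  have h : ∀ w, ∃ y, WeakDeriv 𝕜 (fun s => comp (F s) w) y t := fun w => by
    obtain ⟨n, c, x, hc, hx⟩ := hF.smooth w
    exact ⟨_, SmoothPath.weakDeriv hc hx ht⟩
  choose y hy using h
  refine ⟨ofComp y ⟨N, fun w hw => ?_⟩ fun w => ?_, hy⟩
  · rw [← Submodule.mem_bot 𝕜]
    exact WeakDeriv.mem ht (hy w) ⊥ fun s hs => (Submodule.mem_bot 𝕜).2 (hN s hs w hw)
  · exact WeakDeriv.mem ht (hy w) _ fun s _ => comp_mem _ _

/-- The values of a family of operators on a smooth path form a smooth path. -/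
theorem SmoothFun.apply {M : ℝ → FormalFun 𝕜 d → FormalFun 𝕜 d} {k : ℤ}
    (hM : ∀ t ∈ Set.Icc (0 : ℝ) 1, IsFiltered k (M t))
    (hs : ∀ F, SmoothFun fun t => M t F) {G : ℝ → FormalFun 𝕜 d} (hG : SmoothFun G) :
    SmoothFun fun t => M t (G t) := by
  obtain ⟨N, hN⟩ := hG.bounded
  refine ⟨fun w => ?_, N + k, fun t ht => (hM t ht).weight _ _ (hN t ht)⟩
  choose n c x hc hx using hG.smooth
  replace hx : ∀ w, ∀ t ∈ Set.Icc (0 : ℝ) 1, comp (G t) w = ∑ k, c w k t • x w k := hx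
  have h : SmoothPath (𝕜 := 𝕜) fun t => ∑ v ∈ Finset.Ico N (w - k + 1),
      ∑ j, c v j t • comp (M t (inj 𝕜 d v (x v j))) w :=
    SmoothPath.sum _ fun v _ => SmoothPath.sum _ fun j _ => ((hs _).smooth w).smul (hc v j)
  refine h.congr fun t ht => ?_
  rw [(hM t ht).comp_eq_sum (hN t ht)]
  refine Finset.sum_congr rfl fun v _ => ?_
  rw [hx v t ht, map_sum, (hM t ht).map_sum, comp_sum]
  exact Finset.sum_congr rfl fun j _ => by rw [map_smul, (hM t ht).map_smul, comp_smul]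

/-- The product rule for a family of operators and a smooth path. -/
theorem HasPathDeriv.apply {M : ℝ → FormalFun 𝕜 d → FormalFun 𝕜 d}
    {M' : FormalFun 𝕜 d → FormalFun 𝕜 d} {k l : ℤ} {t : ℝ} (ht : t ∈ Set.Icc (0 : ℝ) 1)
    (hM : ∀ s ∈ Set.Icc (0 : ℝ) 1, IsFiltered k (M s)) (hM' : IsFiltered l M')
    (hd : ∀ F, HasPathDeriv (fun s => M s F) (M' F) t) {G : ℝ → FormalFun 𝕜 d}
    {G' : FormalFun 𝕜 d} (hG : SmoothFun G) (hG' : HasPathDeriv G G' t) :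
    HasPathDeriv (fun s => M s (G s)) (M' (G t) + M t G') t := by
  intro w L
  obtain ⟨N, hN⟩ := hG.bounded
  choose n c x hc hx using hG.smooth
  replace hx : ∀ w, ∀ t ∈ Set.Icc (0 : ℝ) 1, comp (G t) w = ∑ k, c w k t • x w k := hx
  -- A common shift for `M` and `M'` makes all three expansions below run over the same finite range
  -- of weights, so that they can be compared term by term.
  replace hM := fun s hs => (hM s hs).mono (min_le_left k l)
  replace hM' := hM'.mono (min_le_right k l)
  set k' := min k l
  have e1 : ∀ s ∈ Set.Icc (0 : ℝ) 1, L (comp (M s (G s)) w) =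
      ∑ v ∈ Finset.Ico N (w - k' + 1), ∑ j, c v j s * L (comp (M s (inj 𝕜 d v (x v j))) w) := by
    intro s hs
    rw [(hM s hs).comp_eq_sum (hN s hs), map_sum]
    refine Finset.sum_congr rfl fun v _ => ?_
    rw [hx v s hs, map_sum, (hM s hs).map_sum, comp_sum, map_sum]
    exact Finset.sum_congr rfl fun j _ => by
      rw [map_smul, (hM s hs).map_smul, comp_smul, map_smul, smul_eq_mul]
  have e2 : L (comp (M' (G t)) w) =
      ∑ v ∈ Finset.Ico N (w - k' + 1), ∑ j, c v j t * L (comp (M' (inj 𝕜 d v (x v j))) w) := by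
    rw [hM'.comp_eq_sum (hN t ht), map_sum]
    refine Finset.sum_congr rfl fun v _ => ?_
    rw [hx v t ht, map_sum, hM'.map_sum, comp_sum, map_sum]
    exact Finset.sum_congr rfl fun j _ => by
      rw [map_smul, hM'.map_smul, comp_smul, map_smul, smul_eq_mul]
  have e3 : L (comp (M t G') w) = ∑ v ∈ Finset.Ico N (w - k' + 1), ∑ j,
      derivWithin (c v j) (Set.Icc 0 1) t * L (comp (M t (inj 𝕜 d v (x v j))) w) := by
    rw [(hM t ht).comp_eq_sum (hG'.weightGE ht hN), map_sum]
    refine Finset.sum_congr rfl fun v _ => ?_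
    rw [WeakDeriv.unique ht (hG' v) (SmoothPath.weakDeriv (hc v) (hx v) ht), map_sum,
      (hM t ht).map_sum, comp_sum, map_sum]
    exact Finset.sum_congr rfl fun j _ => by
      rw [map_smul, (hM t ht).map_smul, comp_smul, map_smul, smul_eq_mul]
  rw [comp_add, map_add, e2, e3, add_comm, ← Finset.sum_add_distrib]
  refine HasDerivWithinAt.congr_of_mem (HasDerivWithinAt.fun_sum fun v _ => ?_) e1 ht
  rw [← Finset.sum_add_distrib]
  refine HasDerivWithinAt.fun_sum fun j _ => ?_
  exact (((hc v j).differentiableOn (by simp) t ht).hasDerivWithinAt).fun_mul (hd _ w L)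

theorem HasPathDeriv.map {M : FormalFun 𝕜 d → FormalFun 𝕜 d} {k : ℤ} {t : ℝ}
    (ht : t ∈ Set.Icc (0 : ℝ) 1) (hM : IsFiltered k M) {G : ℝ → FormalFun 𝕜 d}
    {G' : FormalFun 𝕜 d} (hG : SmoothFun G) (hG' : HasPathDeriv G G' t) :
    HasPathDeriv (fun s => M (G s)) (M G') t := by
  have := HasPathDeriv.apply ht (fun _ _ => hM) (IsFiltered.zero 0)
    (fun F => hasPathDeriv_const (M F) t) hG hG'
  rwa [zero_add] at this

theorem SmoothFun.map {M : FormalFun 𝕜 d → FormalFun 𝕜 d} {k : ℤ} (hM : IsFiltered k M)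
    {G : ℝ → FormalFun 𝕜 d} (hG : SmoothFun G) : SmoothFun fun s => M (G s) :=
  SmoothFun.apply (fun _ _ => hM) (fun _ => smoothFun_const _) hG

theorem SmoothFun.mul {F G : ℝ → FormalFun 𝕜 d} (hF : SmoothFun F) (hG : SmoothFun G) :
    SmoothFun fun s => F s * G s := by
  obtain ⟨N, hN⟩ := hF.bounded
  exact SmoothFun.apply (fun t ht => IsFiltered.mul_left (hN t ht))
    (fun H => (exists_filtered_mul_right H).elim fun _ h => hF.map h) hG

theorem SmoothFun.bracketOf (Ω : ι → ι → 𝕜) {F G : ℝ → FormalFun 𝕜 d} (hF : SmoothFun F)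
    (hG : SmoothFun G) : SmoothFun fun s => bracketOf Ω (F s) (G s) := by
  obtain ⟨N, hN⟩ := hF.bounded
  exact SmoothFun.apply (fun t ht => bracketOf_filtered_right Ω (hN t ht))
    (fun H => (exists_filtered_bracket_left Ω H).elim fun _ h => hF.map h) hG

theorem HasPathDeriv.mul {F G : ℝ → FormalFun 𝕜 d} {F' G' : FormalFun 𝕜 d} {t : ℝ}
    (ht : t ∈ Set.Icc (0 : ℝ) 1) (hF : SmoothFun F) (hG : SmoothFun G)
    (hF' : HasPathDeriv F F' t) (hG' : HasPathDeriv G G' t) :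
    HasPathDeriv (fun s => F s * G s) (F' * G t + F t * G') t := by
  obtain ⟨N, hN⟩ := hF.bounded
  obtain ⟨k, hk⟩ := exists_filtered_mul_left F'
  exact HasPathDeriv.apply ht (fun s hs => IsFiltered.mul_left (hN s hs)) hk
    (fun H => (exists_filtered_mul_right H).elim fun _ h => hF'.map ht h hF) hG hG'

theorem HasPathDeriv.bracketOf (Ω : ι → ι → 𝕜) {F G : ℝ → FormalFun 𝕜 d} {F' G' : FormalFun 𝕜 d}
    {t : ℝ} (ht : t ∈ Set.Icc (0 : ℝ) 1) (hF : SmoothFun F) (hG : SmoothFun G)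
    (hF' : HasPathDeriv F F' t) (hG' : HasPathDeriv G G' t) :
    HasPathDeriv (fun s => bracketOf Ω (F s) (G s))
      (BV.bracketOf Ω F' (G t) + BV.bracketOf Ω (F t) G') t := by
  obtain ⟨N, hN⟩ := hF.bounded
  obtain ⟨k, hk⟩ := exists_filtered_bracket_right Ω F'
  exact HasPathDeriv.apply ht (fun s hs => bracketOf_filtered_right Ω (hN s hs)) hk
    (fun H => (exists_filtered_bracket_left Ω H).elim fun _ h => hF'.map ht h hF) hG hG'

theorem SmoothFun.exists_antideriv {G : ℝ → FormalFun 𝕜 d} (hG : SmoothFun G) :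
    ∃ H : ℝ → FormalFun 𝕜 d, SmoothFun H ∧ H 0 = 0 ∧
      ∀ t ∈ Set.Icc (0 : ℝ) 1, HasPathDeriv H (G t) t := by
  obtain ⟨N, hN⟩ := hG.bounded
  choose n c x hc hx using hG.smooth
  replace hx : ∀ w, ∀ t ∈ Set.Icc (0 : ℝ) 1, comp (G t) w = ∑ k, c w k t • x w k := hx
  choose C hC hC0 hCd using fun w j => BV.exists_antideriv (hc w j)
  -- The vectors `x w j` need not have weight `w` individually, only their combination on `[0, 1]`
  -- does; hence the projection. The cut-off below `N` keeps the weight bounded below for every real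
  -- `t`.
  let h : ℝ → ℤ → GradedSym 𝕜 d := fun t w =>
    if w < N then 0 else ∑ j, C w j t • proj 𝕜 d w (x w j)
  have hh : ∀ t w, h t w ∈ weightPart 𝕜 d w := fun t w => by
    simp only [h]
    split_ifs
    · exact zero_mem _
    · exact Submodule.sum_mem _ fun j _ => Submodule.smul_mem _ _ (proj_mem _ _)
  have hb : ∀ t, ∀ w < N, h t w = 0 := fun t w hw => if_pos hw
  refine ⟨fun t => ofComp (h t) ⟨N, hb t⟩ (hh t), ⟨fun w => ?_, N, fun t _ => hb t⟩, ?_,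
    fun t ht w L => ?_⟩
  · simp only [comp_ofComp, h]
    split_ifs
    · exact smoothPath_const _
    · exact SmoothPath.sum _ fun j _ => (smoothPath_const _).smul (hC w j)
  · ext w
    simp [h, hC0]
  · simp only [comp_ofComp, h]
    by_cases hw : w < N
    · simp only [if_pos hw, hN t ht w hw, map_zero]
      exact hasDerivWithinAt_const _ _ _
    · simp only [if_neg hw]
      have : comp (G t) w = ∑ j, c w j t • proj 𝕜 d w (x w j) := by
        rw [← proj_eq (comp_mem (G t) w), hx w t ht, map_sum]
        simp only [map_smul]
      rw [this]
      simp only [map_sum, map_smul, smul_eq_mul]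
      exact HasDerivWithinAt.fun_sum fun j _ => (hCd w j t ht).mul_const _

/-- If the derivatives of `D_t(x)` are controlled by the values `D_t(y)` for `y` of higher level,
then a linear condition on the components of `D_t(x)` propagates from `t = 0` to `[0, 1]`. -/
theorem mem_of_hasPathDeriv {α : Type*} {level : ℤ → α → Prop} {D : ℝ → α → FormalFun 𝕜 d}
    (Q : ℤ → Submodule 𝕜 (GradedSym 𝕜 d)) (c : ℤ)
    (hD : ∀ m x, level m x → ∀ t ∈ Set.Icc (0 : ℝ) 1, WeightGE (D t x) (m + c))
    (h0 : ∀ m x, level m x → ∀ w, comp (D 0 x) w ∈ Q w)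
    (hder : ∀ m x, level m x → ∀ t ∈ Set.Icc (0 : ℝ) 1, ∃ D', HasPathDeriv (fun s => D s x) D' t ∧
      ∀ w, (∀ y, level (m + 1) y → comp (D t y) w ∈ Q w) → comp D' w ∈ Q w)
    {m : ℤ} {x : α} (hx : level m x) {t : ℝ} (ht : t ∈ Set.Icc (0 : ℝ) 1) (w : ℤ) :
    comp (D t x) w ∈ Q w := by
  -- The induction descends through the levels. If `w < m + c`, the component vanishes for reasons
  -- of weight; each step down integrates a derivative controlled by the next higher level.
  have key : ∀ n : ℕ, ∀ m x, level m x → w < m + c + n → ∀ t ∈ Set.Icc (0 : ℝ) 1,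
      comp (D t x) w ∈ Q w := by
    intro n
    induction n with
    | zero =>
      intro m x hx hw t ht
      rw [hD m x hx t ht w (by simpa using hw)]
      exact zero_mem _
    | succ n ih =>
      intro m x hx hw t ht
      choose! D' hD' hQ using hder m x hx
      exact mem_of_weakDeriv (f' := fun s => comp (D' s) w) (Q w) (h0 m x hx w)
        (fun s hs => hD' s hs w)
        (fun s hs => hQ s hs w fun y hy => ih (m + 1) y hy (by push_cast at hw; omega) s hs) ht
  exact key (w - m - c + 1).toNat m x hx (by omega) t ht

end FunctionPaths

/-! ### Existence, uniqueness and invariants of flows -/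

section Flows

variable {𝕜 : Type*} [RCLike 𝕜] {ι : Type*} {d : ι → ℤ}

/-- A time-dependent vector field `{-B(t), -}` which raises the weight. -/
structure IsFlowGenerator (B : ℝ → FormalFun 𝕜 d) : Prop where
  smooth : SmoothFun B
  weight : ∀ t ∈ Set.Icc (0 : ℝ) 1, WeightGE (B t) 3
  degree : ∀ t ∈ Set.Icc (0 : ℝ) 1, HasDegree (B t) (-1)

/-- A solution of `(d/dt) Φ_t = Φ_t ∘ {-B(t), -}` with `Φ_0 = id`. -/
structure IsFlowFamily (Ω : ι → ι → 𝕜) (B : ℝ → FormalFun 𝕜 d)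
    (Φ : ℝ → FormalFun 𝕜 d → FormalFun 𝕜 d) : Prop where
  filtered : ∀ t ∈ Set.Icc (0 : ℝ) 1, IsFiltered 0 (Φ t)
  zero : ∀ F, Φ 0 F = F
  deriv : ∀ F, ∀ t ∈ Set.Icc (0 : ℝ) 1,
    HasPathDeriv (fun s => Φ s F) (Φ t (bracketOf Ω (-B t) F)) t

variable {Ω : ι → ι → 𝕜} {B : ℝ → FormalFun 𝕜 d}

theorem zero_mem_unitInterval : (0 : ℝ) ∈ Set.Icc (0 : ℝ) 1 := ⟨le_rfl, zero_le_one⟩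

theorem IsFlowGenerator.filtered (hB : IsFlowGenerator B) (Ω : ι → ι → 𝕜) {t : ℝ}
    (ht : t ∈ Set.Icc (0 : ℝ) 1) : IsFiltered 1 (bracketOf Ω (-B t)) :=
  (bracketOf_filtered_right Ω (hB.weight t ht).neg).mono (by norm_num)

theorem IsFlowGenerator.smooth_bracket (hB : IsFlowGenerator B) (Ω : ι → ι → 𝕜)
    (F : FormalFun 𝕜 d) : SmoothFun fun t => bracketOf Ω (-B t) F :=
  SmoothFun.bracketOf Ω (hB.smooth.map IsFiltered.id.neg) (smoothFun_const F)

theorem IsFlowGenerator.odd (hB : IsFlowGenerator B) {t : ℝ} (ht : t ∈ Set.Icc (0 : ℝ) 1) :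
    parityFun (-B t) = - -B t := (hB.degree t ht).neg.odd

theorem weightGE_of_hasPathDeriv {F F' : ℝ → FormalFun 𝕜 d} {m : ℤ}
    (hF : ∀ t ∈ Set.Icc (0 : ℝ) 1, HasPathDeriv F (F' t) t) (h0 : WeightGE (F 0) m)
    (hF' : ∀ t ∈ Set.Icc (0 : ℝ) 1, WeightGE (F' t) m) {t : ℝ} (ht : t ∈ Set.Icc (0 : ℝ) 1) :
    WeightGE (F t) m := by
  intro w hw
  rw [← Submodule.mem_bot 𝕜]
  exact mem_of_weakDeriv (f' := fun t => comp (F' t) w) ⊥ ((Submodule.mem_bot 𝕜).2 (h0 w hw))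
    (fun s hs => hF s hs w) (fun s hs => (Submodule.mem_bot 𝕜).2 (hF' s hs w hw)) ht

theorem eq_zero_of_hasPathDeriv {F : ℝ → FormalFun 𝕜 d}
    (hF : ∀ t ∈ Set.Icc (0 : ℝ) 1, HasPathDeriv F 0 t) (h0 : F 0 = 0) {t : ℝ}
    (ht : t ∈ Set.Icc (0 : ℝ) 1) : F t = 0 := by
  ext w
  refine weightGE_of_hasPathDeriv (m := w + 1) hF ?_ (fun _ _ => weightGE_zero _) ht w (by omega)
  rw [h0]
  exact weightGE_zero _

/-- The new family is `F ↦ F + ∫₀ᵗ M_s (X_s F) ds`. The antiderivative is chosen separately for each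
`F`, so linearity is recovered from the fact that a path with zero derivative and zero initial value
vanishes. -/
theorem exists_picard_step (hB : IsFlowGenerator B) (Ω : ι → ι → 𝕜)
    {M : ℝ → FormalFun 𝕜 d → FormalFun 𝕜 d} (hM : ∀ t ∈ Set.Icc (0 : ℝ) 1, IsFiltered 0 (M t))
    (hs : ∀ F, SmoothFun fun t => M t F) :
    ∃ M' : ℝ → FormalFun 𝕜 d → FormalFun 𝕜 d, (∀ t ∈ Set.Icc (0 : ℝ) 1, IsFiltered 0 (M' t)) ∧
      (∀ F, SmoothFun fun t => M' t F) ∧ (∀ F, M' 0 F = F) ∧ ∀ F, ∀ t ∈ Set.Icc (0 : ℝ) 1,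
        HasPathDeriv (fun s => M' s F) (M t (bracketOf Ω (-B t) F)) t := by
  have hX : ∀ F, SmoothFun fun t => M t (bracketOf Ω (-B t) F) := fun F =>
    SmoothFun.apply hM hs (hB.smooth_bracket Ω F)
  choose H hHs hH0 hHd using fun F => (hX F).exists_antideriv
  have hMX : ∀ t ∈ Set.Icc (0 : ℝ) 1, IsFiltered (0 + 1) fun F => M t (bracketOf Ω (-B t) F) :=
    fun t ht => (hM t ht).comp (hB.filtered Ω ht)
  have hd : ∀ F, ∀ t ∈ Set.Icc (0 : ℝ) 1,
      HasPathDeriv (fun s => F + H F s) (M t (bracketOf Ω (-B t) F)) t := fun F t ht => by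
    have := (hasPathDeriv_const F t).add (hHd F t ht)
    rwa [zero_add] at this
  refine ⟨fun t F => F + H F t, fun t ht => ⟨fun F G => ?_, fun r F => ?_, fun m F hF => ?_⟩,
    fun F => (smoothFun_const F).add (hHs F), fun F => by simp [hH0], hd⟩
  · rw [← sub_eq_zero]
    refine eq_zero_of_hasPathDeriv (F := fun t => F + G + H (F + G) t - (F + H F t + (G + H G t)))
      (fun s hs => ?_) (by simp [hH0]) ht
    have := (hd (F + G) s hs).sub ((hd F s hs).add (hd G s hs))
    rwa [(hMX s hs).map_add, sub_self] at this
  · rw [← sub_eq_zero]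
    refine eq_zero_of_hasPathDeriv (F := fun t => r • F + H (r • F) t - r • (F + H F t))
      (fun s hs => ?_) (by simp [hH0]) ht
    have := (hd (r • F) s hs).sub ((hd F s hs).smul r)
    rwa [(hMX s hs).map_smul, sub_self] at this
  · rw [add_zero]
    refine weightGE_of_hasPathDeriv (hd F) (by rwa [hH0, add_zero]) (fun s hs => ?_) ht
    exact ((hMX s hs).weight m F hF).mono (by omega)

theorem exists_picard_sequence (hB : IsFlowGenerator B) (Ω : ι → ι → 𝕜) :
    ∃ M : ℕ → ℝ → FormalFun 𝕜 d → FormalFun 𝕜 d,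
      (∀ n, ∀ t ∈ Set.Icc (0 : ℝ) 1, IsFiltered 0 (M n t)) ∧
      (∀ n F, SmoothFun fun t => M n t F) ∧ (∀ n F, M n 0 F = F) ∧ (∀ t F, M 0 t F = F) ∧
      ∀ n F, ∀ t ∈ Set.Icc (0 : ℝ) 1,
        HasPathDeriv (fun s => M (n + 1) s F) (M n t (bracketOf Ω (-B t) F)) t := by
  -- Bundling the hypotheses of the Picard step with the family turns the step into a self-map of a
  -- subtype, which can be iterated.
  let P : (ℝ → FormalFun 𝕜 d → FormalFun 𝕜 d) → Prop := fun M =>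
    (∀ t ∈ Set.Icc (0 : ℝ) 1, IsFiltered 0 (M t)) ∧ (∀ F, SmoothFun fun t => M t F) ∧
      ∀ F, M 0 F = F
  have hstep : ∀ M : {M // P M}, ∃ M' : {M // P M}, ∀ F, ∀ t ∈ Set.Icc (0 : ℝ) 1,
      HasPathDeriv (fun s => M'.1 s F) (M.1 t (bracketOf Ω (-B t) F)) t := fun M => by
    obtain ⟨M', h1, h2, h3, h4⟩ := exists_picard_step hB Ω M.2.1 M.2.2.1
    exact ⟨⟨M', h1, h2, h3⟩, h4⟩
  choose step hstep using hstep
  let M0 : {M // P M} := ⟨fun _ F => F, fun _ _ => IsFiltered.id, smoothFun_const, fun _ => rfl⟩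
  refine ⟨fun n => (step^[n] M0).1, fun n => (step^[n] M0).2.1, fun n => (step^[n] M0).2.2.1,
    fun n => (step^[n] M0).2.2.2, fun _ _ => rfl, fun n => ?_⟩
  simp only [Function.iterate_succ_apply']
  exact hstep _

/-- The vector field raises the weight by at least `1`, so the difference of the Picard iterates `n
+ 1` and `n` raises it by at least `n + 1`. Each component is eventually constant in `n`, and the
limit is taken weight by weight. -/
theorem exists_isFlowFamily (hB : IsFlowGenerator B) (Ω : ι → ι → 𝕜) :
    ∃ Φ : ℝ → FormalFun 𝕜 d → FormalFun 𝕜 d,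
      IsFlowFamily Ω B Φ ∧ ∀ F, SmoothFun fun t => Φ t F := by
  obtain ⟨M, hMf, hMs, hM0, hM00, hMd⟩ := exists_picard_sequence hB Ω
  have hdiff : ∀ n : ℕ, ∀ m F, WeightGE F m → ∀ t ∈ Set.Icc (0 : ℝ) 1,
      WeightGE (M (n + 1) t F - M n t F) (m + n + 1) := by
    intro n
    induction n with
    | zero =>
      intro m F hF t ht
      refine weightGE_of_hasPathDeriv (F := fun t => M 1 t F - M 0 t F)
        (fun s hs => (hMd 0 F s hs).sub ?_) ?_ (fun s hs => ?_) ht (F' := fun s =>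
          M 0 s (bracketOf Ω (-B s) F) - 0)
      · simp only [hM00]
        exact hasPathDeriv_const F s
      · simp only [hM0, sub_self]
        exact weightGE_zero _
      · rw [sub_zero, hM00]
        exact ((hB.filtered Ω hs).weight m F hF).mono (by simp)
    | succ n ih =>
      intro m F hF t ht
      refine weightGE_of_hasPathDeriv (F := fun t => M (n + 1 + 1) t F - M (n + 1) t F)
        (fun s hs => (hMd (n + 1) F s hs).sub (hMd n F s hs)) ?_ (fun s hs => ?_) ht
      · simp only [hM0, sub_self]
        exact weightGE_zero _
      · exact (ih (m + 1) _ ((hB.filtered Ω hs).weight m F hF) s hs).mono (by push_cast; omega)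
  have hstab : ∀ m F, WeightGE F m → ∀ t ∈ Set.Icc (0 : ℝ) 1, ∀ w, ∀ n : ℕ, w < m + n + 1 →
      ∀ n', n ≤ n' → comp (M n' t F) w = comp (M n t F) w := by
    intro m F hF t ht w n hn n' hnn'
    induction n', hnn' using Nat.le_induction with
    | base => rfl
    | succ k hk ih =>
      rw [← ih, ← sub_eq_zero, ← comp_sub]
      exact hdiff k m F hF t ht w (by omega)
  have hlim : ∀ t ∈ Set.Icc (0 : ℝ) 1, ∀ F, ∃ y : FormalFun 𝕜 d, ∀ m, WeightGE F m → ∀ w,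
      ∀ n : ℕ, w < m + n + 1 → comp y w = comp (M n t F) w := by
    intro t ht F
    obtain ⟨m, hm⟩ := exists_weightGE F
    -- For `F` of weight at least `m`, the component of weight `w` no longer changes from the
    -- iterate `(w - m).toNat` on.
    refine ⟨ofComp (fun w => comp (M (w - m).toNat t F) w) ⟨m, fun w hw =>
      (hMf _ t ht).weight m F hm w (by omega)⟩ fun w => comp_mem _ w, fun m' hm' w n hn => ?_⟩
    rw [comp_ofComp, ← hstab m F hm t ht w (w - m).toNat (by omega) _ (le_max_left _ n),
      ← hstab m' F hm' t ht w n hn _ (le_max_right (w - m).toNat n)]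
  choose! Φ hΦ using hlim
  have hex : ∀ (m w : ℤ), ∃ n : ℕ, w < m + n + 1 := fun m w => ⟨(w - m).toNat, by omega⟩
  have hΦ0 : ∀ F, Φ 0 F = F := fun F => by
    obtain ⟨m, hm⟩ := exists_weightGE F
    ext w
    obtain ⟨n, hn⟩ := hex m w
    rw [hΦ 0 zero_mem_unitInterval F m hm w n hn, hM0]
  refine ⟨Φ, ⟨fun t ht => ⟨fun F G => ?_, fun r F => ?_, fun m F hF w hw => ?_⟩, hΦ0,
    fun F t ht w L => ?_⟩, fun F => ?_⟩
  · obtain ⟨m, hm⟩ := exists_weightGE F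
    obtain ⟨m', hm'⟩ := exists_weightGE G
    replace hm := hm.mono (min_le_left m m')
    replace hm' := hm'.mono (min_le_right m m')
    ext w
    obtain ⟨n, hn⟩ := hex (min m m') w
    rw [comp_add, hΦ t ht _ _ (hm.add hm') w n hn, hΦ t ht _ _ hm w n hn, hΦ t ht _ _ hm' w n hn,
      (hMf n t ht).map_add, comp_add]
  · obtain ⟨m, hm⟩ := exists_weightGE F
    ext w
    obtain ⟨n, hn⟩ := hex m w
    rw [comp_smul, hΦ t ht _ _ (hm.smul r) w n hn, hΦ t ht _ _ hm w n hn, (hMf n t ht).map_smul,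
      comp_smul]
  · obtain ⟨n, hn⟩ := hex m w
    rw [hΦ t ht _ _ hF w n hn]
    exact (hMf n t ht).weight m F hF w hw
  -- In weight `w` the limit coincides with iterate `n + 1` on `F` and with iterate `n` on `X_t F`,
  -- so the Picard relation becomes the flow equation.
  · obtain ⟨m, hm⟩ := exists_weightGE F
    obtain ⟨n, hn⟩ := hex m w
    rw [hΦ t ht _ m (((hB.filtered Ω ht).weight m F hm).mono (by omega)) w n hn]
    exact (hMd n F t ht w L).congr_of_mem
      (fun s hs => by rw [hΦ s hs F m hm w (n + 1) (by push_cast; omega)]) ht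
  · obtain ⟨m, hm⟩ := exists_weightGE F
    refine ⟨fun w => ?_, m, fun t ht w hw => ?_⟩
    · obtain ⟨n, hn⟩ := hex m w
      exact ((hMs n F).smooth w).congr fun t ht => hΦ t ht F m hm w n hn
    · obtain ⟨n, hn⟩ := hex m w
      rw [hΦ t ht F m hm w n hn]
      exact (hMf n t ht).weight m F hm w (by omega)

namespace IsFlowFamily

variable {Φ Φ' : ℝ → FormalFun 𝕜 d → FormalFun 𝕜 d}

theorem unique (hB : IsFlowGenerator B) (hΦ : IsFlowFamily Ω B Φ) (hΦ' : IsFlowFamily Ω B Φ')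
    {t : ℝ} (ht : t ∈ Set.Icc (0 : ℝ) 1) (F : FormalFun 𝕜 d) : Φ t F = Φ' t F := by
  obtain ⟨m, hm⟩ := exists_weightGE F
  rw [← sub_eq_zero]
  ext w
  rw [comp_zero, ← Submodule.mem_bot 𝕜]
  refine mem_of_hasPathDeriv (α := FormalFun 𝕜 d) (level := fun m F => WeightGE F m)
    (D := fun t F => Φ t F - Φ' t F) (fun _ => ⊥) 0 (fun m F hF t ht => ?_) (fun m F hF w => ?_)
    (fun m F hF t ht => ?_) hm ht w
  · exact ((hΦ.filtered t ht).weight m F hF).sub ((hΦ'.filtered t ht).weight m F hF)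
  · simp [hΦ.zero, hΦ'.zero]
  · exact ⟨_, (hΦ.deriv F t ht).sub (hΦ'.deriv F t ht), fun w hw =>
      hw _ ((hB.filtered Ω ht).weight m F hF)⟩

/-- The flow equation alone only provides derivatives at each time, whereas the product rules
require smooth paths. Uniqueness transfers smoothness from the Picard flow to an arbitrary one. -/
theorem smooth (hB : IsFlowGenerator B) (hΦ : IsFlowFamily Ω B Φ) (F : FormalFun 𝕜 d) :
    SmoothFun fun t => Φ t F := by
  obtain ⟨Φ', hΦ', hs⟩ := exists_isFlowFamily hB Ω
  refine ⟨fun w => ((hs F).smooth w).congr fun t ht => ?_, ?_⟩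
  · rw [hΦ.unique hB hΦ' ht]
  · obtain ⟨N, hN⟩ := (hs F).bounded
    exact ⟨N, fun t ht => by rw [hΦ.unique hB hΦ' ht]; exact hN t ht⟩

theorem fixed (hΦ : IsFlowFamily Ω B Φ) {F : FormalFun 𝕜 d}
    (hF : ∀ t ∈ Set.Icc (0 : ℝ) 1, bracketOf Ω (-B t) F = 0) {t : ℝ}
    (ht : t ∈ Set.Icc (0 : ℝ) 1) : Φ t F = F := by
  rw [← sub_eq_zero]
  refine eq_zero_of_hasPathDeriv (F := fun t => Φ t F - F) (fun s hs => ?_) (by simp [hΦ.zero]) ht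
  have := (hΦ.deriv F s hs).sub (hasPathDeriv_const F s)
  rwa [hF s hs, (hΦ.filtered s hs).map_zero, sub_zero] at this

/-- A flow preserves the bilinear operations for which the vector field is a derivation. -/
theorem map_bilinear (hB : IsFlowGenerator B) (hΦ : IsFlowFamily Ω B Φ)
    {β : FormalFun 𝕜 d → FormalFun 𝕜 d → FormalFun 𝕜 d} (c : ℤ)
    (hβ : ∀ F G m n, WeightGE F m → WeightGE G n → WeightGE (β F G) (m + n + c))
    (hβd : ∀ {F G : ℝ → FormalFun 𝕜 d} {F' G' : FormalFun 𝕜 d} {t : ℝ}, t ∈ Set.Icc (0 : ℝ) 1 →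
      SmoothFun F → SmoothFun G → HasPathDeriv F F' t → HasPathDeriv G G' t →
      HasPathDeriv (fun s => β (F s) (G s)) (β F' (G t) + β (F t) G') t)
    (hX : ∀ t ∈ Set.Icc (0 : ℝ) 1, ∀ F G, bracketOf Ω (-B t) (β F G) =
      β (bracketOf Ω (-B t) F) G + β F (bracketOf Ω (-B t) G))
    {t : ℝ} (ht : t ∈ Set.Icc (0 : ℝ) 1) (F G : FormalFun 𝕜 d) :
    Φ t (β F G) = β (Φ t F) (Φ t G) := by
  obtain ⟨m, hm⟩ := exists_weightGE F
  obtain ⟨n, hn⟩ := exists_weightGE G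
  rw [← sub_eq_zero]
  ext w
  rw [comp_zero, ← Submodule.mem_bot 𝕜]
  refine mem_of_hasPathDeriv (α := FormalFun 𝕜 d × FormalFun 𝕜 d)
    (level := fun k x => ∃ m n, m + n = k ∧ WeightGE x.1 m ∧ WeightGE x.2 n)
    (D := fun t x => Φ t (β x.1 x.2) - β (Φ t x.1) (Φ t x.2)) (fun _ => ⊥) c ?_ ?_ ?_
    (x := (F, G)) ⟨m, n, rfl, hm, hn⟩ ht w
  · rintro _ ⟨F, G⟩ ⟨m, n, rfl, hm, hn⟩ t ht
    have h1 := (hΦ.filtered t ht).weight _ _ (hβ F G m n hm hn)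
    have h2 := hβ _ _ _ _ ((hΦ.filtered t ht).weight _ _ hm) ((hΦ.filtered t ht).weight _ _ hn)
    exact (h1.mono (by omega)).sub (h2.mono (by omega))
  · rintro _ ⟨F, G⟩ - w
    simp [hΦ.zero]
  · rintro _ ⟨F, G⟩ ⟨m, n, rfl, hm, hn⟩ t ht
    refine ⟨_, (hΦ.deriv _ t ht).sub (hβd ht (hΦ.smooth hB F) (hΦ.smooth hB G) (hΦ.deriv F t ht)
      (hΦ.deriv G t ht)), fun w hw => ?_⟩
    have h1 := hw (bracketOf Ω (-B t) F, G) ⟨m + 1, n, by ring,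
      (hB.filtered Ω ht).weight m F hm, hn⟩
    have h2 := hw (F, bracketOf Ω (-B t) G) ⟨m, n + 1, by ring, hm,
      (hB.filtered Ω ht).weight n G hn⟩
    have h3 := add_mem h1 h2
    rw [← comp_add] at h3
    rw [hX t ht, (hΦ.filtered t ht).map_add]
    convert h3 using 2
    abel

theorem map_mul (hΩ : IsOddForm d Ω) (hB : IsFlowGenerator B) (hΦ : IsFlowFamily Ω B Φ) {t : ℝ}
    (ht : t ∈ Set.Icc (0 : ℝ) 1) (F G : FormalFun 𝕜 d) : Φ t (F * G) = Φ t F * Φ t G :=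
  hΦ.map_bilinear hB (β := fun F G => F * G) 0
    (fun _ _ _ _ hF hG => (hF.mul hG).mono (by omega)) HasPathDeriv.mul
    (fun _ ht F G => bracketOf_mul_of_odd hΩ (hB.odd ht) F G) ht F G

theorem map_bracketOf (hΩ : IsOddForm d Ω) (hB : IsFlowGenerator B) (hΦ : IsFlowFamily Ω B Φ)
    {t : ℝ} (ht : t ∈ Set.Icc (0 : ℝ) 1) (F G : FormalFun 𝕜 d) :
    Φ t (bracketOf Ω F G) = bracketOf Ω (Φ t F) (Φ t G) :=
  hΦ.map_bilinear hB (β := bracketOf Ω) (-2)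
    (fun _ _ _ _ hF hG => (weightGE_bracketOf Ω hF hG).mono (by omega))
    (HasPathDeriv.bracketOf Ω)
    (fun _ ht F G => bracketOf_jacobi hΩ (hB.odd ht) F G) ht F G

/-- Any condition cut out by one subspace in each weight and stable under the vector field is stable
under its flow; used for the degree and for the absence of negative powers of `ħ`. -/
theorem preserves (hB : IsFlowGenerator B) (hΦ : IsFlowFamily Ω B Φ)
    (Q : ℤ → Submodule 𝕜 (GradedSym 𝕜 d))
    (hX : ∀ t ∈ Set.Icc (0 : ℝ) 1, ∀ F, (∀ w, comp F w ∈ Q w) →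
      ∀ w, comp (bracketOf Ω (-B t) F) w ∈ Q w)
    {F : FormalFun 𝕜 d} (hF : ∀ w, comp F w ∈ Q w) {t : ℝ} (ht : t ∈ Set.Icc (0 : ℝ) 1) (w : ℤ) :
    comp (Φ t F) w ∈ Q w := by
  obtain ⟨m, hm⟩ := exists_weightGE F
  refine mem_of_hasPathDeriv (α := FormalFun 𝕜 d)
    (level := fun m F => WeightGE F m ∧ ∀ w, comp F w ∈ Q w) (D := Φ) Q 0 ?_ ?_ ?_ ⟨hm, hF⟩ ht w
  · exact fun m F hF t ht => (hΦ.filtered t ht).weight m F hF.1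
  · intro m F hF w
    rw [hΦ.zero]
    exact hF.2 w
  · exact fun m F hF t ht => ⟨_, hΦ.deriv F t ht, fun w hw =>
      hw _ ⟨(hB.filtered Ω ht).weight m F hF.1, hX t ht F hF.2⟩⟩

theorem hasDegree (hΩ : IsOddForm d Ω) (hB : IsFlowGenerator B) (hΦ : IsFlowFamily Ω B Φ)
    {F : FormalFun 𝕜 d} {n : ℤ} (hF : HasDegree F n) {t : ℝ} (ht : t ∈ Set.Icc (0 : ℝ) 1) :
    HasDegree (Φ t F) n := by
  refine hΦ.preserves hB (fun _ => monoSpan 𝕜 d fun _ l => (l.map d).sum = n)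
    (fun t ht F hF w => ?_) hF ht
  have := ((hB.degree t ht).neg.bracketOf hΩ (G := F) (n := n) hF) w
  rwa [show -1 + n + 1 = n by ring] at this

theorem isRegular (hΩ : IsOddForm d Ω) (hB : IsFlowGenerator B) (hΦ : IsFlowFamily Ω B Φ)
    (hreg : ∀ t ∈ Set.Icc (0 : ℝ) 1, IsRegular (B t)) {F : FormalFun 𝕜 d} (hF : IsRegular F)
    {t : ℝ} (ht : t ∈ Set.Icc (0 : ℝ) 1) : IsRegular (Φ t F) :=
  hΦ.preserves hB (fun w => monoSpan 𝕜 d fun g l => 0 ≤ g ∧ 2 * g + l.length = w)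
    (fun t ht F hF => (hreg t ht).neg.bracketOf hΩ (G := F) hF) hF ht

end IsFlowFamily

end Flows

/-! ### Flows as families of formal maps -/

section FormalMapFlows

variable {𝕜 V ι : Type*} [RCLike 𝕜] [AddCommGroup V] [Module 𝕜 V] {X : OddSymplecticSpace 𝕜 V}
  {b : HomogeneousBasis X ι}

theorem FormalMap.filtered (Φ : FormalMap b b) : IsFiltered 0 Φ.pullback :=
  ⟨map_add _, map_smul _, fun m F hF => by rw [add_zero]; exact Φ.map_weight F m hF⟩

theorem IsFlow.isFlowFamily {B : ℝ → Functions b} {Φ : ℝ → FormalMap b b} (hΦ : IsFlow B Φ) :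
    IsFlowFamily (X.invForm b) B fun t => (Φ t).pullback :=
  ⟨fun t _ => (Φ t).filtered, hΦ.zero, hΦ.deriv⟩

/-- The vector field is an odd function's bracket, hence a derivation killing `1` and `ħ`; so its
flow consists of unital, `ħ`-linear algebra homomorphisms. -/
theorem exists_isFlow {B : ℝ → Functions b} (hB : IsFlowGenerator B) :
    ∃ Φ : ℝ → FormalMap b b, IsFlow B Φ := by
  obtain ⟨Φ, hΦ, -⟩ := exists_isFlowFamily hB (X.invForm b)
  have hΩ := isOddForm_invForm X b
  have hmap : ∀ t ∈ Set.Icc (0 : ℝ) 1, ∃ φ : FormalMap b b, ∀ F, φ.pullback F = Φ t F := by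
    intro t ht
    refine ⟨⟨AlgHom.ofLinearMap (hΦ.filtered t ht).toLinearMap
      (hΦ.fixed (fun s _ => bracketOf_one _ _) ht) (hΦ.map_mul hΩ hB ht),
      hΦ.fixed (fun s _ => bracketOf_hbar _ _ _) ht, fun F n hF => hΦ.hasDegree hΩ hB hF ht,
      fun F k hF => ?_⟩, fun F => rfl⟩
    have := (hΦ.filtered t ht).weight k F hF
    rwa [add_zero] at this
  obtain ⟨φ0, -⟩ := hmap 0 zero_mem_unitInterval
  -- Outside `[0, 1]` the family is arbitrary, and some default formal map is needed there.
  have : Nonempty (FormalMap b b) := ⟨φ0⟩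
  choose! φ hφ using hmap
  refine ⟨φ, fun F => ?_, fun F t ht => ?_⟩
  · rw [hφ 0 zero_mem_unitInterval, hΦ.zero]
  · rw [hφ t ht]
    exact (hΦ.deriv F t ht).congr ht fun s hs => hφ s hs F

end FormalMapFlows

/-! ### Exponentials of functions of positive weight -/

section Exponentials

variable {𝕜 : Type*} [RCLike 𝕜] {ι : Type*} {d : ι → ℤ} {Ω : ι → ι → 𝕜}

/-- The exponential series, for `a` of weight at least `1`. -/
def expFun (a : FormalFun 𝕜 d) : FormalFun 𝕜 d := weightSum fun k => ((k.factorial : 𝕜)⁻¹) • a ^ k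

/-- The term `a^k / k!` of the exponential series. -/
def expTerm (a : FormalFun 𝕜 d) (k : ℕ) : FormalFun 𝕜 d := ((k.factorial : 𝕜)⁻¹) • a ^ k

theorem weightGE_weightSum_sub {y : ℕ → FormalFun 𝕜 d} (hy : ∀ k, WeightGE (y k) k) (N : ℕ) :
    WeightGE (weightSum y - ∑ k ∈ Finset.range N, y k) N := by
  intro w hw
  rw [comp_sub, comp_sum, sub_eq_zero]
  change (if 0 ≤ w then _ else _) = _
  split_ifs with h
  · refine Finset.sum_subset (fun k hk => ?_) fun k _ hk => ?_
    · rw [Finset.mem_range] at hk ⊢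
      omega
    · rw [Finset.mem_range] at hk
      exact hy k w (by omega)
  · exact (Finset.sum_eq_zero fun k _ => hy k w (by omega)).symm

theorem weightGE_one : WeightGE (1 : FormalFun 𝕜 d) 0 := by
  rw [← hbar_zero]; exact (weightGE_hbar 0).mono (by simp)

theorem WeightGE.pow {a : FormalFun 𝕜 d} (ha : WeightGE a 1) (k : ℕ) : WeightGE (a ^ k) k := by
  induction k with
  | zero => simpa using weightGE_one
  | succ k ih => rw [pow_succ]; exact (ih.mul ha).mono (by push_cast; omega)

theorem weightGE_expTerm {a : FormalFun 𝕜 d} (ha : WeightGE a 1) (k : ℕ) :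
    WeightGE (expTerm a k) k := (ha.pow k).smul _

theorem weightGE_expFun_sub {a : FormalFun 𝕜 d} (ha : WeightGE a 1) (N : ℕ) :
    WeightGE (expFun a - ∑ k ∈ Finset.range N, expTerm a k) N :=
  weightGE_weightSum_sub (weightGE_expTerm ha) N

theorem eq_of_weightGE_add {F G : FormalFun 𝕜 d} (c : ℤ) (h : ∀ N : ℕ, WeightGE (F - G) (N + c)) :
    F = G :=
  eq_of_forall_weightGE fun N => (h (N - c).toNat).mono (by omega)

/-- Two operators which agree on the partial sums of the exponential series, up to terms of large
weight, agree on the exponential. -/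
theorem eq_on_expFun {a : FormalFun 𝕜 d} (ha : WeightGE a 1) {f g : FormalFun 𝕜 d → FormalFun 𝕜 d}
    {k l : ℤ} (hf : IsFiltered k f) (hg : IsFiltered l g) (c : ℤ)
    (h : ∀ N : ℕ, WeightGE (f (∑ k ∈ Finset.range (N + 2), expTerm a k) -
      g (∑ k ∈ Finset.range (N + 2), expTerm a k)) (N + c)) : f (expFun a) = g (expFun a) := by
  -- The tail of the series after `N + 2` terms is moved by at most `k` or `l`, while `c` measures
  -- the mismatch on the partial sum. Taking `N + 2` terms leaves room for the two index shifts
  -- caused by a second-order operator.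
  refine eq_of_weightGE_add (min c (min k l)) fun N => ?_
  have h0 := weightGE_expFun_sub ha (N + 2)
  have h1 := hf.weight _ _ h0
  have h2 := hg.weight _ _ h0
  rw [hf.map_sub] at h1
  rw [hg.map_sub] at h2
  push_cast at h1 h2
  have := ((h1.mono (m := N + min c (min k l)) (by omega)).sub
    (h2.mono (m := N + min c (min k l)) (by omega))).add
    ((h N).mono (m := N + min c (min k l)) (by omega))
  convert this using 1
  abel

theorem expTerm_zero (a : FormalFun 𝕜 d) : expTerm a 0 = 1 := by simp [expTerm]

theorem expTerm_succ (a : FormalFun 𝕜 d) (k : ℕ) :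
    ((k + 1 : ℕ) : 𝕜) • expTerm a (k + 1) = a * expTerm a k := by
  rw [expTerm, expTerm, smul_smul, mul_smul_comm, pow_succ', Nat.factorial_succ]
  congr 1
  have : ((k + 1 : ℕ) : 𝕜) ≠ 0 := Nat.cast_ne_zero.2 (Nat.succ_ne_zero k)
  push_cast at this ⊢
  field_simp

theorem eq_of_natCast_smul {k : ℕ} {F G : FormalFun 𝕜 d}
    (h : ((k + 1 : ℕ) : 𝕜) • F = ((k + 1 : ℕ) : 𝕜) • G) : F = G :=
  smul_right_injective _ (Nat.cast_ne_zero.2 (Nat.succ_ne_zero k)) h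

theorem expTerm_one (a : FormalFun 𝕜 d) : expTerm a 1 = a := by
  have := expTerm_succ a 0
  rw [expTerm_zero, mul_one] at this
  simpa using this

theorem expTerm_mul_comm {a : FormalFun 𝕜 d} (ha : parityFun a = a) (k : ℕ) (F : FormalFun 𝕜 d) :
    expTerm a k * F = F * expTerm a k := by
  have h : Commute (a ^ k) F := Commute.pow_left (mul_comm_of_even ha F) k
  rw [expTerm, smul_mul_assoc, mul_smul_comm, h.eq]

/-- As `a` is even it commutes with `D a`, so the usual power rule holds. The Leibniz rule is only
required for a first factor `a`, which covers odd derivations as well. -/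
theorem derivation_expTerm {a : FormalFun 𝕜 d} (ha : parityFun a = a)
    {D : FormalFun 𝕜 d → FormalFun 𝕜 d} {k : ℤ} (hD : IsFiltered k D)
    (hmul : ∀ F, D (a * F) = D a * F + a * D F) (n : ℕ) :
    D (expTerm a (n + 1)) = expTerm a n * D a := by
  induction n with
  | zero => rw [zero_add, expTerm_zero, expTerm_one, one_mul]
  | succ n ih =>
    apply eq_of_natCast_smul (k := n + 1)
    rw [← hD.map_smul, expTerm_succ, hmul, ih, ← mul_assoc, ← expTerm_succ,
      ← expTerm_mul_comm ha, smul_mul_assoc]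
    push_cast
    module

theorem derivation_expFun {a : FormalFun 𝕜 d} (ha : parityFun a = a) (hw : WeightGE a 1)
    {D : FormalFun 𝕜 d → FormalFun 𝕜 d} {k : ℤ} (hD : IsFiltered k D) (h1 : D 1 = 0)
    (hmul : ∀ F, D (a * F) = D a * F + a * D F) : D (expFun a) = expFun a * D a := by
  obtain ⟨m, hm⟩ := exists_weightGE (D a)
  refine eq_on_expFun hw hD (IsFiltered.mul_right hm) m fun N => ?_
  have h2 : D (∑ k ∈ Finset.range (N + 2), expTerm a k) =
      (∑ k ∈ Finset.range (N + 1), expTerm a k) * D a := by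
    rw [hD.map_sum, Finset.sum_range_succ', expTerm_zero, h1, add_zero, Finset.sum_mul]
    exact Finset.sum_congr rfl fun k _ => derivation_expTerm ha hD hmul k
  rw [h2, Finset.sum_range_succ _ (N + 1), add_mul, sub_add_cancel_left]
  exact (((weightGE_expTerm hw (N + 1)).mul hm).mono (by push_cast; omega)).neg

/-- A second-order operator acts on a divided power by hitting either one factor or a pair of
factors; the `½` accounts for unordered pairs. -/
theorem laplacianOf_expTerm (hΩ : IsOddForm d Ω) {a : FormalFun 𝕜 d} (ha : parityFun a = a)
    (n : ℕ) : laplacianOf Ω (expTerm a (n + 2)) = expTerm a (n + 1) * laplacianOf Ω a +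
      (2⁻¹ : 𝕜) • (expTerm a n * bracketOf Ω a a) := by
  have hmul : ∀ F, laplacianOf Ω (a * F) =
      laplacianOf Ω a * F + a * laplacianOf Ω F + bracketOf Ω a F := fun F => by
    rw [laplacianOf_mul hΩ, ha]
  obtain ⟨l, hl⟩ := exists_filtered_bracket_right Ω a
  have hbr : ∀ n, bracketOf Ω a (expTerm a (n + 1)) = expTerm a n * bracketOf Ω a a :=
    derivation_expTerm ha hl fun F => by
      rw [bracketOf_mul_of_even hΩ ha, ha]
  induction n with
  | zero =>
    apply eq_of_natCast_smul (k := 1)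
    rw [← laplacianOf_smul, expTerm_succ, hmul, expTerm_one, expTerm_zero, one_mul,
      ← mul_comm_of_even ha]
    push_cast
    module
  | succ n ih =>
    apply eq_of_natCast_smul (k := n + 2)
    rw [← laplacianOf_smul, expTerm_succ, hmul, ih, hbr, mul_add, ← mul_assoc, ← expTerm_succ,
      mul_smul_comm, ← mul_assoc, ← expTerm_succ, ← expTerm_mul_comm ha, smul_mul_assoc,
      smul_mul_assoc]
    push_cast
    module

theorem laplacianOf_one (Ω : ι → ι → 𝕜) : laplacianOf Ω (1 : FormalFun 𝕜 d) = 0 := by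
  have h1 : (1 : FormalFun 𝕜 d) = inj 𝕜 d 0 1 := by
    rw [← hbar_zero, hbar_eq_inj]
    simp [mono]
  have h2 : (1 : GradedSym 𝕜 d) ∈ weightPart 𝕜 d 0 := by
    simpa using prod_mem (𝕜 := 𝕜) (d := d) []
  rw [h1, laplacianOf_inj Ω (u := -2) (by ring) h2]
  simp [polyLaplacian]

theorem laplacianOf_expFun (hΩ : IsOddForm d Ω) {a : FormalFun 𝕜 d} (ha : parityFun a = a)
    (hw : WeightGE a 1) : laplacianOf Ω (expFun a) =
      expFun a * (laplacianOf Ω a + (2⁻¹ : 𝕜) • bracketOf Ω a a) := by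
  obtain ⟨m, hm⟩ := exists_weightGE (laplacianOf Ω a)
  obtain ⟨n, hn⟩ := exists_weightGE ((2⁻¹ : 𝕜) • bracketOf Ω a a)
  obtain ⟨l, hl⟩ := exists_filtered_mul_right (laplacianOf Ω a + (2⁻¹ : 𝕜) • bracketOf Ω a a)
  refine eq_on_expFun hw (laplacianOf_filtered Ω) hl (min m n) fun N => ?_
  have h2 : laplacianOf Ω (∑ k ∈ Finset.range (N + 2), expTerm a k) =
      (∑ k ∈ Finset.range (N + 1), expTerm a k) * laplacianOf Ω a +
        (∑ k ∈ Finset.range N, expTerm a k) * ((2⁻¹ : 𝕜) • bracketOf Ω a a) := by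
    rw [(laplacianOf_filtered Ω).map_sum, Finset.sum_range_succ', Finset.sum_range_succ',
      Finset.sum_range_succ' (fun k => expTerm a k), expTerm_zero, laplacianOf_one, zero_add,
      expTerm_one, add_zero, Finset.sum_congr rfl fun k _ => laplacianOf_expTerm hΩ ha k,
      Finset.sum_add_distrib, add_mul, one_mul, Finset.sum_mul, Finset.sum_mul]
    simp only [mul_smul_comm]
    abel
  rw [h2]
  -- The partial sums differ only in their last one or two terms, whose weights grow with `N`.
  have h3 : (∑ k ∈ Finset.range (N + 1), expTerm a k) * laplacianOf Ω a +
        (∑ k ∈ Finset.range N, expTerm a k) * ((2⁻¹ : 𝕜) • bracketOf Ω a a) -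
      (∑ k ∈ Finset.range (N + 2), expTerm a k) *
        (laplacianOf Ω a + (2⁻¹ : 𝕜) • bracketOf Ω a a) =
      -(expTerm a (N + 1) * laplacianOf Ω a) + -((expTerm a N + expTerm a (N + 1)) *
        ((2⁻¹ : 𝕜) • bracketOf Ω a a)) := by
    generalize (2⁻¹ : 𝕜) • bracketOf Ω a a = K
    simp only [Finset.sum_range_succ]
    noncomm_ring
  rw [h3]
  refine WeightGE.add (((weightGE_expTerm hw (N + 1)).mul hm).mono (by push_cast; omega)).neg
    (WeightGE.mono ((WeightGE.add (weightGE_expTerm hw N)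
      ((weightGE_expTerm hw (N + 1)).mono (by push_cast; omega))).mul hn) (by omega)).neg

theorem parityFun_expFun {a : FormalFun 𝕜 d} (ha : parityFun a = a) (hw : WeightGE a 1) :
    parityFun (expFun a) = expFun a := by
  refine eq_on_expFun hw parityFun_filtered IsFiltered.id 0 fun N => ?_
  have h : ∀ k, parityFun (expTerm a k) = expTerm a k := fun k => by
    rw [expTerm, parityFun_filtered.map_smul]
    congr 1
    induction k with
    | zero => simp [← hbar_zero, parityFun_hbar]
    | succ k ih => rw [pow_succ, parityFun_mul, ih, ha]
  rw [parityFun_filtered.map_sum, Finset.sum_congr rfl fun k _ => h k, sub_self]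
  exact weightGE_zero _

/-- Here `F = -(e^a - 1) F`, and `e^a - 1` has positive weight, so the lower bound on the weight of
`F` can be raised indefinitely. -/
theorem eq_zero_of_expFun_mul {a F : FormalFun 𝕜 d} (ha : WeightGE a 1) (h : expFun a * F = 0) :
    F = 0 := by
  have h1 := weightGE_expFun_sub ha 1
  rw [Finset.sum_range_one, expTerm_zero] at h1
  have h2 : F = -((expFun a - 1) * F) := by rw [sub_mul, h, one_mul]; abel
  obtain ⟨m, hm⟩ := exists_weightGE F
  refine eq_of_weightGE_add m fun N => ?_
  rw [sub_zero]
  induction N with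
  | zero => exact hm.mono (by simp)
  | succ N ih =>
    rw [h2]
    exact ((h1.mul ih).mono (by push_cast; omega)).neg

theorem SmoothFun.expTerm {a : ℝ → FormalFun 𝕜 d} (hs : SmoothFun a) (n : ℕ) :
    SmoothFun fun t => expTerm (a t) n := by
  have h : SmoothFun fun t => a t ^ n := by
    induction n with
    | zero => simpa using smoothFun_const (1 : FormalFun 𝕜 d)
    | succ n ih => simp only [pow_succ]; exact ih.mul hs
  obtain ⟨N, hN⟩ := h.bounded
  exact ⟨fun w => (h.smooth w).smul contDiffOn_const, N, fun t ht => (hN t ht).smul _⟩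

theorem hasPathDeriv_expTerm {a : ℝ → FormalFun 𝕜 d} {a' : FormalFun 𝕜 d} {t : ℝ}
    (ht : t ∈ Set.Icc (0 : ℝ) 1) (hs : SmoothFun a) (ha : parityFun (a t) = a t)
    (ha' : HasPathDeriv a a' t) (n : ℕ) :
    HasPathDeriv (fun s => expTerm (a s) (n + 1)) (expTerm (a t) n * a') t := by
  have hsc : ∀ (n : ℕ) (c : FormalFun 𝕜 d), c = ((n + 1 : ℕ) : 𝕜)⁻¹ • ((n + 1 : ℕ) : 𝕜) • c :=
    fun n c => by rw [smul_smul, inv_mul_cancel₀ (Nat.cast_ne_zero.2 (Nat.succ_ne_zero n)), one_smul]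
  have hstep : ∀ (n : ℕ) (G' : FormalFun 𝕜 d), HasPathDeriv (fun s => expTerm (a s) n) G' t →
      a' * expTerm (a t) n + a t * G' = ((n + 1 : ℕ) : 𝕜) • (expTerm (a t) n * a') →
      HasPathDeriv (fun s => expTerm (a s) (n + 1)) (expTerm (a t) n * a') t := by
    intro n G' hG hE
    have h := (HasPathDeriv.mul ht hs (hs.expTerm n) ha' hG).smul (((n + 1 : ℕ) : 𝕜)⁻¹)
    rw [hE, ← hsc] at h
    refine h.congr ht fun s _ => ?_
    rw [← expTerm_succ, ← hsc]
  induction n with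
  | zero =>
    refine hstep 0 0 ?_ ?_
    · simp only [expTerm_zero]
      exact hasPathDeriv_const 1 t
    · simp [expTerm_zero]
  | succ n ih =>
    refine hstep (n + 1) _ ih ?_
    rw [← mul_assoc, ← expTerm_succ, ← expTerm_mul_comm ha, smul_mul_assoc]
    push_cast
    module

/-- In a fixed weight the exponential is a finite partial sum, so there is no interchange of limits.
Evenness is needed to move `a'` past the powers of `a`. -/
theorem hasPathDeriv_expFun {a : ℝ → FormalFun 𝕜 d} {a' : FormalFun 𝕜 d} {t : ℝ}
    (ht : t ∈ Set.Icc (0 : ℝ) 1) (hs : SmoothFun a) (ha : parityFun (a t) = a t)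
    (hw : ∀ s ∈ Set.Icc (0 : ℝ) 1, WeightGE (a s) 1) (ha' : HasPathDeriv a a' t) :
    HasPathDeriv (fun s => expFun (a s)) (expFun (a t) * a') t := by
  intro w L
  set N : ℕ := (w + 1).toNat
  have hN : w < (N : ℤ) := by omega
  have h1 : ∀ n : ℕ, HasPathDeriv (fun s => ∑ k ∈ Finset.range (n + 1), expTerm (a s) k)
      ((∑ k ∈ Finset.range n, expTerm (a t) k) * a') t := by
    intro n
    induction n with
    | zero => simpa [expTerm_zero] using hasPathDeriv_const (1 : FormalFun 𝕜 d) t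
    | succ n ih =>
      simp only [Finset.sum_range_succ _ (n + 1)]
      rw [Finset.sum_range_succ, add_mul]
      exact ih.add (hasPathDeriv_expTerm ht hs ha ha' n)
  have h2 : comp (expFun (a t) * a') w = comp ((∑ k ∈ Finset.range N, expTerm (a t) k) * a') w := by
    rw [← sub_eq_zero, ← comp_sub, ← sub_mul]
    exact ((weightGE_expFun_sub (hw t ht) N).mul (ha'.weightGE ht hw)) w (by omega)
  rw [h2]
  refine (h1 N w L).congr_of_mem (fun s hs => ?_) ht
  congr 1
  rw [← sub_eq_zero, ← comp_sub]
  exact weightGE_expFun_sub (hw s hs) (N + 1) w (by push_cast; omega)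

theorem formPow_fst (x : FormalFun 𝕜 d × FormalFun 𝕜 d) (k : ℕ) : (formPow x k).1 = x.1 ^ k := by
  induction k with
  | zero => simp [formPow]
  | succ k ih => rw [formPow, formMul, ih, pow_succ]

/-- Exactly one factor of the power contributes `b dt`. With `a` even, the `k + 1` positions give
the same term, and the factor `k + 1` cancels against the factorial. -/
theorem formPow_snd {a : FormalFun 𝕜 d} (ha : parityFun a = a) (b : FormalFun 𝕜 d) (k : ℕ) :
    (((k + 1).factorial : 𝕜)⁻¹) • (formPow (a, b) (k + 1)).2 = expTerm a k * b := by
  have h : ∀ k : ℕ, (formPow (a, b) (k + 1)).2 = ((k + 1 : ℕ) : 𝕜) • (a ^ k * b) := by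
    intro k
    induction k with
    | zero => simp [formPow, formMul]
    | succ k ih =>
      rw [formPow, formMul, ih, formPow_fst]
      simp only [ha]
      rw [smul_mul_assoc, mul_assoc, ← mul_comm_of_even ha b, ← mul_assoc, ← pow_succ]
      push_cast
      module
  rw [h, smul_smul, expTerm, smul_mul_assoc, Nat.factorial_succ]
  congr 1
  have : ((k + 1 : ℕ) : 𝕜) ≠ 0 := Nat.cast_ne_zero.2 (Nat.succ_ne_zero k)
  push_cast at this ⊢
  field_simp

theorem formExp_fst (a b : FormalFun 𝕜 d) : (formExp (a, b)).1 = expFun a := by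
  simp only [formExp, formPow_fst, expFun]

/-- The zeroth power has no `dt` part, so `N + 1` terms of the form series match `N` terms of the
exponential times `b`. -/
theorem formExp_snd {a b : FormalFun 𝕜 d} (ha : parityFun a = a) (hw : WeightGE a 1)
    (hb : WeightGE b 1) : (formExp (a, b)).2 = expFun a * b := by
  have h0 : ((0 : ℕ).factorial : 𝕜)⁻¹ • (formPow (a, b) 0).2 = 0 := by simp [formPow]
  refine eq_of_weightGE_add 1 fun N => ?_
  have h1 := weightGE_weightSum_sub (y := fun k => ((k.factorial : 𝕜)⁻¹) • (formPow (a, b) k).2)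
    (fun k => by
      rcases k with _ | k
      · rw [h0]; exact weightGE_zero _
      · rw [formPow_snd ha]
        exact ((weightGE_expTerm hw k).mul hb).mono (by push_cast; omega)) (N + 1)
  rw [Finset.sum_range_succ', h0, add_zero, Finset.sum_congr rfl fun k _ => formPow_snd ha b k,
    ← Finset.sum_mul] at h1
  have h2 := (weightGE_expFun_sub hw N).mul hb
  rw [sub_mul] at h2
  have := h1.sub (h2.mono (by push_cast; omega))
  rw [sub_sub_sub_cancel_right] at this
  exact this.mono (by push_cast; omega)

end Exponentials

/-! ### From the homotopy equation to the intertwining relation -/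

section HomotopyEquations

variable {𝕜 V ι : Type*} [RCLike 𝕜] [AddCommGroup V] [Module 𝕜 V] {X : OddSymplecticSpace 𝕜 V}
  {b : HomogeneousBasis X ι}

theorem twisted_filtered {S : Functions b} (hS : WeightGE S 2) :
    IsFiltered 0 (twisted S) := by
  have h1 := (IsFiltered.mul_left (weightGE_hbar (𝕜 := 𝕜) (d := b.dualDeg) 1)).comp
    (laplacianOf_filtered (X.invForm b))
  exact (h1.add (bracketOf_filtered_right (X.invForm b) hS)).mono (by norm_num)

/-- Conjugating the second-order operator `T_S` by `e^a` adds the first-order term `ħ {a, -}`. With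
`a = A/ħ` this is the passage from `T_S` to `T_{S+A}`. -/
theorem twisted_expFun_mul {S a β : Functions b} (hS : parityFun S = S) (ha : parityFun a = a)
    (hw : WeightGE a 1) (hβ : parityFun β = -β) :
    twisted S (expFun a * β) = twisted S (expFun a) * β +
      expFun a * (twisted S β + hbar 𝕜 _ 1 * bracket a β) := by
  have hΩ := isOddForm_invForm X b
  have hE := parityFun_expFun ha hw
  obtain ⟨k, hk⟩ := exists_filtered_bracket_right (X.invForm b) β
  have h1 : bracketOf (X.invForm b) (expFun a) β = expFun a * bracketOf (X.invForm b) a β := by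
    have := bracketOf_comm_of_odd hΩ hβ hE
    rw [derivation_expFun ha hw hk (bracketOf_one _ _) (bracketOf_mul_of_odd hΩ hβ a),
      bracketOf_comm_of_odd hΩ hβ ha, mul_neg, neg_inj] at this
    exact this.symm
  simp only [twisted, laplacian, bracket]
  rw [laplacianOf_mul hΩ, hE, h1, bracketOf_mul_of_even hΩ hS, hE]
  have h2 : ∀ F : Functions b, hbar 𝕜 _ 1 * (expFun a * F) = expFun a * (hbar 𝕜 _ 1 * F) :=
    fun F => by rw [← mul_assoc, hbar_mul_comm, mul_assoc]
  simp only [mul_add, add_mul, h2, mul_assoc]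
  abel

theorem twisted_expFun {S a : Functions b} (hS : parityFun S = S) (ha : parityFun a = a)
    (hw : WeightGE a 1) : twisted S (expFun a) = expFun a *
      (twisted S a + (2⁻¹ : 𝕜) • (hbar 𝕜 _ 1 * bracket a a)) := by
  have hΩ := isOddForm_invForm X b
  obtain ⟨k, hk⟩ := exists_filtered_bracket_right (X.invForm b) S
  simp only [twisted, laplacian, bracket]
  rw [laplacianOf_expFun hΩ ha hw, derivation_expFun ha hw hk (bracketOf_one _ _) fun F => by
    rw [bracketOf_mul_of_even hΩ hS, ha]]
  rw [← mul_assoc, hbar_mul_comm, mul_assoc]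
  simp only [mul_add, mul_smul_comm]
  abel

theorem hbar_mul_twisted (S F : Functions b) :
    hbar 𝕜 _ 1 * twisted S F = twisted S (hbar 𝕜 _ 1 * F) := by
  simp only [twisted, laplacian, bracket]
  rw [laplacianOf_hbar_mul, bracketOf_hbar_mul_right, mul_add]

theorem hbar_mul_hbar_neg (F : Functions b) : hbar 𝕜 _ 1 * (hbar 𝕜 _ (-1) * F) = F := by
  rw [← mul_assoc, hbar_mul_hbar, add_neg_cancel, hbar_zero, one_mul]

theorem twisted_add (S S' F : Functions b) :
    twisted (S + S') F = twisted S F + bracket S' F := by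
  simp only [twisted, bracket]
  rw [bracketOf_add_left, add_assoc]

theorem IsFreeAction.weightGE {S : Functions b} (hS : IsFreeAction S) : WeightGE S 2 :=
  fun w hw => hS.comp_eq_zero w hw.ne

variable {Sfree : Functions b} {A B : ℝ → Functions b}

theorem IsHomotopy.isFlowGenerator (h : IsHomotopy Sfree A B) : IsFlowGenerator B :=
  ⟨⟨h.smooth_B, 3, h.weight_B⟩, h.weight_B, h.degree_B⟩

theorem IsHomotopy.smoothFun (h : IsHomotopy Sfree A B) : SmoothFun A :=
  ⟨h.smooth_A, 3, h.weight_A⟩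

theorem weightGE_hbar_neg_mul {F : Functions b} (hF : WeightGE F 3) :
    WeightGE (hbar 𝕜 _ (-1) * F) 1 := ((weightGE_hbar (-1)).mul hF).mono (by norm_num)

theorem parityFun_hbar_mul_even {F : Functions b} (hF : parityFun F = F) (g : ℤ) :
    parityFun (hbar 𝕜 _ g * F) = hbar 𝕜 _ g * F := by rw [parityFun_mul, hF, parityFun_hbar]

theorem parityFun_hbar_mul_odd {F : Functions b} (hF : parityFun F = -F) (g : ℤ) :
    parityFun (hbar 𝕜 _ g * F) = -(hbar 𝕜 _ g * F) := by
  rw [parityFun_mul, hF, parityFun_hbar, mul_neg]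

/-- Cancelling the exponential in the closedness equation and multiplying by `ħ` gives `T_{S_free} A
+ ½ {A, A} = 0`. This is the master equation for the sum, since `Δ S_free` and `{S_free, S_free}`
vanish and the bracket of even functions is symmetric. -/
theorem IsHomotopy.isQuantumLInfty (hS : IsFreeAction Sfree) (h : IsHomotopy Sfree A B) {t : ℝ}
    (ht : t ∈ Set.Icc (0 : ℝ) 1) : IsQuantumLInfty (Sfree + A t) := by
  have hΩ := isOddForm_invForm X b
  have hAe := (h.degree_A t ht).even
  have hSe := hS.degree.even
  refine ⟨hS.weightGE.add ((h.weight_A t ht).mono (by norm_num)), ?_,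
    hS.degree.add (h.degree_A t ht), ?_⟩
  · rw [comp_add, h.weight_A t ht 2 (by norm_num), add_zero]
    exact hS.quadratic
  have hw := weightGE_hbar_neg_mul (h.weight_A t ht)
  have hc := h.closed t ht
  rw [homotopyExp, formExp_fst, twisted_expFun hSe (parityFun_hbar_mul_even hAe _) hw] at hc
  have h1 := congrArg (hbar 𝕜 b.dualDeg 1 * ·) (eq_zero_of_expFun_mul hw hc)
  simp only [mul_add, mul_zero] at h1
  rw [hbar_mul_twisted, hbar_mul_hbar_neg, mul_smul_comm, bracket, ← bracketOf_hbar_mul_left,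
    ← bracketOf_hbar_mul_right, hbar_mul_hbar_neg] at h1
  have h0 : laplacianOf (X.invForm b) Sfree = 0 :=
    laplacianOf_quadratic hΩ hS.comp_eq_zero hS.quadratic hSe
  have hb : bracketOf (X.invForm b) Sfree Sfree = 0 := hS.bracket_self
  simp only [QuantumMasterEquation, twisted, laplacian, bracket] at h1 ⊢
  rw [laplacianOf_add, h0, zero_add, bracketOf_add_left, bracketOf_add_right, bracketOf_add_right,
    hb, zero_add, bracketOf_comm_of_even hΩ hAe hSe, ← h1]
  module

/-- The equation of motion `dA/dt = - T_{S_free + A(t)} B(t)` of a homotopy. -/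
theorem IsHomotopy.deriv_eq (hS : IsFreeAction Sfree) (h : IsHomotopy Sfree A B) {t : ℝ}
    (ht : t ∈ Set.Icc (0 : ℝ) 1) {A' : Functions b} (hA' : HasPathDeriv A A' t) :
    A' = -twisted (Sfree + A t) (B t) := by
  have hAe := fun s hs => parityFun_hbar_mul_even ((h.degree_A s hs).even) (-1)
  have hBo := parityFun_hbar_mul_odd (h.degree_B t ht).odd (-1)
  have hw := fun s hs => weightGE_hbar_neg_mul (h.weight_A s hs)
  have hc := h.closed t ht
  obtain ⟨E', hE', hcd⟩ := h.closed_dt t ht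
  have hm := IsFiltered.mul_left (weightGE_hbar (𝕜 := 𝕜) (d := b.dualDeg) (-1))
  -- Weak derivatives are unique, so the derivative supplied by the homotopy is the one given by the
  -- chain rule.
  have hE : E' = expFun (hbar 𝕜 _ (-1) * A t) * (hbar 𝕜 _ (-1) * A') := by
    refine hE'.unique ht ((hasPathDeriv_expFun ht (h.smoothFun.map hm) (hAe t ht) hw
      (hA'.map ht hm h.smoothFun)).congr ht fun s hs => ?_)
    rw [homotopyExp, formExp_fst]
  rw [homotopyExp, formExp_fst] at hc
  rw [homotopyExp, formExp_snd (hAe t ht) (hw t ht) (weightGE_hbar_neg_mul (h.weight_B t ht)),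
    twisted_expFun_mul hS.degree.even (hAe t ht) (hw t ht) hBo, hc, zero_mul, zero_add, hE,
    ← mul_add] at hcd
  have h1 := congrArg (hbar 𝕜 b.dualDeg 1 * ·) (eq_zero_of_expFun_mul (hw t ht) hcd)
  simp only [mul_add, mul_zero] at h1
  rw [hbar_mul_twisted, hbar_mul_hbar_neg, bracket, ← bracketOf_hbar_mul_left,
    ← bracketOf_hbar_mul_right, hbar_mul_hbar_neg, hbar_mul_hbar_neg, hbar_mul_hbar_neg] at h1
  rw [twisted_add]
  exact eq_neg_of_add_eq_zero_right h1

/-- The commutator of the twisted Laplacian with the vector field of an odd function. -/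
theorem twisted_bracket {S B : Functions b} (hS : parityFun S = S) (hB : parityFun B = -B)
    (F : Functions b) :
    twisted S (bracket B F) = bracket (twisted S B) F + bracket B (twisted S F) := by
  have hΩ := isOddForm_invForm X b
  simp only [twisted, laplacian, bracket]
  rw [laplacianOf_bracketOf hΩ hB, bracketOf_add_left, bracketOf_add_right,
    bracketOf_hbar_mul_left, bracketOf_hbar_mul_right, bracketOf_jacobi hΩ hB,
    bracketOf_comm_of_odd hΩ hB hS, bracketOf_neg_left, mul_add]
  abel

/-- The defect of the relation at `F` has as derivative the defect at `X_t F`, a function of higher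
weight, and it vanishes at `t = 0`; so it vanishes throughout. -/
theorem intertwines_of_isFlow (hS : IsFreeAction Sfree) (h : IsHomotopy Sfree A B)
    {Φ : ℝ → FormalMap b b} (hΦ : IsFlow B Φ) {t : ℝ} (ht : t ∈ Set.Icc (0 : ℝ) 1)
    (F : Functions b) : (Φ t).pullback (twisted (Sfree + A t) F) =
      twisted (Sfree + A 0) ((Φ t).pullback F) := by
  have hB := h.isFlowGenerator
  have hfl := hΦ.isFlowFamily
  have hwS : ∀ s ∈ Set.Icc (0 : ℝ) 1, WeightGE (Sfree + A s) 2 := fun s hs =>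
    hS.weightGE.add ((h.weight_A s hs).mono (by norm_num))
  have hT : ∀ s ∈ Set.Icc (0 : ℝ) 1, IsFiltered 0 (twisted (Sfree + A s)) := fun s hs =>
    twisted_filtered (hwS s hs)
  have hT0 := hT 0 zero_mem_unitInterval
  obtain ⟨m, hm⟩ := exists_weightGE F
  rw [← sub_eq_zero]
  ext w
  rw [comp_zero, ← Submodule.mem_bot 𝕜]
  refine mem_of_hasPathDeriv (α := Functions b) (level := fun m F => WeightGE F m)
    (D := fun t F => (Φ t).pullback (twisted (Sfree + A t) F) -
      twisted (Sfree + A 0) ((Φ t).pullback F)) (fun _ => ⊥) 0 ?_ ?_ ?_ hm ht w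
  · intro m F hF t ht
    have h1 := (Φ t).filtered.weight _ _ ((hT t ht).weight m F hF)
    have h2 := hT0.weight _ _ ((Φ t).filtered.weight m F hF)
    exact (h1.mono (by omega)).sub (h2.mono (by omega))
  · intro m F _ w
    simp [hΦ.zero]
  · intro m F hF t ht
    obtain ⟨A', hA'⟩ := h.smoothFun.exists_deriv ht
    obtain ⟨k, hk⟩ := exists_filtered_bracket_left (X.invForm b) F
    have hAF : HasPathDeriv (fun s => bracket (A s) F) (bracket A' F) t :=
      hA'.map ht hk h.smoothFun
    have hTd : HasPathDeriv (fun s => twisted (Sfree + A s) F) (bracket A' F) t := by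
      have := (hasPathDeriv_const (twisted Sfree F) t).add hAF
      rw [zero_add] at this
      exact this.congr ht fun s _ => twisted_add Sfree (A s) F
    have hTs : SmoothFun fun s => twisted (Sfree + A s) F := by
      simp only [twisted_add]
      exact (smoothFun_const _).add (h.smoothFun.map hk)
    have d1 := HasPathDeriv.apply ht (fun s _ => (Φ s).filtered)
      (((Φ t).filtered).comp (hB.filtered (X.invForm b) ht)) (fun F => hΦ.deriv F t ht) hTs hTd
    have d2 := (hΦ.deriv F t ht).map ht hT0 (hfl.smooth hB F)
    refine ⟨_, d1.sub d2, fun w hw => ?_⟩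
    have h1 := hw (bracket (-B t) F) ((hB.filtered (X.invForm b) ht).weight m F hF)
    -- The motion of `T_t` compensates its commutator with the vector field: `T_t {-B, F} =
    -- {T_t(-B), F} + {-B, T_t F}`, and `T_t(-B) = A'` by the equation of motion.
    have h2 : bracketOf (X.invForm b) (-B t) (twisted (Sfree + A t) F) + bracket A' F =
        twisted (Sfree + A t) (bracket (-B t) F) := by
      have h3 := twisted_bracket (hS.degree.add (h.degree_A t ht)).even (hB.odd ht) F
      rw [h3, h.deriv_eq hS ht hA', ← (hT t ht).map_neg, add_comm]
      rfl
    rw [← map_add, h2]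
    exact h1

end HomotopyEquations

end BV

end

/-- The flow of a homotopy between two quantum `L_∞` structures intertwines the twisted
Laplacians, and its value at time `1` is a quantum `L_∞`-morphism. -/
theorem mainTheorem7 {𝕜 V ι : Type*} [RCLike 𝕜] [AddCommGroup V] [Module 𝕜 V]
    (X : BV.OddSymplecticSpace 𝕜 V) (b : BV.HomogeneousBasis X ι)
    (Sfree : BV.Functions b) (hSfree : BV.IsFreeAction Sfree)
    (A B : ℝ → BV.Functions b) (hAB : BV.IsHomotopy Sfree A B) :
    (∃ Φ : ℝ → BV.FormalMap b b, BV.IsFlow B Φ) ∧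
    ∀ Φ : ℝ → BV.FormalMap b b, BV.IsFlow B Φ →
      (∀ t ∈ Set.Icc (0 : ℝ) 1, ∀ F : BV.Functions b,
        (Φ t).pullback (BV.twisted (Sfree + A t) F) =
          BV.twisted (Sfree + A 0) ((Φ t).pullback F)) ∧
      BV.IsQuantumLInftyMorphism (Sfree + A 0) (Sfree + A 1) (Φ 1) ∧
      ((∀ t ∈ Set.Icc (0 : ℝ) 1, BV.IsRegular (B t)) →
        ∀ t ∈ Set.Icc (0 : ℝ) 1, ∀ F : BV.Functions b,
          BV.IsRegular F → BV.IsRegular ((Φ t).pullback F)) := by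
  have hΩ := BV.isOddForm_invForm X b
  have hB := hAB.isFlowGenerator
  have h0 : (0 : ℝ) ∈ Set.Icc (0 : ℝ) 1 := BV.zero_mem_unitInterval
  have h1 : (1 : ℝ) ∈ Set.Icc (0 : ℝ) 1 := ⟨zero_le_one, le_rfl⟩
  refine ⟨BV.exists_isFlow hB, fun Φ hΦ =>
    ⟨fun t ht F => BV.intertwines_of_isFlow hSfree hAB hΦ ht F,
      ⟨hAB.isQuantumLInfty hSfree h0, hAB.isQuantumLInfty hSfree h1,
        fun F G => hΦ.isFlowFamily.map_bracketOf hΩ hB h1 F G,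
        fun F => BV.intertwines_of_isFlow hSfree hAB hΦ h1 F⟩,
      fun hreg t ht F hF => hΦ.isFlowFamily.isRegular hΩ hB hreg hF ht⟩⟩
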